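/- **Setting.** For a complex $n\times(n+k)$ matrix $A$ let $$\Phi(A)=\binom{n+k}{n}^{-1}\sum_{S}|\mathrm{Per}(A_S)|^2$$ (the "temperament"), where $S$ runs over the $n$-element sets of columns and $A_S$ is the corresponding $n\times n$ submatrix. Let $\mathcal N(0,1)_{\mathbb C}^{n\times m}$ denote the law of an $n\times m$ matrix with i.i.d. complex Gaussian entries of mean $0$ and variance $1$. Error bounds are reciprocals of positive integers given in unary. Machines and oracles receive a real matrix through the rounding (down) of the real and imaginary parts of its entries to $p$ binary places, where $p$ is part of the input, in unary. * $\Sigma|\mathrm{GPE}|^2_\pm$: an oracle (a function $\mathcal O$ from queries to integer multiples of $2^{-p}$) *solves the problem for $n\times(n+k)$ matrices at precision $p$ with error bounds $\epsilon',\delta'$* if, with probability at least $1-\delta'$ over $A\sim\mathcal N(0,1)_{\mathbb C}^{n\times(n+k)}$, its answer to $(n,k,p,\epsilon',\delta',A\text{ rounded to }p\text{ places})$ is within $\pm\epsilon'\,n!$ of $\Phi(A)$. * $|\mathrm{GPE}|^2_\pm$: a probabilistic oracle machine $M^{\mathcal O}$ *solves the problem for $n\times n$ matrices at precision $p$ with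 error bounds $\epsilon,\delta$* if, with probability at least $1-\delta$ over $X\sim\mathcal N(0,1)_{\mathbb C}^{n\times n}$, on input $(n,p,\epsilon,\delta,X\text{ rounded to }p\text{ places})$ it outputs, with probability at least $2/3$ over its coin flips, a number within $\pm\epsilon\,n!$ of $|\mathrm{Per}(X)|^2$. **Theorem.** Fix $k\ge 0$ (with $0^0=1$). There are constants $C,c>0$, depending only on $k$, error bounds $\epsilon'=\epsilon'(n,\epsilon,\delta)$ and $\delta'=\delta'(n,\epsilon,\delta)$ (reciprocals of positive integers) with $$\epsilon'\ \ge\ C\,\frac{\epsilon\,\delta^{k+1/2}\,k^{k/2}}{n^{k/2}(n+k)^k},\qquad \delta'\ \ge\ c\,\delta ,$$ and a probabilistic oracle machine $M$ such that: 1. $M$ runs in polynomial time: for every oracle and all coin flips, its running time (with bit costs) is bounded by a fixed polynomial in $n$, $p$, $1/\epsilon$, $1/\delta$ and the total number of bits of the entries of its input matrix; 2. for every oracle $\mathcal O$, all $n\ge1$, $p\ge0$ and all $\epsilon,\delta$: if $\mathcal O$ solves $\Sigma|\mathrm{GPE}|^2_\pm$ for $n\times(n+k)$ matrices at precision $p$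 with error bounds $\epsilon',\delta'$, then $M^{\mathcal O}$ solves $|\mathrm{GPE}|^2_\pm$ for $n\times n$ matrices at precision $p$ with error bounds $\epsilon,\delta$. In particular, if $\mathcal O$ solves $\Sigma|\mathrm{GPE}|^2_\pm$ with additive error $\epsilon'\,n!$, where $\epsilon'$ is of order $\epsilon\,\delta^{k+1/2}k^{k/2}/(n^{k/2}(n+k)^k)$, then $|\mathrm{GPE}|^2_\pm$ can be solved in $\mathrm{BPP}^{\mathcal O}$. -/

import Mathlib

open MeasureTheory ProbabilityTheory
open scoped ENNReal

namespace LossyBS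

/-! ### Gaussian matrices, permanents and the temperament -/

/-- The standard complex Gaussian law: mean `0`, variance `E|z|² = 1`. -/
noncomputable def complexGaussian : Measure ℂ :=
  ((gaussianReal 0 (1 / 2)).prod (gaussianReal 0 (1 / 2))).map
    (fun z : ℝ × ℝ => (⟨z.1, z.2⟩ : ℂ))

/-- The law of an `n × m` matrix with i.i.d. standard complex Gaussian entries. -/
noncomputable def gaussianMatrix (n m : ℕ) : Measure (Fin n → Fin m → ℂ) :=
  Measure.pi fun _ => Measure.pi fun _ => complexGaussian

/-- `|Per X|²`. -/
noncomputable def perSq {n : ℕ} (X : Fin n → Fin n → ℂ) : ℝ :=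
  ‖(Matrix.of X).permanent‖ ^ 2

/-- The temperament `Φ(A)`: the average of `|Per A_S|²` over the `n × n` submatrices `A_S` of the
`n × (n + k)` matrix `A`; a choice of `n` columns is a strictly increasing map
`Fin n → Fin (n + k)`. -/
noncomputable def temperament {n k : ℕ} (A : Fin n → Fin (n + k) → ℂ) : ℝ :=
  (∑ S : Fin n ↪o Fin (n + k), perSq fun i j => A i (S j)) / ((n + k).choose n : ℝ)

/-! ### Finite precision -/

/-- Entrywise rounding (down) to `p` binary places, real and imaginary part separately;
the integers `(u, v)` stand for `(u + v i) / 2 ^ p`. -/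
noncomputable def roundMatrix {n m : ℕ} (p : ℕ) (A : Fin n → Fin m → ℂ) :
    Fin n → Fin m → ℤ × ℤ :=
  fun i j => (⌊2 ^ p * (A i j).re⌋, ⌊2 ^ p * (A i j).im⌋)

/-- The entries of an integer matrix, row by row. -/
def entries {n m : ℕ} (Z : Fin n → Fin m → ℤ × ℤ) : List ℤ :=
  (List.ofFn fun i => (List.ofFn fun j => [(Z i j).1, (Z i j).2]).flatten).flatten

/-- Number of binary digits of (the absolute value of) an integer. -/
def bitLen (z : ℤ) : ℕ := Nat.size z.natAbs

/-- Total number of binary digits in a list of integers. -/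
def bitLenList (l : List ℤ) : ℕ := (l.map bitLen).sum

/-! ### Probabilistic oracle machines

A random access machine over the integers with logarithmic (bit length) cost, fair coin flips and
queries to a function oracle. Memory cells have integer addresses. -/

/-- A function oracle: it answers a finite sequence of integers by an integer. -/
abbrev Oracle := List ℤ → ℤ

/-- Programs. A numeral argument is the address of a memory cell. -/
inductive Cmd : Type
  /-- `[d] := z` -/
  | const (d : ℕ) (z : ℤ)
  /-- `[d] := [s] + [t]` -/
  | add (d s t : ℕ)
  /-- `[d] := [s] - [t]` -/
  | sub (d s t : ℕ)
  /-- `[d] := [s] * [t]` -/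
  | mul (d s t : ℕ)
  /-- `[d] := [s] / [t]`, division with remainder, `0` if `[t] = 0` -/
  | div (d s t : ℕ)
  /-- `[d] := [[s]]` -/
  | load (d s : ℕ)
  /-- `[[d]] := [s]` -/
  | store (d s : ℕ)
  /-- `[d] :=` a fresh fair random bit -/
  | coin (d : ℕ)
  /-- `[d] :=` the oracle's answer to the query stored in the `[t]` cells from address `[s]` on;
  `[l]` is the number of answer bits that the machine is prepared to read, and a longer answer is
  saturated at `± 2 ^ [l]` -/
  | ask (d s t l : ℕ)
  | seq (c₁ c₂ : Cmd)
  /-- if `[r] > 0` then `c₁` else `c₂` -/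
  | ite (r : ℕ) (c₁ c₂ : Cmd)
  /-- while `[r] > 0` do `c` -/
  | loop (r : ℕ) (c : Cmd)

/-- Memory contents, and the time used so far. -/
structure Config where
  mem : ℤ → ℤ
  time : ℕ

/-- Write `z` to address `d` at cost `t`. -/
def Config.write (s : Config) (d z : ℤ) (t : ℕ) : Config :=
  ⟨Function.update s.mem d z, s.time + t⟩

/-- Let time `t` pass. -/
def Config.tick (s : Config) (t : ℕ) : Config := ⟨s.mem, s.time + t⟩

/-- An answer read with `l` bits. -/
def saturate (l : ℕ) (z : ℤ) : ℤ := max (-2 ^ l) (min (2 ^ l) z)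

/-- The content of the `len` cells from address `base` on. -/
def Config.block (s : Config) (base : ℤ) (len : ℕ) : List ℤ :=
  (List.range len).map fun i => s.mem (base + i)

/-- A while loop with condition `[r] > 0` and body `f`, given up (`none`) after the number of
tests in the third argument. -/
noncomputable def iterate (r : ℕ) (f : Config → PMF (Option Config)) :
    ℕ → Config → PMF (Option Config)
  | 0, _ => PMF.pure none
  | j + 1, s =>
    if 0 < s.mem r then
      (f (s.tick (1 + bitLen (s.mem r)))).bind fun o =>
        match o with
        | none => PMF.pure none
        | some s' => iterate r f j s'
    else PMF.pure (some (s.tick (1 + bitLen (s.mem r))))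

/-- The law of the final configuration of a program; `none` means that some loop was given up
after `fuel` tests. Every test of a loop costs at least one unit of time, so nothing is given up
in a computation that takes time less than `fuel`. -/
noncomputable def eval (O : Oracle) (fuel : ℕ) : Cmd → Config → PMF (Option Config)
  | .const d z, s => PMF.pure (some (s.write d z (1 + bitLen z)))
  | .add d x y, s => PMF.pure (some
      (s.write d (s.mem x + s.mem y) (1 + bitLen (s.mem x) + bitLen (s.mem y))))
  | .sub d x y, s => PMF.pure (some
      (s.write d (s.mem x - s.mem y) (1 + bitLen (s.mem x) + bitLen (s.mem y))))
  | .mul d x y, s => PMF.pure (some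
      (s.write d (s.mem x * s.mem y) (1 + bitLen (s.mem x) + bitLen (s.mem y))))
  | .div d x y, s => PMF.pure (some
      (s.write d (s.mem x / s.mem y) (1 + bitLen (s.mem x) + bitLen (s.mem y))))
  | .load d x, s => PMF.pure (some
      (s.write d (s.mem (s.mem x)) (1 + bitLen (s.mem x) + bitLen (s.mem (s.mem x)))))
  | .store d x, s => PMF.pure (some
      (s.write (s.mem d) (s.mem x) (1 + bitLen (s.mem d) + bitLen (s.mem x))))
  | .coin d, s => (PMF.uniformOfFintype Bool).map fun r =>
      some (s.write d (if r then 1 else 0) 1)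
  | .ask d x t l, s =>
      PMF.pure (some (s.write d
        (saturate (s.mem l).toNat (O (s.block (s.mem x) (s.mem t).toNat)))
        (1 + bitLen (s.mem x) + bitLen (s.mem t) + bitLen (s.mem l) + (s.mem t).toNat +
          bitLenList (s.block (s.mem x) (s.mem t).toNat) + (s.mem l).toNat)))
  | .seq c₁ c₂, s => (eval O fuel c₁ s).bind fun o =>
      match o with
      | none => PMF.pure none
      | some s' => eval O fuel c₂ s'
  | .ite r c₁ c₂, s =>
      if 0 < s.mem r then eval O fuel c₁ (s.tick (1 + bitLen (s.mem r)))
      else eval O fuel c₂ (s.tick (1 + bitLen (s.mem r)))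
  | .loop r c, s => iterate r (eval O fuel c) fuel s

/-- Initially the input occupies the cells `0, 1, 2, …`, and all other cells hold `0`. -/
def initial (x : List ℤ) : Config :=
  ⟨fun z => if 0 ≤ z then x.getD z.toNat 0 else 0, 0⟩

/-- On input `x`, the program halts within time `T`, whatever the coin flips. -/
def HaltsWithin (M : Cmd) (O : Oracle) (x : List ℤ) (T : ℕ) : Prop :=
  ∀ o ∈ (eval O (T + 1) M (initial x)).support, ∃ s : Config, o = some s ∧ s.time ≤ T

/-- The output of a program is a fraction, with numerator in cell `0` and denominator in
cell `1`. -/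
noncomputable def Config.output (s : Config) : ℝ := (s.mem 0 : ℝ) / (s.mem 1 : ℝ)

/-- The probability over the coin flips that the program halts on input `x` with an output
in `S`. -/
noncomputable def outputProb (M : Cmd) (O : Oracle) (x : List ℤ) (S : Set ℝ) : ℝ≥0∞ :=
  ⨆ fuel : ℕ, (eval O fuel M (initial x)).toOuterMeasure
    {o | ∃ s : Config, o = some s ∧ s.output ∈ S}

/-! ### The two estimation problems

Error bounds are given as `ε = 1 / a`, `δ = 1 / b` with positive integers `a`, `b`; these and the
number `p` of binary places count in unary. -/

/-- Input for the estimation of `|Per X|²`. -/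
def gpeInput {n : ℕ} (p a b : ℕ) (Z : Fin n → Fin n → ℤ × ℤ) : List ℤ :=
  [(n : ℤ), (p : ℤ), (a : ℤ), (b : ℤ)] ++ entries Z

/-- Length of that input. -/
def gpeSize {n : ℕ} (p a b : ℕ) (Z : Fin n → Fin n → ℤ × ℤ) : ℕ :=
  n + p + a + b + bitLenList (entries Z)

/-- The oracle query for the estimation of `Φ(A)`. -/
def sigmaQuery {n k : ℕ} (p m d : ℕ) (Z : Fin n → Fin (n + k) → ℤ × ℤ) : List ℤ :=
  [(n : ℤ), (k : ℤ), (p : ℤ), (m : ℤ), (d : ℤ)] ++ entries Z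

/-- `M` is a probabilistic polynomial time oracle program: its running time is polynomial in the
length of the input, for every oracle and all coin flips. -/
def PolyTime (M : Cmd) : Prop :=
  ∃ q : Polynomial ℕ, ∀ (O : Oracle) (n p a b : ℕ), 0 < n → 0 < a → 0 < b →
    ∀ Z : Fin n → Fin n → ℤ × ℤ,
      HaltsWithin M O (gpeInput p a b Z) (q.eval (gpeSize p a b Z))

/-- With error bounds `ε' = 1 / m`, `δ' = 1 / d` and entries given to `p` binary places, the
oracle estimates `Φ(A)` to within `± ε' n!` with probability at least `1 - δ'` over a Gaussian
`n × (n + k)` matrix `A`. An answer `z` stands for the number `z / 2 ^ p`. -/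
def SolvesSigmaGPE (O : Oracle) (k n p m d : ℕ) : Prop :=
  1 - 1 / (d : ℝ≥0∞) ≤ gaussianMatrix n (n + k)
    {A | |(O (sigmaQuery p m d (roundMatrix p A)) : ℝ) / 2 ^ p - temperament A| ≤
      1 / (m : ℝ) * (n.factorial : ℝ)}

/-- With error bounds `ε = 1 / a`, `δ = 1 / b` and entries given to `p` binary places, the
program with the oracle estimates `|Per X|²` with bounded error: with probability at least `1 - δ`
over a Gaussian `n × n` matrix `X`, its output is within `± ε n!` of `|Per X|²` with probability
at least `2 / 3` over its coin flips. -/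
def SolvesGPE (M : Cmd) (O : Oracle) (n p a b : ℕ) : Prop :=
  1 - 1 / (b : ℝ≥0∞) ≤ gaussianMatrix n n
    {X | 2 / 3 ≤ outputProb M O (gpeInput p a b (roundMatrix p X))
      {y | |y - perSq X| ≤ 1 / (a : ℝ) * (n.factorial : ℝ)}}

/-- `ε δ^(k+1/2) k^(k/2) / (n^(k/2) (n+k)^k)`. -/
noncomputable def errorRate (k n : ℕ) (ε δ : ℝ) : ℝ :=
  ε * δ ^ ((k : ℝ) + 1 / 2) * (k : ℝ) ^ ((k : ℝ) / 2) /
    ((n : ℝ) ^ ((k : ℝ) / 2) * ((n : ℝ) + (k : ℝ)) ^ k)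

end LossyBS

/-! Append to X a Gaussian n × k block Y whose entries are multiplied by c. An n × n submatrix that
uses i of the extra columns gains the factor c^(2i) in |Per|², so Φ([X | cY]) is a polynomial of
degree at most k in c². Its constant term is |Per X|² / binom(n+k, n), because only one choice of
columns avoids Y (`temperament_extend`). The oracle cannot be trusted at c = 0, where the matrix is
far from Gaussian. It is asked at the k + 1 values c_j = M/(M+j), all close to 1, and the answers
are extrapolated to 0. In the variable t = (M+j)² the reversed polynomial has the wanted number as
leading coefficient, and the Lagrange weights are at most (2M)^k (`extrapolate`, `abs_weight_le`).
The oracle's error is thus multiplied by at most binom(n+k, n) (k+1) (2M)^k.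

How small M may be is decided by a change of measure. The law of kn complex Gaussian entries scaled
by c has a density with second moment at most (1 - (1-c²)²)^(-kn), about 1 + kn(1-c²)²
(`gaussianMatrix_scaling`). If kn(1-c²)² ≤ τ ≤ 1/2, the probability of any event at most doubles, up
to an additive 2τ (`DensitySqLE.preimage_le`, `extend_event_le`). Since 1 - c_j² ≤ 2k/M, an M of
order √n/δ suffices. The loss is then of order n^(k/2) δ^(-k) (n+k)^k, so an ε' of order ε δ^k /
(n^(k/2) (n+k)^k) is enough; this is at least the required rate because δ ≤ 1.

The machine owns only fair bits, so Y has to be simulated. One sample is a centred sum of 2N coarse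
bits, refined by q fine bits. Its law is dominated pointwise by e^(2/L) times a discretized Gaussian
law (`choose_div_le_gaussianReal`). A one-sided bound is enough, since only failure has to be
unlikely, and the 2nk samples together cost a factor of at most 3. The grid is chosen so that
rounding c_j Y is an exact floor division of the sample (`floor_scale`). Hence each query is
literally the rounding of [X | c_j Y] for every Y in the cell of the sample, and discretization adds
no error to the estimate. Markov's inequality over X then leaves, outside a set of measure at most
δ, at least two thirds of the bit strings good (`many_goodCoins`).

The program is verified with total-correctness triples `Runs`, which carry a step count together
with a uniform bound on the length of all numbers in memory. All coins are flipped in a single loop,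
so the law of the final configuration is the image of the uniform law on bit strings
(`eval_program`). Answers are read with a limited number of bits; this bounds the running time for
every oracle and, by moment bounds on the entries, does not affect the good runs. -/

namespace LossyBS

/-! ### The temperament as a polynomial in the scaling of the extra columns -/

/-- `X` followed by the columns of `Y` scaled by `c`. -/
noncomputable def extend {n k : ℕ} (c : ℝ) (X : Fin n → Fin n → ℂ) (Y : Fin n → Fin k → ℂ) :
    Fin n → Fin (n + k) → ℂ :=
  fun i => Fin.append (X i) fun j => (c : ℂ) * Y i j

theorem perSq_mul_columns {n : ℕ} (d : Fin n → ℝ) (B : Fin n → Fin n → ℂ) :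
    perSq (fun i j => (d j : ℂ) * B i j) = (∏ j, d j) ^ 2 * perSq B := by
  have h : (Matrix.of fun i j => (d j : ℂ) * B i j).permanent
      = (∏ j, (d j : ℂ)) * (Matrix.of B).permanent := by
    simp only [Matrix.permanent, Matrix.of_apply, Finset.prod_mul_distrib, Finset.mul_sum]
  rw [perSq, h, norm_mul, mul_pow, perSq, ← Complex.ofReal_prod, Complex.norm_real,
    Real.norm_eq_abs, sq_abs]

/-- The number of selected columns among the last `k`. -/
def extraColumns {n k : ℕ} (S : Fin n ↪o Fin (n + k)) : ℕ :=
  (Finset.univ.filter fun j => n ≤ (S j : ℕ)).card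

theorem extraColumns_le {n k : ℕ} (S : Fin n ↪o Fin (n + k)) : extraColumns S ≤ k := by
  have h : ((Finset.univ.filter fun j => n ≤ (S j : ℕ)).image fun j => (S j : ℕ))
      ⊆ Finset.Ico n (n + k) := by
    intro x hx
    obtain ⟨j, hj, rfl⟩ := Finset.mem_image.1 hx
    exact Finset.mem_Ico.2 ⟨(Finset.mem_filter.1 hj).2, (S j).isLt⟩
  have := Finset.card_le_card h
  rw [Finset.card_image_of_injective _ (fun a b hab => S.injective (Fin.ext hab))] at this
  simpa [extraColumns] using this

/-- An injection of n columns into the first n is onto, and an increasing map is determined by its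
range. -/
theorem eq_castAdd_of_extraColumns_eq_zero {n k : ℕ} (S : Fin n ↪o Fin (n + k))
    (h : extraColumns S = 0) (j : Fin n) : S j = Fin.castAdd k j := by
  have hlt : ∀ j, (S j : ℕ) < n := by
    intro j
    by_contra hj
    have : j ∈ (Finset.univ.filter fun j => n ≤ (S j : ℕ)) := by simpa using hj
    rw [Finset.card_eq_zero.1 h] at this
    simp at this
  have hr : Set.range S = Set.range (Fin.castAdd k : Fin n → Fin (n + k)) := by
    have hsub : Finset.univ.image S ⊆ Finset.univ.image (Fin.castAdd k) := by
      intro x hx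
      obtain ⟨i, -, rfl⟩ := Finset.mem_image.1 hx
      exact Finset.mem_image.2 ⟨⟨S i, hlt i⟩, Finset.mem_univ _, rfl⟩
    have heq := Finset.eq_of_subset_of_card_le hsub (by
      rw [Finset.card_image_of_injective _ S.injective,
        Finset.card_image_of_injective _ (Fin.castAdd_injective n k)])
    simpa using congrArg (fun s : Finset (Fin (n + k)) => (s : Set (Fin (n + k)))) heq
  exact congrFun ((S.strictMono.range_inj (Fin.strictMono_castAdd k)).1 hr) j

theorem perSq_extend_submatrix {n k : ℕ} (c : ℝ) (X : Fin n → Fin n → ℂ) (Y : Fin n → Fin k → ℂ)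
    (S : Fin n ↪o Fin (n + k)) :
    perSq (fun i j => extend c X Y i (S j))
      = c ^ (2 * extraColumns S) * perSq fun i j => extend 1 X Y i (S j) := by
  have h : (fun i j => extend c X Y i (S j)) = fun i j =>
      (((if n ≤ (S j : ℕ) then c else 1 : ℝ)) : ℂ) * extend 1 X Y i (S j) := by
    funext i j
    simp only [extend]
    refine Fin.addCases (fun u => ?_) (fun u => ?_) (S j)
    · simp [Nat.not_le.2 u.isLt]
    · simp
  rw [h, perSq_mul_columns, Finset.prod_ite, Finset.prod_const, Finset.prod_const_one, mul_one,
    ← pow_mul, mul_comm _ 2]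
  rfl

/-- Isolates the constant term of the polynomial: only the initial segment of columns avoids the
extra block. -/
theorem card_extraColumns_eq_zero {n k : ℕ} (f : (Fin n ↪o Fin (n + k)) → ℝ) :
    (∑ S ∈ Finset.univ.filter (fun S : Fin n ↪o Fin (n + k) => extraColumns S = 0), f S)
      = f (Fin.castAddOrderEmb k) := by
  have : Finset.univ.filter (fun S : Fin n ↪o Fin (n + k) => extraColumns S = 0)
      = {Fin.castAddOrderEmb k} := by
    ext S
    simp only [Finset.mem_filter, Finset.mem_univ, true_and, Finset.mem_singleton]
    constructor
    · intro h
      ext j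
      rw [eq_castAdd_of_extraColumns_eq_zero S h j]
      rfl
    · rintro rfl
      refine Finset.card_eq_zero.2 (Finset.filter_eq_empty_iff.2 fun j _ => ?_)
      have : ((Fin.castAddOrderEmb k j : Fin (n + k)) : ℕ) = j := rfl
      rw [this]
      exact Nat.not_le.2 j.isLt
  rw [this, Finset.sum_singleton]

/-- Group the submatrices by the number of extra columns they use. The coefficients depend on X and
Y but not on c, which is what permits extrapolation in c for a fixed pair. -/
theorem temperament_extend {n k : ℕ} (X : Fin n → Fin n → ℂ) (Y : Fin n → Fin k → ℂ) :
    ∃ a : ℕ → ℝ, (∀ c : ℝ, temperament (extend c X Y)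
        = ∑ i ∈ Finset.range (k + 1), a i * c ^ (2 * i)) ∧
      a 0 = perSq X / ((n + k).choose n : ℝ) := by
  refine ⟨fun i => (∑ S ∈ Finset.univ.filter
      (fun S : Fin n ↪o Fin (n + k) => extraColumns S = i),
      perSq fun u j => extend 1 X Y u (S j)) / ((n + k).choose n : ℝ), fun c => ?_, ?_⟩
  · rw [temperament]
    simp_rw [perSq_extend_submatrix c]
    rw [← Finset.sum_fiberwise_of_maps_to (s := Finset.univ) (t := Finset.range (k + 1))
      (g := fun S : Fin n ↪o Fin (n + k) => extraColumns S)
      (fun S _ => Finset.mem_range.2 (Nat.lt_succ_of_le (extraColumns_le S))), Finset.sum_div]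
    refine Finset.sum_congr rfl fun i _ => ?_
    rw [div_mul_eq_mul_div, Finset.sum_mul]
    congr 1
    refine Finset.sum_congr rfl fun S hS => ?_
    rw [(Finset.mem_filter.1 hS).2, mul_comm]
  · simp only
    rw [card_extraColumns_eq_zero]
    congr 2
    funext i j
    have : (Fin.castAddOrderEmb k j : Fin (n + k)) = Fin.castAdd k j := rfl
    rw [this, extend, Fin.append_left]

/-! ### Extrapolation -/

/-- The denominator of the extrapolation weight of the node `M + j`. -/
def weightDen (k : ℕ) (M : ℤ) (j : ℕ) : ℤ :=
  ∏ i ∈ (Finset.range (k + 1)).erase j, ((M + j) ^ 2 - (M + i) ^ 2)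

/-- With t = (M+j)², the inner sum is t^(-k) P(t) for a polynomial P of degree at most k whose
coefficient at t^k is `a 0`. Lagrange interpolation expresses this coefficient as the sum of P(t_j)
/ ∏ (t_j - t_i). -/
theorem extrapolate (k : ℕ) (M : ℤ) (hM : 0 < M) (a : ℕ → ℝ) :
    a 0 = ∑ j ∈ Finset.range (k + 1), (((M : ℝ) + j) ^ (2 * k) / (weightDen k M j : ℝ)) *
      ∑ i ∈ Finset.range (k + 1), a i * ((M : ℝ) / (M + j)) ^ (2 * i) := by
  have hM' : (0 : ℝ) < M := by exact_mod_cast hM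
  let P : Polynomial ℝ := ∑ i ∈ Finset.range (k + 1),
    Polynomial.C (a i * (M : ℝ) ^ (2 * i)) * Polynomial.X ^ (k - i)
  let v : ℕ → ℝ := fun j => ((M : ℝ) + j) ^ 2
  have hinj : Set.InjOn v (Finset.range (k + 1)) := by
    intro x _ y _ hxy
    have := (sq_eq_sq₀ (by positivity) (by positivity)).1 hxy
    exact_mod_cast (add_left_cancel this)
  have hdeg : P.degree < (Finset.range (k + 1)).card := by
    rw [Finset.card_range]
    refine (Polynomial.degree_sum_le _ _).trans_lt ?_
    refine (Finset.sup_lt_iff (WithBot.bot_lt_coe _)).2 fun i _ => ?_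
    refine (Polynomial.degree_C_mul_X_pow_le _ _).trans_lt ?_
    exact_mod_cast Nat.lt_succ_of_le (Nat.sub_le k i)
  have key := Lagrange.coeff_eq_sum hinj hdeg
  have hcoeff : P.coeff k = a 0 := by
    rw [Polynomial.finsetSum_coeff, Finset.sum_eq_single 0]
    · simp
    · intro i hi h0
      rw [Polynomial.coeff_C_mul_X_pow, if_neg]
      have := Finset.mem_range.1 hi
      omega
    · simp
  rw [Finset.card_range, Nat.add_sub_cancel, hcoeff] at key
  rw [key]
  refine Finset.sum_congr rfl fun j _ => ?_
  have hD : (∏ i ∈ (Finset.range (k + 1)).erase j, (v j - v i)) = (weightDen k M j : ℝ) := by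
    simp [weightDen, v]
  rw [hD, div_mul_eq_mul_div, Polynomial.eval_finsetSum, Finset.mul_sum]
  congr 1
  refine Finset.sum_congr rfl fun i hi => ?_
  have hi' : i ≤ k := Nat.le_of_lt_succ (Finset.mem_range.1 hi)
  have hpos : (0 : ℝ) < M + j := by positivity
  simp only [Polynomial.eval_mul, Polynomial.eval_C, Polynomial.eval_pow, Polynomial.eval_X, v]
  rw [div_pow, ← pow_mul]
  have : ((M : ℝ) + j) ^ (2 * k) = (M + j) ^ (2 * (k - i)) * (M + j) ^ (2 * i) := by
    rw [← pow_add]; congr 1; omega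
  rw [this]
  field_simp

theorem weightDen_ne_zero (k : ℕ) (M : ℤ) (hM : 0 < M) (j : ℕ) : weightDen k M j ≠ 0 := by
  refine Finset.prod_ne_zero_iff.2 fun i hi h => ?_
  have hij := (Finset.mem_erase.1 hi).1
  have h1 : (M + j) ^ 2 = (M + i) ^ 2 := by linarith
  have := (sq_eq_sq₀ (by positivity) (by positivity)).1 h1
  omega

/-- The numerator is at most (2M)^(2k), because j ≤ k ≤ M. Each of the k factors (j - i)(2M + i + j)
of the denominator has absolute value at least 2M. -/
theorem abs_weight_le (k : ℕ) (M : ℤ) (hM : 0 < M) (hk : (k : ℤ) ≤ M) (j : ℕ) (hj : j ≤ k) :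
    |((M : ℝ) + j) ^ (2 * k) / (weightDen k M j : ℝ)| ≤ (2 * M) ^ k := by
  have hM' : (0 : ℝ) < M := by exact_mod_cast hM
  have hcard : ((Finset.range (k + 1)).erase j).card = k := by
    rw [Finset.card_erase_of_mem (Finset.mem_range.2 (by omega)), Finset.card_range]; rfl
  have hpos : (0 : ℝ) < (2 * M) ^ k := by positivity
  have hden : (2 * (M : ℝ)) ^ k ≤ |(weightDen k M j : ℝ)| := by
    rw [weightDen, Int.cast_prod, Finset.abs_prod]
    calc (2 * (M : ℝ)) ^ k = ∏ i ∈ (Finset.range (k + 1)).erase j, (2 * (M : ℝ)) := by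
          rw [Finset.prod_const, hcard]
      _ ≤ _ := by
          refine Finset.prod_le_prod (fun _ _ => by positivity) fun i hi => ?_
          have hij := (Finset.mem_erase.1 hi).1
          have h1 : (((M + j) ^ 2 - (M + i) ^ 2 : ℤ) : ℝ) = ((j : ℝ) - i) * (2 * M + i + j) := by
            push_cast; ring
          rw [h1, abs_mul]
          have h2 : (1 : ℝ) ≤ |(j : ℝ) - i| := by
            have : (1 : ℤ) ≤ |(j : ℤ) - i| := Int.one_le_abs (by omega)
            exact_mod_cast this
          have h3 : (2 * (M : ℝ)) ≤ |2 * (M : ℝ) + i + j| := by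
            rw [abs_of_nonneg (by positivity)]
            have : (0 : ℝ) ≤ i := Nat.cast_nonneg i
            have : (0 : ℝ) ≤ j := Nat.cast_nonneg j
            linarith
          nlinarith
  rw [abs_div, abs_of_nonneg (by positivity : (0 : ℝ) ≤ ((M : ℝ) + j) ^ (2 * k))]
  rw [div_le_iff₀ (hpos.trans_le hden)]
  calc ((M : ℝ) + j) ^ (2 * k) ≤ (2 * M) ^ (2 * k) := by
        have : (j : ℝ) ≤ M := by
          have : (j : ℤ) ≤ M := by omega
          exact_mod_cast this
        gcongr; linarith
    _ = (2 * M) ^ k * (2 * M) ^ k := by rw [two_mul k, pow_add]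
    _ ≤ _ := by gcongr

/-- Estimates of the temperament at the `k + 1` scalings `M / (M + j)` yield an estimate of
`|Per X|²`. -/
theorem abs_extrapolation_sub_perSq_le {n k : ℕ} (X : Fin n → Fin n → ℂ) (Y : Fin n → Fin k → ℂ)
    (M : ℤ) (hM : 0 < M) (hk : (k : ℤ) ≤ M) (z : ℕ → ℝ) (η : ℝ)
    (hz : ∀ j ≤ k, |z j - temperament (extend ((M : ℝ) / (M + j)) X Y)| ≤ η) :
    |((n + k).choose n : ℝ) * (∑ j ∈ Finset.range (k + 1),
        (((M : ℝ) + j) ^ (2 * k) / (weightDen k M j : ℝ)) * z j) - perSq X|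
      ≤ ((n + k).choose n : ℝ) * ((k + 1) * ((2 * M) ^ k * η)) := by
  obtain ⟨a, ha, ha0⟩ := temperament_extend X Y
  have hc : (0 : ℝ) < ((n + k).choose n : ℝ) := by
    exact_mod_cast Nat.choose_pos (Nat.le_add_right n k)
  have hM' : (0 : ℝ) < M := by exact_mod_cast hM
  have hper : perSq X = ((n + k).choose n : ℝ) * a 0 := by
    rw [ha0]; field_simp
  rw [hper, extrapolate k M hM a, ← mul_sub, abs_mul, abs_of_pos hc, ← Finset.sum_sub_distrib]
  refine mul_le_mul_of_nonneg_left ?_ hc.le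
  refine (Finset.abs_sum_le_sum_abs _ _).trans ?_
  refine (Finset.sum_le_card_nsmul _ _ ((2 * (M : ℝ)) ^ k * η) fun j hj => ?_).trans_eq ?_
  · have hj' : j ≤ k := Nat.le_of_lt_succ (Finset.mem_range.1 hj)
    rw [← mul_sub, abs_mul, ← ha]
    exact mul_le_mul (abs_weight_le k M hM hk j hj') (hz j hj') (abs_nonneg _) (by positivity)
  · rw [Finset.card_range, nsmul_eq_mul]; push_cast; ring

/-! ### Scaling Gaussian matrices -/

/-- The law of `f` under `μ` has a density with respect to `μ` whose second moment is at
most `V`. -/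
def DensitySqLE {α : Type*} [MeasurableSpace α] (μ : Measure α) (f : α → α) (V : ℝ≥0∞) : Prop :=
  Measurable f ∧ ∃ r : α → ℝ≥0∞, Measurable r ∧ μ.map f = μ.withDensity r ∧ ∫⁻ x, r x ^ 2 ∂μ ≤ V

/-- Independence of the coordinates of a product measure, in the form needed for densities of
product form. -/
theorem lintegral_pi_prod {ι : Type*} [Fintype ι] {α : Type*} [MeasurableSpace α]
    (μ : Measure α) [IsProbabilityMeasure μ] (g : ι → α → ℝ≥0∞) (hg : ∀ i, Measurable (g i)) :
    ∫⁻ x : ι → α, ∏ i, g i (x i) ∂(Measure.pi fun _ => μ) = ∏ i, ∫⁻ x, g i x ∂μ := by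
  have hi : iIndepFun (fun i (ω : ι → α) => g i (ω i)) (Measure.pi fun _ => μ) :=
    iIndepFun_pi fun i => (hg i).aemeasurable
  rw [lintegral_prod_eq_prod_lintegral_of_indepFun Finset.univ _ hi
    fun i => (hg i).comp (measurable_pi_apply i)]
  refine Finset.prod_congr rfl fun i _ => ?_
  exact (measurePreserving_eval (fun _ : ι => μ) i).lintegral_comp (hg i)

theorem pi_withDensity {ι : Type*} [Fintype ι] {α : Type*} [MeasurableSpace α]
    (μ : Measure α) [IsProbabilityMeasure μ] (r : α → ℝ≥0∞) (hr : Measurable r)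
    [SigmaFinite (μ.withDensity r)] :
    (Measure.pi fun _ : ι => μ.withDensity r)
      = (Measure.pi fun _ : ι => μ).withDensity fun x => ∏ i, r (x i) := by
  refine Measure.pi_eq fun s hs => ?_
  rw [withDensity_apply _ (MeasurableSet.univ_pi hs),
    ← lintegral_indicator (MeasurableSet.univ_pi hs)]
  have h : (Set.univ.pi s).indicator (fun x : ι → α => ∏ i, r (x i))
      = fun x => ∏ i, (s i).indicator r (x i) := by
    funext x
    by_cases hx : x ∈ Set.univ.pi s
    · rw [Set.indicator_of_mem hx]
      exact Finset.prod_congr rfl fun i _ =>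
        (Set.indicator_of_mem (hx i (Set.mem_univ i)) r).symm
    · rw [Set.indicator_of_notMem hx]
      simp only [Set.mem_pi, Set.mem_univ, true_implies, not_forall] at hx
      obtain ⟨i, hi⟩ := hx
      exact (Finset.prod_eq_zero (Finset.mem_univ i) (Set.indicator_of_notMem hi r)).symm
  rw [h, lintegral_pi_prod μ _ fun i => hr.indicator (hs i)]
  refine Finset.prod_congr rfl fun i _ => ?_
  rw [withDensity_apply _ (hs i), lintegral_indicator (hs i)]

/-- Densities and their second moments are both multiplicative over independent coordinates. -/
theorem DensitySqLE.pi {ι : Type*} [Fintype ι] {α : Type*} [MeasurableSpace α]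
    {μ : Measure α} [IsProbabilityMeasure μ] {f : α → α} {V : ℝ≥0∞} (h : DensitySqLE μ f V) :
    DensitySqLE (Measure.pi fun _ : ι => μ) (fun x i => f (x i)) (V ^ Fintype.card ι) := by
  obtain ⟨hf, r, hr, hmap, hV⟩ := h
  refine ⟨measurable_pi_lambda _ fun i => hf.comp (measurable_pi_apply i),
    fun x => ∏ i, r (x i), ?_, ?_, ?_⟩
  · exact Finset.measurable_prod _ fun i _ => hr.comp (measurable_pi_apply i)
  · have : IsProbabilityMeasure (μ.map f) := Measure.isProbabilityMeasure_map hf.aemeasurable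
    have : IsProbabilityMeasure (μ.withDensity r) := hmap ▸ this
    rw [← pi_withDensity μ r hr, Measure.pi_map_pi (fun _ => hf.aemeasurable)]
    simp_rw [hmap]
  · simp_rw [← Finset.prod_pow]
    rw [lintegral_pi_prod μ (fun _ x => r x ^ 2) fun _ => hr.pow_const 2, Finset.prod_const,
      Finset.card_univ]
    gcongr

theorem DensitySqLE.prod {α β : Type*} [MeasurableSpace α] [MeasurableSpace β]
    {μ : Measure α} {ν : Measure β} [IsProbabilityMeasure μ] [IsProbabilityMeasure ν]
    {f : α → α} {g : β → β} {V W : ℝ≥0∞} (h : DensitySqLE μ f V) (h' : DensitySqLE ν g W) :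
    DensitySqLE (μ.prod ν) (Prod.map f g) (V * W) := by
  obtain ⟨hf, r, hr, hmap, hV⟩ := h
  obtain ⟨hg, t, ht, hmap', hW⟩ := h'
  refine ⟨hf.prodMap hg, fun z => r z.1 * t z.2, by fun_prop, ?_, ?_⟩
  · rw [← prod_withDensity hr ht, ← hmap, ← hmap', Measure.map_prod_map _ _ hf hg]
  · simp_rw [mul_pow]
    rw [lintegral_prod_mul (hr.pow_const 2).aemeasurable (ht.pow_const 2).aemeasurable]
    gcongr

/-- Invariance under measurable isomorphisms; it serves to pass from pairs of reals to complex
numbers. -/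
theorem DensitySqLE.conj {α β : Type*} [MeasurableSpace α] [MeasurableSpace β]
    {μ : Measure α} {f : α → α} {V : ℝ≥0∞} (h : DensitySqLE μ f V) (e : α ≃ᵐ β) :
    DensitySqLE (μ.map e) (e ∘ f ∘ e.symm) V := by
  obtain ⟨hf, r, hr, hmap, hV⟩ := h
  refine ⟨e.measurable.comp (hf.comp e.symm.measurable), r ∘ e.symm, hr.comp e.symm.measurable,
    ?_, ?_⟩
  · rw [Measure.map_map (e.measurable.comp (hf.comp e.symm.measurable)) e.measurable]
    have : (e ∘ f ∘ e.symm) ∘ e = e ∘ f := by funext x; simp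
    rw [this, ← Measure.map_map e.measurable hf, hmap]
    ext s hs
    rw [Measure.map_apply e.measurable hs, withDensity_apply _ (e.measurable hs),
      withDensity_apply _ hs, setLIntegral_map hs (hr.comp e.symm.measurable) e.measurable]
    simp
  · rw [lintegral_map ((hr.comp e.symm.measurable).pow_const 2) e.measurable]
    simpa using hV

/-- The event estimate behind the change of measure. -/
theorem DensitySqLE.preimage_le {α : Type*} [MeasurableSpace α] {μ : Measure α}
    [IsProbabilityMeasure μ] {f : α → α} {V : ℝ≥0∞} (h : DensitySqLE μ f V) {F : Set α}
    (hF : MeasurableSet F) : μ (f ⁻¹' F) + 1 ≤ 2 * μ F + V := by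
  obtain ⟨hf, r, hr, hmap, hV⟩ := h
  have h1 : μ (f ⁻¹' F) = ∫⁻ x in F, r x ∂μ := by
    rw [← Measure.map_apply hf hF, hmap, withDensity_apply _ hF]
  have htot : ∫⁻ x, r x ∂μ = 1 := by
    have := congrArg (fun ν : Measure α => ν Set.univ) hmap
    simp only [withDensity_apply _ MeasurableSet.univ, Measure.restrict_univ] at this
    rw [← this, Measure.map_apply hf MeasurableSet.univ]; simp
  -- Completing the square: 3r ≤ 3 + r² on F and 2r ≤ 1 + r² off F. Integrated against a density of
  -- total mass 1, this keeps the excess V - 1 additive at the cost of a factor 2 on the measure of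
  -- F.
  have hpt : ∀ x, 2 * r x + F.indicator r x ≤ 1 + F.indicator (fun _ => 2) x + r x ^ 2 := by
    intro x
    rcases eq_or_ne (r x) ∞ with hx | hx
    · simp [hx]
    · obtain ⟨t, ht⟩ : ∃ t : NNReal, r x = t := ⟨(r x).toNNReal, (ENNReal.coe_toNNReal hx).symm⟩
      by_cases hxF : x ∈ F
      · simp only [Set.indicator_of_mem hxF, ht]
        norm_cast
        rw [← NNReal.coe_le_coe]; push_cast
        nlinarith [sq_nonneg ((t : ℝ) - 3 / 2)]
      · simp only [Set.indicator_of_notMem hxF, ht, add_zero]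
        norm_cast
        rw [← NNReal.coe_le_coe]; push_cast
        nlinarith [sq_nonneg ((t : ℝ) - 1)]
  have hint := lintegral_mono (μ := μ) hpt
  rw [lintegral_add_left (hr.const_mul 2), lintegral_const_mul 2 hr, htot,
    lintegral_indicator hF, ← h1, lintegral_add_right _ (hr.pow_const 2),
    lintegral_add_left measurable_const, lintegral_indicator hF] at hint
  simp only [lintegral_const, measure_univ, mul_one, Measure.restrict_apply MeasurableSet.univ,
    Set.univ_inter] at hint
  have h2 : 1 + (μ (f ⁻¹' F) + 1) ≤ 1 + (2 * μ F + V) := by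
    calc 1 + (μ (f ⁻¹' F) + 1) = 2 + μ (f ⁻¹' F) := by rw [← one_add_one_eq_two]; ring
      _ ≤ _ := hint
      _ ≤ 1 + 2 * μ F + V := by gcongr
      _ = _ := by ring
  exact (ENNReal.add_le_add_iff_left (by simp)).1 h2

/-- The density of N(0, c²/2) with respect to N(0, 1/2) is c⁻¹ exp(-(c⁻² - 1)x²). Its second moment
is a Gaussian integral with exponent 2c⁻² - 1, which is positive since c ≤ 1, and 1 - (1-c²)² =
c⁴(2c⁻² - 1). -/
theorem gaussianReal_scaling (c : ℝ) (h0 : 0 < c) (h1 : c ≤ 1) :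
    DensitySqLE (gaussianReal 0 (1 / 2)) (fun x => c * x)
      (ENNReal.ofReal (1 / √(1 - (1 - c ^ 2) ^ 2))) := by
  refine ⟨by fun_prop, fun x => ENNReal.ofReal (c⁻¹ * Real.exp (-((c ^ 2)⁻¹ - 1) * x ^ 2)),
    by fun_prop, ?_, ?_⟩
  · rw [gaussianReal_map_const_mul, gaussianReal_of_var_ne_zero _ (v := 1 / 2) (by norm_num),
      gaussianReal_of_var_ne_zero, ← withDensity_mul _ (measurable_gaussianPDF _ _) (by fun_prop)]
    · congr 1
      funext x
      simp only [Pi.mul_apply, gaussianPDF, mul_zero]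
      rw [← ENNReal.ofReal_mul (gaussianPDFReal_nonneg _ _ _)]
      congr 1
      simp only [gaussianPDFReal]
      push_cast
      have h2 : √(2 * Real.pi * (c ^ 2 * (1 / 2))) = c * √(2 * Real.pi * (1 / 2)) := by
        rw [show 2 * Real.pi * (c ^ 2 * (1 / 2)) = c ^ 2 * (2 * Real.pi * (1 / 2)) by ring,
          Real.sqrt_mul (by positivity), Real.sqrt_sq h0.le]
      have h3 : Real.exp (-(x - 0) ^ 2 / (2 * (c ^ 2 * (1 / 2))))
          = Real.exp (-(x - 0) ^ 2 / (2 * (1 / 2))) * Real.exp (-((c ^ 2)⁻¹ - 1) * x ^ 2) := by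
        rw [← Real.exp_add]; congr 1; field_simp; ring
      rw [h2, h3, mul_inv]
      ring
    · refine mul_ne_zero ?_ (by norm_num)
      simpa [← NNReal.coe_ne_zero] using h0.ne'
  · have hb : 0 < 2 * (c ^ 2)⁻¹ - 1 := by
      have : 1 ≤ (c ^ 2)⁻¹ := (one_le_inv₀ (by positivity)).2 (pow_le_one₀ h0.le h1)
      linarith
    rw [gaussianReal_of_var_ne_zero _ (v := 1 / 2) (by norm_num),
      lintegral_withDensity_eq_lintegral_mul _ (measurable_gaussianPDF _ _) (by fun_prop)]
    have h : ∀ x : ℝ, (gaussianPDF 0 (1 / 2) * fun x =>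
        ENNReal.ofReal (c⁻¹ * Real.exp (-((c ^ 2)⁻¹ - 1) * x ^ 2)) ^ 2) x
        = ENNReal.ofReal ((c ^ 2)⁻¹ * (√Real.pi)⁻¹ *
          Real.exp (-(2 * (c ^ 2)⁻¹ - 1) * x ^ 2)) := by
      intro x
      simp only [Pi.mul_apply, gaussianPDF]
      rw [← ENNReal.ofReal_pow (by positivity), ← ENNReal.ofReal_mul (gaussianPDFReal_nonneg _ _ _)]
      congr 1
      simp only [gaussianPDFReal]
      push_cast
      rw [mul_pow, ← Real.exp_nat_mul,
        show -(2 * (c ^ 2)⁻¹ - 1) * x ^ 2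
          = -(x - 0) ^ 2 / (2 * (1 / 2)) + (2 : ℕ) * (-((c ^ 2)⁻¹ - 1) * x ^ 2) by
            push_cast; ring, Real.exp_add, show 2 * Real.pi * (1 / 2) = Real.pi by ring]
      push_cast
      ring
    rw [lintegral_congr h, ← ofReal_integral_eq_lintegral_ofReal
      ((integrable_exp_neg_mul_sq hb).const_mul _) (ae_of_all _ fun x => by positivity),
      integral_const_mul, integral_gaussian]
    refine ENNReal.ofReal_le_ofReal (le_of_eq ?_)
    rw [Real.sqrt_div Real.pi_pos.le]
    have hp : √Real.pi ≠ 0 := (Real.sqrt_pos.2 Real.pi_pos).ne'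
    have h4 : 1 - (1 - c ^ 2) ^ 2 = (c ^ 2) ^ 2 * (2 * (c ^ 2)⁻¹ - 1) := by
      field_simp; ring
    rw [h4, Real.sqrt_mul (by positivity), Real.sqrt_sq (by positivity)]
    field_simp


theorem complexGaussian_eq :
    complexGaussian = ((gaussianReal 0 (1 / 2)).prod (gaussianReal 0 (1 / 2))).map
      Complex.measurableEquivRealProd.symm := rfl

instance : IsProbabilityMeasure complexGaussian := by
  rw [complexGaussian_eq]
  exact Measure.isProbabilityMeasure_map Complex.measurableEquivRealProd.symm.measurable.aemeasurable

instance (n m : ℕ) : IsProbabilityMeasure (gaussianMatrix n m) := by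
  unfold gaussianMatrix; infer_instance

/-- The real and imaginary parts contribute the same factor, so the square root disappears. -/
theorem complexGaussian_scaling (c : ℝ) (h0 : 0 < c) (h1 : c ≤ 1) :
    DensitySqLE complexGaussian (fun z => c * z) (ENNReal.ofReal (1 / (1 - (1 - c ^ 2) ^ 2))) := by
  have hx : 0 ≤ 1 - (1 - c ^ 2) ^ 2 := by
    have : c ^ 2 ≤ 1 := pow_le_one₀ h0.le h1
    nlinarith [sq_nonneg c]
  have h := ((gaussianReal_scaling c h0 h1).prod (gaussianReal_scaling c h0 h1)).conj
    Complex.measurableEquivRealProd.symm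
  rw [← complexGaussian_eq, ← ENNReal.ofReal_mul (by positivity), div_mul_div_comm, one_mul,
    Real.mul_self_sqrt hx] at h
  convert h using 1
  funext z
  simp only [Function.comp_apply, MeasurableEquiv.symm_symm]
  apply Complex.ext <;> simp [Complex.measurableEquivRealProd]

theorem gaussianMatrix_scaling (n k : ℕ) (c : ℝ) (h0 : 0 < c) (h1 : c ≤ 1) :
    DensitySqLE (gaussianMatrix n k) (fun Y i j => c * Y i j)
      (ENNReal.ofReal (1 / (1 - (1 - c ^ 2) ^ 2)) ^ (k * n)) := by
  have h := ((complexGaussian_scaling c h0 h1).pi (ι := Fin k)).pi (ι := Fin n)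
  simp only [Fintype.card_fin, ← pow_mul] at h
  exact h

/-- Bernoulli's inequality gives (1-u)^N ≥ 1 - τ, and 1/(1-τ) ≤ 1 + 2τ for τ ≤ 1/2. -/
theorem inv_one_sub_pow_le (N : ℕ) (u τ : ℝ) (hu0 : 0 ≤ u) (hu1 : u < 1) (hτ : N * u ≤ τ)
    (hτ' : τ ≤ 1 / 2) : (1 / (1 - u)) ^ N ≤ 1 + 2 * τ := by
  have hb : 1 - τ ≤ (1 - u) ^ N := by
    have := one_add_mul_le_pow (a := -u) (by linarith) N
    rw [← sub_eq_add_neg] at this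
    linarith
  have hτ0 : 0 ≤ τ := le_trans (by positivity) hτ
  rw [one_div, inv_pow, inv_le_comm₀ (by positivity) (by positivity)]
  refine le_trans ?_ hb
  rw [inv_le_iff_one_le_mul₀ (by positivity)]
  nlinarith

/-- The second moment differs from 1 only to second order in 1 - c². So kn entries tolerate a 1 - c²
of order √(τ/(kn)), and this is why the nodes need only be of size √n. -/
theorem gaussianMatrix_scaled_event_le {n k : ℕ} {c τ : ℝ} (h0 : 0 < c) (h1 : c ≤ 1)
    (hτ : (k * n : ℕ) * (1 - c ^ 2) ^ 2 ≤ τ) (hτ' : τ ≤ 1 / 2)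
    {F : Set (Fin n → Fin k → ℂ)} (hF : MeasurableSet F) :
    gaussianMatrix n k {Y | (fun i j => (c : ℂ) * Y i j) ∈ F}
      ≤ 2 * gaussianMatrix n k F + ENNReal.ofReal (2 * τ) := by
  have h := (gaussianMatrix_scaling n k c h0 h1).preimage_le hF
  have hc : c ^ 2 ≤ 1 := pow_le_one₀ h0.le h1
  have hc0 : 0 < c ^ 2 := by positivity
  have hu : (1 - c ^ 2) ^ 2 < 1 := by nlinarith
  have hV : ENNReal.ofReal (1 / (1 - (1 - c ^ 2) ^ 2)) ^ (k * n)
      ≤ ENNReal.ofReal (2 * τ) + 1 := by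
    rw [← ENNReal.ofReal_pow (by have := sub_pos.2 hu; positivity), ← ENNReal.ofReal_one,
      ← ENNReal.ofReal_add (by have : 0 ≤ τ := le_trans (by positivity) hτ
                               positivity) zero_le_one]
    refine ENNReal.ofReal_le_ofReal ?_
    rw [add_comm]
    exact inv_one_sub_pow_le _ _ τ (sq_nonneg _) hu hτ hτ'
  have h2 := h.trans (add_le_add_right hV _)
  rw [← add_assoc] at h2
  exact (ENNReal.add_le_add_iff_right (by simp)).1 h2

/-! ### Gluing independent Gaussian blocks -/

theorem measurePreserving_append (n k : ℕ) {α : Type*} [MeasurableSpace α] (μ : Measure α)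
    [IsProbabilityMeasure μ] :
    MeasurePreserving (fun z : (Fin n → α) × (Fin k → α) => (Fin.append z.1 z.2 : Fin (n + k) → α))
      ((Measure.pi fun _ => μ).prod (Measure.pi fun _ => μ)) (Measure.pi fun _ => μ) := by
  have hm : Measurable
      (fun z : (Fin n → α) × (Fin k → α) => (Fin.append z.1 z.2 : Fin (n + k) → α)) := by
    refine measurable_pi_lambda _ fun i => ?_
    refine Fin.addCases (fun u => ?_) (fun u => ?_) i
    · simp only [Fin.append_left]; fun_prop
    · simp only [Fin.append_right]; fun_prop
  refine ⟨hm, (Measure.pi_eq fun s hs => ?_).symm⟩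
  rw [Measure.map_apply hm (MeasurableSet.univ_pi hs)]
  have : (fun z : (Fin n → α) × (Fin k → α) => (Fin.append z.1 z.2 : Fin (n + k) → α)) ⁻¹'
      Set.univ.pi s = (Set.univ.pi fun i => s (Fin.castAdd k i)) ×ˢ
        (Set.univ.pi fun i => s (Fin.natAdd n i)) := by
    ext z
    simp only [Set.mem_preimage, Set.mem_pi, Set.mem_univ, true_implies, Set.mem_prod]
    constructor
    · intro h
      exact ⟨fun i => by simpa using h (Fin.castAdd k i),
        fun i => by simpa using h (Fin.natAdd n i)⟩
    · rintro ⟨h1, h2⟩ i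
      refine Fin.addCases (fun u => ?_) (fun u => ?_) i
      · simpa using h1 u
      · simpa using h2 u
  rw [this, Measure.prod_prod, Measure.pi_pi, Measure.pi_pi, Fin.prod_univ_add]

/-- Translates events about the oracle's matrices into events about independent pairs (X, Y), on
which Y alone can be scaled. -/
theorem measurePreserving_extend (n k : ℕ) :
    MeasurePreserving (fun z : (Fin n → Fin n → ℂ) × (Fin n → Fin k → ℂ) => extend 1 z.1 z.2)
      ((gaussianMatrix n n).prod (gaussianMatrix n k)) (gaussianMatrix n (n + k)) := by
  have h1 := (measurePreserving_arrowProdEquivProdArrow (Fin n → ℂ) (Fin k → ℂ) (Fin n)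
    (fun _ => Measure.pi fun _ => complexGaussian)
    (fun _ => Measure.pi fun _ => complexGaussian)).symm
  have h2 := measurePreserving_pi (ι := Fin n) _ _
    (fun _ => measurePreserving_append n k complexGaussian)
  have h3 := h2.comp h1
  have he : (fun z : (Fin n → Fin n → ℂ) × (Fin n → Fin k → ℂ) => extend 1 z.1 z.2)
      = (fun a i => Fin.append (a i).1 (a i).2) ∘
        (MeasurableEquiv.arrowProdEquivProdArrow (Fin n → ℂ) (Fin k → ℂ) (Fin n)).symm := by
    funext z i
    simp only [extend, Complex.ofReal_one, one_mul, Function.comp_apply]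
    rfl
  rw [he]
  exact h3

theorem measurable_extend (n k : ℕ) (c : ℝ) :
    Measurable fun z : (Fin n → Fin n → ℂ) × (Fin n → Fin k → ℂ) => extend c z.1 z.2 := by
  refine measurable_pi_lambda _ fun i => measurable_pi_lambda _ fun j => ?_
  refine Fin.addCases (fun u => ?_) (fun u => ?_) j
  · simp only [extend, Fin.append_left]; fun_prop
  · simp only [extend, Fin.append_right]; fun_prop

/-- Scaling the last `k` columns of a Gaussian matrix by a number close to `1` changes the
probability of an event little. -/
theorem extend_event_le {n k : ℕ} {c τ : ℝ} (h0 : 0 < c) (h1 : c ≤ 1)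
    (hτ : (k * n : ℕ) * (1 - c ^ 2) ^ 2 ≤ τ) (hτ' : τ ≤ 1 / 2)
    {B : Set (Fin n → Fin (n + k) → ℂ)} (hB : MeasurableSet B) :
    ((gaussianMatrix n n).prod (gaussianMatrix n k)) {z | extend c z.1 z.2 ∈ B}
      ≤ 2 * gaussianMatrix n (n + k) B + ENNReal.ofReal (2 * τ) := by
  have hms : ∀ c : ℝ, MeasurableSet {z : (Fin n → Fin n → ℂ) × (Fin n → Fin k → ℂ) |
      extend c z.1 z.2 ∈ B} := fun c => measurable_extend n k c hB
  rw [← (measurePreserving_extend n k).measure_preimage hB.nullMeasurableSet,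
    Measure.prod_apply (hms c), Measure.prod_apply ((measurePreserving_extend n k).measurable hB)]
  -- Fubini: for fixed X the slice at scaling c is the preimage under Y ↦ cY of the slice at scaling
  -- 1, so the change of measure acts on Y only.
  calc _ ≤ ∫⁻ X, (2 * gaussianMatrix n k (Prod.mk X ⁻¹' ((fun z : (Fin n → Fin n → ℂ) ×
          (Fin n → Fin k → ℂ) => extend 1 z.1 z.2) ⁻¹' B)) + ENNReal.ofReal (2 * τ))
          ∂(gaussianMatrix n n) := by
        refine lintegral_mono fun X => ?_
        have := gaussianMatrix_scaled_event_le (n := n) (k := k) h0 h1 hτ hτ'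
          (F := Prod.mk X ⁻¹' ((fun z : (Fin n → Fin n → ℂ) ×
          (Fin n → Fin k → ℂ) => extend 1 z.1 z.2) ⁻¹' B))
          (measurable_prodMk_left ((measurePreserving_extend n k).measurable hB))
        convert this using 3
        ext Y
        have : extend c X Y = extend 1 X fun i j => c * Y i j := by
          funext i
          simp [extend]
        simp only [Set.mem_preimage, Set.mem_ofPred_eq, this]
    _ = _ := by
        rw [lintegral_add_right _ measurable_const, lintegral_const_mul]
        · simp
        · exact measurable_measure_prodMk_left ((measurePreserving_extend n k).measurable hB)

/-! ### Tails -/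

theorem gaussianReal_tail (t : ℝ) (ht : 0 < t) :
    gaussianReal 0 (1 / 2) {x | t ≤ |x|} ≤ ENNReal.ofReal (1 / (2 * t ^ 2)) := by
  have h := meas_ge_le_variance_div_sq (μ := gaussianReal 0 (1 / 2)) (X := id)
    (memLp_id_gaussianReal 2) ht
  rw [variance_id_gaussianReal] at h
  simp only [id, integral_id_gaussianReal, sub_zero] at h
  refine h.trans (ENNReal.ofReal_le_ofReal (le_of_eq ?_))
  push_cast
  rw [div_div]

theorem complexGaussian_tail (t : ℝ) (ht : 0 < t) :
    complexGaussian {z | 2 * t < ‖z‖} ≤ ENNReal.ofReal (1 / t ^ 2) := by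
  have hsub : Complex.measurableEquivRealProd.symm ⁻¹' {z : ℂ | 2 * t < ‖z‖} ⊆
      ({x | t ≤ |x|} ×ˢ Set.univ) ∪ (Set.univ ×ˢ {x | t ≤ |x|}) := by
    intro z hz
    by_contra hcon
    simp only [Set.mem_union, Set.mem_prod, Set.mem_ofPred_eq, Set.mem_univ, and_true, true_and,
      not_or, not_le] at hcon
    have h1 := Complex.norm_le_abs_re_add_abs_im (Complex.measurableEquivRealProd.symm z)
    have h2 : 2 * t < ‖Complex.measurableEquivRealProd.symm z‖ := hz
    have h3 : (Complex.measurableEquivRealProd.symm z).re = z.1 := rfl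
    have h4 : (Complex.measurableEquivRealProd.symm z).im = z.2 := rfl
    rw [h3, h4] at h1
    linarith [hcon.1, hcon.2]
  rw [complexGaussian_eq, Measure.map_apply Complex.measurableEquivRealProd.symm.measurable
    (measurableSet_lt measurable_const measurable_norm)]
  refine (measure_mono hsub).trans ((measure_union_le _ _).trans ?_)
  rw [Measure.prod_prod, Measure.prod_prod, measure_univ, one_mul, mul_one]
  refine (add_le_add (gaussianReal_tail t ht) (gaussianReal_tail t ht)).trans_eq ?_
  rw [← ENNReal.ofReal_add (by positivity) (by positivity)]
  congr 1
  field_simp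
  norm_num

/-- Chebyshev and a union bound. The sharper Gaussian decay is not needed, because the size of the
entries matters only for the number of answer bits to be read. -/
theorem gaussianMatrix_tail (n m : ℕ) (t : ℝ) (ht : 0 < t) :
    gaussianMatrix n m {X | ∃ i j, 2 * t < ‖X i j‖} ≤ ENNReal.ofReal (n * m / t ^ 2) := by
  have hset : {X : Fin n → Fin m → ℂ | ∃ i j, 2 * t < ‖X i j‖}
      = ⋃ i, ⋃ j, {X | 2 * t < ‖X i j‖} := by
    ext X; simp
  have hone : ∀ i j, gaussianMatrix n m {X | 2 * t < ‖X i j‖} ≤ ENNReal.ofReal (1 / t ^ 2) := by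
    intro i j
    have h1 := measurePreserving_eval
      (fun _ : Fin n => Measure.pi fun _ : Fin m => complexGaussian) i
    have h2 := measurePreserving_eval (fun _ : Fin m => complexGaussian) j
    have h3 := (h2.comp h1).measure_preimage
      (measurableSet_lt (measurable_const (a := 2 * t)) measurable_norm).nullMeasurableSet
    refine (le_of_eq ?_).trans (complexGaussian_tail t ht)
    rw [← h3]
    rfl
  rw [hset]
  refine (measure_iUnion_fintype_le _ _).trans ?_
  calc _ ≤ ∑ _i : Fin n, ∑ _j : Fin m, ENNReal.ofReal (1 / t ^ 2) :=
        Finset.sum_le_sum fun i _ => (measure_iUnion_fintype_le _ _).trans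
          (Finset.sum_le_sum fun j _ => hone i j)
    _ = _ := by
        simp only [Finset.sum_const, Finset.card_univ, Fintype.card_fin, nsmul_eq_mul]
        rw [← ENNReal.ofReal_natCast n, ← ENNReal.ofReal_natCast m,
          ← ENNReal.ofReal_mul (by positivity), ← ENNReal.ofReal_mul (by positivity)]
        congr 1
        ring

/-! ### Binomial and Gaussian probabilities -/

/-- Keep the first term of log((1+x)/(1-x)) = 2(x + x³/3 + …), whose terms are all nonnegative. -/
theorem one_sub_div_one_add_le_exp (x : ℝ) (h0 : 0 ≤ x) (h1 : x < 1) :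
    (1 - x) / (1 + x) ≤ Real.exp (-(2 * x)) := by
  have hs := Real.hasSum_log_sub_log_of_abs_lt_one (abs_lt.2 ⟨by linarith, h1⟩)
  have h := hs.tsum_eq ▸ hs.summable.le_tsum 0 (fun k _ => by positivity)
  have h' : 2 * x ≤ Real.log (1 + x) - Real.log (1 - x) := by simpa using h
  rw [← Real.log_le_iff_le_exp (by apply div_pos <;> linarith),
    Real.log_div (by linarith) (by linarith)]
  linarith

/-- The ratio of consecutive binomials is (N-d)/(N+d+1) = (1-x)/(1+x) with x = (d + 1/2)/(N + 1/2).
The resulting exponents 2x add up to exactly d²/(N + 1/2). -/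
theorem choose_add_le (N d : ℕ) :
    ((2 * N).choose (N + d) : ℝ) ≤ N.centralBinom * Real.exp (-((d : ℝ) ^ 2 / (N + 1 / 2))) := by
  induction d with
  | zero => simp [Nat.centralBinom]
  | succ d ih =>
    rcases Nat.lt_or_ge N (d + 1) with h | h
    · rw [Nat.choose_eq_zero_of_lt (by omega)]
      simp only [Nat.cast_zero]; positivity
    · have hN : (0 : ℝ) < N + 1 / 2 := by positivity
      have hrec : ((2 * N).choose (N + (d + 1)) : ℝ) * (N + d + 1)
          = (2 * N).choose (N + d) * (N - d) := by
        have := Nat.choose_succ_right_eq (2 * N) (N + d)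
        rw [show 2 * N - (N + d) = N - d by omega] at this
        have h2 := congrArg (Nat.cast (R := ℝ)) this
        push_cast [Nat.cast_sub (show d ≤ N by omega)] at h2
        exact h2
      have hd : (d : ℝ) + 1 ≤ N := by exact_mod_cast h
      set x : ℝ := (d + 1 / 2) / (N + 1 / 2) with hx
      have hx1 : x < 1 := by rw [hx, div_lt_one hN]; linarith
      have hx0 : 0 ≤ x := by positivity
      have hratio : ((N : ℝ) - d) / (N + d + 1) = (1 - x) / (1 + x) := by
        rw [hx]; field_simp; ring
      have hstep : ((2 * N).choose (N + (d + 1)) : ℝ)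
          = (2 * N).choose (N + d) * (((N : ℝ) - d) / (N + d + 1)) := by
        rw [mul_div_assoc', eq_div_iff (by positivity), hrec]
      rw [hstep, hratio]
      calc _ ≤ (N.centralBinom * Real.exp (-((d : ℝ) ^ 2 / (N + 1 / 2))))
            * Real.exp (-(2 * x)) := by
            have h3 : 0 ≤ (1 - x) / (1 + x) := div_nonneg (by linarith) (by linarith)
            exact mul_le_mul ih (one_sub_div_one_add_le_exp x hx0 hx1) h3 (by positivity)
        _ = _ := by
            rw [mul_assoc, ← Real.exp_add]
            congr 2
            rw [hx]
            push_cast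
            field_simp
            ring

theorem choose_le_exp (N S : ℕ) (hS : S ≤ 2 * N) :
    ((2 * N).choose S : ℝ)
      ≤ N.centralBinom * Real.exp (-(((S : ℝ) - N) ^ 2 / (N + 1 / 2))) := by
  rcases Nat.le_total N S with h | h
  · obtain ⟨d, rfl⟩ := Nat.exists_eq_add_of_le h
    have := choose_add_le N d
    push_cast
    rwa [add_sub_cancel_left]
  · obtain ⟨d, hd⟩ := Nat.exists_eq_add_of_le h
    have := choose_add_le N d
    rw [← Nat.choose_symm hS, show 2 * N - S = N + d by omega]
    have hd' : (S : ℝ) - N = -d := by rw [hd]; push_cast; ring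
    rwa [hd', neg_sq]

/-- The partial Wallis product equals (4^N / centralBinom)² / (2N+1), and its known lower bound
gives the claim because (2N+1)² ≥ 4N(N+1). -/
theorem centralBinom_le (N : ℕ) (hN : 0 < N) :
    (N.centralBinom : ℝ) / 4 ^ N ≤ 1 / √(Real.pi * N) := by
  have hW := Real.Wallis.le_W N
  rw [Real.Wallis.W_eq_factorial_ratio] at hW
  have hN' : (0 : ℝ) < N := by exact_mod_cast hN
  have hcb : (N.centralBinom : ℝ) * (N.factorial : ℝ) ^ 2 = ((2 * N).factorial : ℝ) := by
    have := Nat.choose_mul_factorial_mul_factorial (show N ≤ 2 * N by omega)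
    rw [show 2 * N - N = N by omega] at this
    rw [Nat.centralBinom, ← this]; push_cast; ring
  have hcpos : (0 : ℝ) < N.centralBinom := by exact_mod_cast N.centralBinom_pos
  have hf : (0 : ℝ) < (N.factorial : ℝ) := by exact_mod_cast N.factorial_pos
  have hp := Real.pi_pos
  rw [← hcb] at hW
  have h16 : (2 : ℝ) ^ (4 * N) = (4 ^ N) ^ 2 := by
    rw [← pow_mul, show (4 : ℝ) = 2 ^ 2 by norm_num, ← pow_mul]; congr 1; ring
  have h1 : (2 : ℝ) ^ (4 * N) * (N.factorial : ℝ) ^ 4 /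
      (((N.centralBinom : ℝ) * (N.factorial : ℝ) ^ 2) ^ 2 * (2 * N + 1))
      = (4 ^ N / N.centralBinom) ^ 2 / (2 * N + 1) := by
    rw [h16]; field_simp
  rw [h1, le_div_iff₀ (by positivity)] at hW
  have h2 : Real.pi * N ≤ (4 ^ N / (N.centralBinom : ℝ)) ^ 2 := by
    refine le_trans ?_ hW
    rw [show (2 * (N : ℝ) + 1) / (2 * N + 2) * (Real.pi / 2) * (2 * N + 1)
      = Real.pi * ((2 * N + 1) ^ 2 / (4 * (N + 1))) by field_simp; ring]
    refine mul_le_mul_of_nonneg_left ?_ hp.le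
    rw [le_div_iff₀ (by positivity)]
    nlinarith
  have h3 : √(Real.pi * N) ≤ 4 ^ N / (N.centralBinom : ℝ) := Real.sqrt_le_left (by positivity) |>.2 h2
  rw [← one_div_div]
  exact one_div_le_one_div_of_le (Real.sqrt_pos.2 (by positivity)) h3

/-- The cell contains an interval of length 1/σ on which the density is at least π^(-1/2) e^(-A). -/
theorem gaussianReal_cell_ge (σ A : ℝ) (hσ : 0 < σ) (w : ℤ)
    (hA : ∀ y : ℝ, (w : ℝ) ≤ σ * y → σ * y ≤ w + 1 → y ^ 2 ≤ A) :
    ENNReal.ofReal (1 / (σ * √Real.pi) * Real.exp (-A))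
      ≤ gaussianReal 0 (1 / 2) {y | ⌊σ * y⌋ = w} := by
  have hsub : Set.Ico (w / σ) ((w + 1) / σ) ⊆ {y : ℝ | ⌊σ * y⌋ = w} := by
    intro y hy
    have h1 := (div_le_iff₀ hσ).1 hy.1
    have h2 := (lt_div_iff₀ hσ).1 hy.2
    exact Int.floor_eq_iff.2 ⟨by linarith, by linarith⟩
  refine le_trans ?_ (measure_mono hsub)
  rw [gaussianReal_apply _ (v := 1 / 2) (by norm_num)]
  calc _ = ∫⁻ _ in Set.Ico (w / σ) ((w + 1) / σ), ENNReal.ofReal ((√Real.pi)⁻¹ * Real.exp (-A)) := by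
        rw [lintegral_const, Measure.restrict_apply MeasurableSet.univ, Set.univ_inter,
          Real.volume_Ico, ← ENNReal.ofReal_mul (by positivity)]
        congr 1
        field_simp
        ring
    _ ≤ _ := by
        refine setLIntegral_mono' measurableSet_Ico fun y hy => ?_
        refine ENNReal.ofReal_le_ofReal ?_
        simp only [gaussianPDFReal]
        push_cast
        rw [show 2 * Real.pi * (1 / 2) = Real.pi by ring]
        refine mul_le_mul_of_nonneg_left (Real.exp_le_exp.2 ?_) (by positivity)
        have h1 := (div_le_iff₀ hσ).1 hy.1
        have h2 := (lt_div_iff₀ hσ).1 hy.2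
        have := hA y (by linarith) (by linarith)
        rw [sub_zero, show (2 * (1 / 2) : ℝ) = 1 by norm_num, div_one]
        linarith

/-- The law of `S Q + u - (N Q + Q / 2)`, with `S` a sum of `2 N` fair bits and `u` uniform
in `[0, Q)`, is dominated by the discretization of a Gaussian law up to a factor close
to `1`. -/
theorem choose_div_le_gaussianReal (L N Q S u : ℕ) (hL : 2 ≤ L) (hN : N + L = L ^ 2) (hS : S ≤ 2 * N)
    (hQ : 2 ∣ Q) (hu : u < Q) (w : ℤ) (hw : w + (N * Q + Q / 2) = u + Q * S) :
    ENNReal.ofReal ((2 * N).choose S / (4 ^ N * Q)) ≤ ENNReal.ofReal (Real.exp (2 / L)) *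
      gaussianReal 0 (1 / 2) {y | ⌊((Q * L : ℕ) : ℝ) * y⌋ = w} := by
  have hQ0 : 0 < Q := by omega
  have hQ' : (0 : ℝ) < Q := by exact_mod_cast hQ0
  have hL' : (2 : ℝ) ≤ L := by exact_mod_cast hL
  have hNL : (N : ℝ) = L ^ 2 - L := by
    have : (N : ℝ) + L = L ^ 2 := by exact_mod_cast hN
    linarith
  have hN0 : 0 < N := by nlinarith
  have hN' : (0 : ℝ) < N := by exact_mod_cast hN0
  have hu' : (u : ℝ) + 1 ≤ Q := by exact_mod_cast hu
  have hw' : (w : ℝ) = u + Q * (S - N) - Q / 2 := by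
    obtain ⟨h, rfl⟩ := hQ
    have h2 : ((2 * h : ℕ) : ℤ) / 2 = h := by omega
    rw [h2] at hw
    have h3 := congrArg (Int.cast (R := ℝ)) hw
    push_cast at h3 ⊢
    linarith
  set d : ℝ := (S : ℝ) - N with hd
  -- A bounds y² on the cell. There Ly = d + t with t² ≤ 1/4, and a weighted inequality for the
  -- cross term gives (d+t)² ≤ (1 + 1/(2L)) d² + (1 + 2L) t².
  set A : ℝ := ((1 + 1 / (2 * L)) * d ^ 2 + (1 + 2 * L) / 4) / L ^ 2 with hAdef
  have hcell := gaussianReal_cell_ge ((Q * L : ℕ) : ℝ) A (by positivity) w (by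
    intro y h1 h2
    push_cast at h1 h2
    rw [hw'] at h1 h2
    have hu0 : (0 : ℝ) ≤ u := Nat.cast_nonneg u
    have h3 : Q * (d - 1 / 2) ≤ Q * (L * y) := by linarith
    have h4 : Q * (L * y) ≤ Q * (d + 1 / 2) := by linarith
    have h5 := le_of_mul_le_mul_left h3 hQ'
    have h6 := le_of_mul_le_mul_left h4 hQ'
    set t := L * y - d with ht
    have ht2 : t ^ 2 ≤ 1 / 4 := by nlinarith
    have hy : L * y = d + t := by rw [ht]; ring
    rw [hAdef, le_div_iff₀ (by positivity), show y ^ 2 * (L : ℝ) ^ 2 = (L * y) ^ 2 by ring, hy]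
    have h7 : 2 * d * t ≤ 1 / (2 * L) * d ^ 2 + 2 * L * t ^ 2 := by
      have h8 : 1 / (2 * (L : ℝ)) * d ^ 2 + 2 * L * t ^ 2 - 2 * d * t
          = 1 / (2 * L) * (d - 2 * L * t) ^ 2 := by field_simp; ring
      have h9 : 0 ≤ 1 / (2 * (L : ℝ)) * (d - 2 * L * t) ^ 2 := by positivity
      linarith
    nlinarith)
  refine le_trans ?_ (mul_le_mul_right hcell _)
  rw [← ENNReal.ofReal_mul (by positivity)]
  refine ENNReal.ofReal_le_ofReal ?_
  -- The first of the two factors e^(1/L): the normalization of the binomial law involves √N, that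
  -- of the Gaussian cell involves L.
  have hsqL : (L : ℝ) / √N ≤ Real.exp (1 / L) := by
    rw [div_le_iff₀ (by positivity)]
    refine le_of_sq_le_sq ?_ (by positivity)
    rw [mul_pow, Real.sq_sqrt hN'.le, ← Real.exp_nat_mul, hNL]
    have := Real.add_one_le_exp ((2 : ℕ) * (1 / (L : ℝ)))
    have h2 : (2 / (L : ℝ) + 1) * ((L : ℝ) ^ 2 - L) = L ^ 2 + L - 2 := by field_simp; ring
    push_cast at this ⊢
    rw [mul_one_div] at this ⊢
    nlinarith
  -- Here N = L² - L pays off: with this deficit, 1/(N + 1/2) still exceeds (1 + 1/(2L))/L², so the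
  -- binomial exponent absorbs the cross term of the fine part. The constant term that remains is at
  -- most 1/L, which is the second factor e^(1/L).
  have hAle : -(d ^ 2 / (N + 1 / 2)) ≤ 1 / L - A := by
    have h1 : (1 + 1 / (2 * (L : ℝ))) / L ^ 2 ≤ 1 / (N + 1 / 2) := by
      rw [div_le_div_iff₀ (by positivity) (by positivity), hNL]
      have : (1 + 1 / (2 * (L : ℝ))) * (L ^ 2 - L + 1 / 2) = L ^ 2 - L / 2 + 1 / (4 * L) := by
        field_simp; ring
      rw [this]
      have : 1 / (4 * (L : ℝ)) ≤ L / 2 := by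
        rw [div_le_iff₀ (by positivity)]; nlinarith
      linarith
    have h2 : ((1 + 2 * (L : ℝ)) / 4) / L ^ 2 ≤ 1 / L := by
      rw [div_div, div_le_div_iff₀ (by positivity) (by positivity)]; nlinarith
    have h3 : A = (1 + 1 / (2 * (L : ℝ))) / L ^ 2 * d ^ 2 + ((1 + 2 * (L : ℝ)) / 4) / L ^ 2 := by
      rw [hAdef]; ring
    have h4 := mul_le_mul_of_nonneg_right h1 (sq_nonneg d)
    rw [h3]
    have h5 : 1 / ((N : ℝ) + 1 / 2) * d ^ 2 = d ^ 2 / (N + 1 / 2) := by ring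
    linarith
  have hsp : 0 < √Real.pi := Real.sqrt_pos.2 Real.pi_pos
  have hsN : 0 < √(N : ℝ) := Real.sqrt_pos.2 hN'
  calc ((2 * N).choose S : ℝ) / (4 ^ N * Q)
      ≤ N.centralBinom * Real.exp (-(d ^ 2 / (N + 1 / 2))) / (4 ^ N * Q) := by
        gcongr; exact choose_le_exp N S hS
    _ = (N.centralBinom / 4 ^ N) * (Real.exp (-(d ^ 2 / (N + 1 / 2))) / Q) := by
        field_simp
    _ ≤ (1 / √(Real.pi * N)) * (Real.exp (1 / L - A) / Q) := by
        refine mul_le_mul (centralBinom_le N hN0) ?_ (by positivity) (by positivity)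
        gcongr
    _ = (L / √N) * (1 / ((Q * L : ℕ) * √Real.pi) * Real.exp (1 / L - A)) := by
        rw [Real.sqrt_mul Real.pi_pos.le]
        push_cast
        field_simp
    _ ≤ Real.exp (1 / L) * (1 / ((Q * L : ℕ) * √Real.pi) * Real.exp (1 / L - A)) := by
        gcongr
    _ = Real.exp (2 / L) * (1 / ((Q * L : ℕ) * √Real.pi) * Real.exp (-A)) := by
        rw [show (2 : ℝ) / L = 1 / L + 1 / L by ring, Real.exp_add, sub_eq_add_neg, Real.exp_add]
        ring

/-! ### Cells -/

/-- The matrices whose entries, multiplied by `σ`, round down to `W`. -/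
def cell {n k : ℕ} (σ : ℝ) (W : Fin n → Fin k → ℤ × ℤ) : Set (Fin n → Fin k → ℂ) :=
  {Y | ∀ i j, ⌊σ * (Y i j).re⌋ = (W i j).1 ∧ ⌊σ * (Y i j).im⌋ = (W i j).2}

theorem measurableSet_cell {n k : ℕ} (σ : ℝ) (W : Fin n → Fin k → ℤ × ℤ) :
    MeasurableSet (cell σ W) := by
  have : cell σ W = ⋂ i, ⋂ j, ({Y : Fin n → Fin k → ℂ | ⌊σ * (Y i j).re⌋ = (W i j).1} ∩
      {Y | ⌊σ * (Y i j).im⌋ = (W i j).2}) := by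
    ext Y; simp [cell]
  rw [this]
  refine MeasurableSet.iInter fun i => MeasurableSet.iInter fun j => MeasurableSet.inter ?_ ?_
  · have : Measurable fun Y : Fin n → Fin k → ℂ => ⌊σ * (Y i j).re⌋ := by fun_prop
    exact this (measurableSet_singleton _)
  · have : Measurable fun Y : Fin n → Fin k → ℂ => ⌊σ * (Y i j).im⌋ := by fun_prop
    exact this (measurableSet_singleton _)

theorem disjoint_cell {n k : ℕ} (σ : ℝ) {W W' : Fin n → Fin k → ℤ × ℤ} (h : W ≠ W') :
    Disjoint (cell σ W) (cell σ W') := by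
  refine Set.disjoint_left.2 fun Y hY hY' => h ?_
  funext i j
  exact Prod.ext ((hY i j).1.symm.trans (hY' i j).1) ((hY i j).2.symm.trans (hY' i j).2)

theorem gaussianMatrix_cell {n k : ℕ} (σ : ℝ) (W : Fin n → Fin k → ℤ × ℤ) :
    gaussianMatrix n k (cell σ W) = ∏ i, ∏ j,
      (gaussianReal 0 (1 / 2) {y | ⌊σ * y⌋ = (W i j).1} *
        gaussianReal 0 (1 / 2) {y | ⌊σ * y⌋ = (W i j).2}) := by
  have h : cell σ W = Set.univ.pi fun i => Set.univ.pi fun j =>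
      {z : ℂ | ⌊σ * z.re⌋ = (W i j).1 ∧ ⌊σ * z.im⌋ = (W i j).2} := by
    ext Y; simp [cell]
  rw [h, gaussianMatrix, Measure.pi_pi]
  refine Finset.prod_congr rfl fun i _ => ?_
  rw [Measure.pi_pi]
  refine Finset.prod_congr rfl fun j _ => ?_
  rw [complexGaussian_eq, MeasurableEquiv.map_apply, ← Measure.prod_prod]
  rfl

/-! ### Sampling by fair bits -/

theorem sum_two_pow_bits_lt (q : ℕ) (f : Fin q → Bool) :
    ∑ y : Fin q, 2 ^ (y : ℕ) * (f y).toNat < 2 ^ q := by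
  induction q with
  | zero => simp
  | succ q ih =>
    rw [Fin.sum_univ_succ]
    have h : ∑ y : Fin q, 2 ^ ((y.succ : Fin (q + 1)) : ℕ) * (f y.succ).toNat
        = 2 * ∑ y : Fin q, 2 ^ (y : ℕ) * (f y.succ).toNat := by
      rw [Finset.mul_sum]
      exact Finset.sum_congr rfl fun y _ => by rw [Fin.val_succ, pow_succ]; ring
    have h1 := ih fun y => f y.succ
    have h2 : (f 0).toNat ≤ 1 := Bool.toNat_le _
    rw [h, Fin.val_zero, pow_zero, one_mul, pow_succ]
    omega

theorem sum_two_pow_bits_injective (q : ℕ) :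
    Function.Injective fun f : Fin q → Bool => ∑ y : Fin q, 2 ^ (y : ℕ) * (f y).toNat := by
  induction q with
  | zero => intro f g _; exact Subsingleton.elim f g
  | succ q ih =>
    intro f g hfg
    simp only [Fin.sum_univ_succ] at hfg
    have h : ∀ f : Fin (q + 1) → Bool, ∑ y : Fin q, 2 ^ ((y.succ : Fin (q + 1)) : ℕ) * (f y.succ).toNat
        = 2 * ∑ y : Fin q, 2 ^ (y : ℕ) * (f y.succ).toNat := by
      intro f
      rw [Finset.mul_sum]
      exact Finset.sum_congr rfl fun y _ => by rw [Fin.val_succ, pow_succ]; ring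
    rw [h, h, Fin.val_zero, pow_zero, one_mul, one_mul] at hfg
    have h2 : (f 0).toNat ≤ 1 := Bool.toNat_le _
    have h3 : (g 0).toNat ≤ 1 := Bool.toNat_le _
    have h0 : f 0 = g 0 := by
      have : (f 0).toNat = (g 0).toNat := by omega
      cases hf : f 0 <;> cases hg : g 0 <;> simp_all
    have h1 := ih (a₁ := fun y => f y.succ) (a₂ := fun y => g y.succ) (by simp only; omega)
    funext y
    refine Fin.cases h0 (fun y => congrFun h1 y) y

/-- A bit string is identified with the set of positions of its ones. -/
theorem card_bits_sum_eq_le (m S : ℕ) :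
    (Finset.univ.filter fun f : Fin m → Bool => ∑ y, (f y).toNat = S).card ≤ m.choose S := by
  have h := Finset.card_le_card_of_injOn
    (s := Finset.univ.filter fun f : Fin m → Bool => ∑ y, (f y).toNat = S)
    (t := (Finset.univ : Finset (Fin m)).powersetCard S)
    (fun f => Finset.univ.filter fun y => f y = true) (by
      intro f hf
      have hf' := (Finset.mem_filter.1 hf).2
      refine Finset.mem_coe.2 (Finset.mem_powersetCard.2 ⟨Finset.subset_univ _, ?_⟩)
      rw [← hf', Finset.card_filter]
      exact Finset.sum_congr rfl fun y _ => by cases f y <;> rfl) (by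
      intro f _ g _ hfg
      funext y
      have := congrArg (fun s => y ∈ s) hfg
      simp only [Finset.mem_filter, Finset.mem_univ, true_and, eq_iff_iff] at this
      exact Bool.eq_iff_iff.2 this)
  simpa using h

/-- The integer made of `q` fine and `m` coarse bits. -/
def bitsValue (q m : ℕ) (f : Fin (q + m) → Bool) : ℕ :=
  ∑ y : Fin q, 2 ^ (y : ℕ) * (f (Fin.castAdd m y)).toNat
    + 2 ^ q * ∑ y : Fin m, (f (Fin.natAdd q y)).toNat

/-- Fine and coarse parts are the remainder and the quotient modulo 2^q. The remainder determines
all fine bits, so only coarse bits are left to count. -/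
theorem card_bitsValue_eq_le (q m u S : ℕ) (hu : u < 2 ^ q) :
    (Finset.univ.filter fun f : Fin (q + m) → Bool => bitsValue q m f = u + 2 ^ q * S).card
      ≤ m.choose S := by
  refine le_trans ?_ (card_bits_sum_eq_le m S)
  have hsplit : ∀ f : Fin (q + m) → Bool, bitsValue q m f = u + 2 ^ q * S →
      ∑ y : Fin q, 2 ^ (y : ℕ) * (f (Fin.castAdd m y)).toNat = u ∧
        ∑ y : Fin m, (f (Fin.natAdd q y)).toNat = S := by
    intro f hf
    have h1 := sum_two_pow_bits_lt q fun y => f (Fin.castAdd m y)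
    have hpos : 0 < 2 ^ q := by positivity
    rw [bitsValue] at hf
    have h2 := congrArg (· % 2 ^ q) hf
    have h3 := congrArg (· / 2 ^ q) hf
    simp only [Nat.add_mul_mod_self_left, Nat.mod_eq_of_lt h1, Nat.mod_eq_of_lt hu] at h2
    simp only [Nat.add_mul_div_left _ _ hpos, Nat.div_eq_of_lt h1, Nat.div_eq_of_lt hu,
      zero_add] at h3
    exact ⟨h2, h3⟩
  refine Finset.card_le_card_of_injOn (fun f y => f (Fin.natAdd q y)) (fun f hf => ?_)
    (fun f hf g hg hfg => ?_)
  · exact Finset.mem_coe.2 (Finset.mem_filter.2 ⟨Finset.mem_univ _, (hsplit f (Finset.mem_filter.1 hf).2).2⟩)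
  · have h1 := (hsplit f (Finset.mem_filter.1 hf).2).1
    have h2 := (hsplit g (Finset.mem_filter.1 hg).2).1
    have h3 := sum_two_pow_bits_injective q (a₁ := fun y => f (Fin.castAdd m y))
      (a₂ := fun y => g (Fin.castAdd m y)) (h1.trans h2.symm)
    funext y
    exact Fin.addCases (fun u => congrFun h3 u) (fun u => congrFun hfg u) y

/-- One sample has, up to a factor close to `1`, at most the probability of the discretized
Gaussian law. -/
theorem card_bitsValue_le_gaussianReal (L N q : ℕ) (hL : 2 ≤ L) (hN : N + L = L ^ 2) (hq : 0 < q)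
    (w : ℤ) :
    ((Finset.univ.filter fun f : Fin (q + 2 * N) → Bool =>
      (bitsValue q (2 * N) f : ℤ) - (N * 2 ^ q + 2 ^ q / 2) = w).card : ℝ≥0∞)
      ≤ 2 ^ (q + 2 * N) * (ENNReal.ofReal (Real.exp (2 / L)) *
        gaussianReal 0 (1 / 2) {y | ⌊((2 ^ q * L : ℕ) : ℝ) * y⌋ = w}) := by
  rcases Finset.eq_empty_or_nonempty (Finset.univ.filter fun f : Fin (q + 2 * N) → Bool =>
      (bitsValue q (2 * N) f : ℤ) - (N * 2 ^ q + 2 ^ q / 2) = w) with h | ⟨f₀, hf₀⟩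
  · rw [h]; simp
  · have hf := (Finset.mem_filter.1 hf₀).2
    set u := ∑ y : Fin q, 2 ^ (y : ℕ) * (f₀ (Fin.castAdd (2 * N) y)).toNat with hu
    set S := ∑ y : Fin (2 * N), (f₀ (Fin.natAdd q y)).toNat with hS
    have hv : bitsValue q (2 * N) f₀ = u + 2 ^ q * S := rfl
    have hult : u < 2 ^ q := sum_two_pow_bits_lt q _
    have hSle : S ≤ 2 * N := by
      rw [hS]
      refine (Finset.sum_le_card_nsmul _ _ 1 fun y _ => Bool.toNat_le _).trans ?_
      simp
    have hcard : (Finset.univ.filter fun f : Fin (q + 2 * N) → Bool =>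
        (bitsValue q (2 * N) f : ℤ) - (N * 2 ^ q + 2 ^ q / 2) = w).card ≤ (2 * N).choose S := by
      refine le_trans (Finset.card_le_card ?_) (card_bitsValue_eq_le q (2 * N) u S hult)
      intro f hf'
      have h1 := (Finset.mem_filter.1 hf').2
      refine Finset.mem_filter.2 ⟨Finset.mem_univ _, ?_⟩
      rw [← hv]
      have h2 : (bitsValue q (2 * N) f : ℤ) = bitsValue q (2 * N) f₀ := by linarith
      exact_mod_cast h2
    have hmain := choose_div_le_gaussianReal L N (2 ^ q) S u hL hN hSle
      (dvd_pow_self 2 hq.ne') hult w (by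
        rw [hv] at hf; push_cast at hf ⊢; linarith)
    calc _ ≤ (((2 * N).choose S : ℕ) : ℝ≥0∞) := by exact_mod_cast hcard
      _ = 2 ^ (q + 2 * N) * ENNReal.ofReal ((2 * N).choose S / (4 ^ N * (2 ^ q : ℕ))) := by
          rw [show (2 : ℝ≥0∞) ^ (q + 2 * N) = ENNReal.ofReal (2 ^ (q + 2 * N)) by
            rw [ENNReal.ofReal_pow (by norm_num)]; norm_num, ← ENNReal.ofReal_mul (by positivity),
            ← ENNReal.ofReal_natCast]
          congr 1
          rw [show (2 : ℝ) ^ (q + 2 * N) = 4 ^ N * 2 ^ q by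
            rw [pow_add, pow_mul]; norm_num; ring]
          push_cast
          field_simp
      _ ≤ _ := by gcongr

/-- The `i`-th of `T` bits, as an integer. -/
def bitVal {T : ℕ} (ω : Fin T → Bool) (i : ℕ) : ℤ :=
  if h : i < T then ((ω ⟨i, h⟩).toNat : ℤ) else 0

/-- The `x`-th sample computed from a sequence of bits. -/
def sample (q N : ℕ) (g : ℕ → ℤ) (x : ℕ) : ℤ :=
  ∑ y ∈ Finset.range q, 2 ^ y * g (x * (q + 2 * N) + y)
    + 2 ^ q * ∑ y ∈ Finset.range (2 * N), g (x * (q + 2 * N) + q + y)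
    - (N * 2 ^ q + 2 ^ q / 2)

/-- A matrix of pairs of samples. -/
def sampleMatrix (n k q N : ℕ) (g : ℕ → ℤ) : Fin n → Fin k → ℤ × ℤ :=
  fun i j => (sample q N g (((i : ℕ) * k + j) * 2), sample q N g (((i : ℕ) * k + j) * 2 + 1))

/-- Different samples use disjoint blocks of q + 2N bits, so the count is a product over the samples
and the comparison factors multiply. -/
theorem card_samples_eq_le (L N q X : ℕ) (hL : 2 ≤ L) (hN : N + L = L ^ 2) (hq : 0 < q)
    (w : ℕ → ℤ) :
    ((Finset.univ.filter fun ω : Fin (X * (q + 2 * N)) → Bool =>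
      ∀ x < X, sample q N (bitVal ω) x = w x).card : ℝ≥0∞)
      ≤ 2 ^ (X * (q + 2 * N)) * (ENNReal.ofReal (Real.exp (2 / L)) ^ X *
        ∏ x ∈ Finset.range X,
          gaussianReal 0 (1 / 2) {y | ⌊((2 ^ q * L : ℕ) : ℝ) * y⌋ = w x}) := by
  let e : (Fin X → Fin (q + 2 * N) → Bool) ≃ (Fin (X * (q + 2 * N)) → Bool) :=
    (Equiv.curry _ _ _).symm.trans (finProdFinEquiv.arrowCongr (Equiv.refl Bool))
  have hbit : ∀ (f : Fin X → Fin (q + 2 * N) → Bool) (x : Fin X) (y : Fin (q + 2 * N)),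
      bitVal (e f) ((x : ℕ) * (q + 2 * N) + y) = (f x y).toNat := by
    intro f x y
    have h1 : ((finProdFinEquiv (x, y) : Fin (X * (q + 2 * N))) : ℕ) = x * (q + 2 * N) + y := by
      rw [finProdFinEquiv_apply_val]; ring
    have h2 : e f (finProdFinEquiv (x, y)) = f x y := by
      simp only [e, Equiv.trans_apply, Equiv.arrowCongr_apply, Function.comp_apply,
        Equiv.symm_apply_apply]
      rfl
    rw [← h1, bitVal, dif_pos (Fin.isLt _), Fin.eta, h2]
  have hsample : ∀ (f : Fin X → Fin (q + 2 * N) → Bool) (x : Fin X),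
      sample q N (bitVal (e f)) x = (bitsValue q (2 * N) (f x) : ℤ) - (N * 2 ^ q + 2 ^ q / 2) := by
    intro f x
    rw [sample, bitsValue, Finset.sum_range, Finset.sum_range]
    push_cast
    congr 2
    · exact Finset.sum_congr rfl fun y _ => by rw [← hbit]; rfl
    · congr 1
      exact Finset.sum_congr rfl fun y _ => by
        rw [← hbit, Fin.val_natAdd, add_assoc]
  have hcard : (Finset.univ.filter fun ω : Fin (X * (q + 2 * N)) → Bool =>
      ∀ x < X, sample q N (bitVal ω) x = w x).card
      = ∏ x : Fin X, (Finset.univ.filter fun f : Fin (q + 2 * N) → Bool =>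
        (bitsValue q (2 * N) f : ℤ) - (N * 2 ^ q + 2 ^ q / 2) = w x).card := by
    rw [← Fintype.card_piFinset]
    refine (Finset.card_bij (fun f _ => e f) (fun f hf => ?_) (fun f _ g _ h => e.injective h)
      (fun ω hω => ⟨e.symm ω, ?_, e.apply_symm_apply ω⟩)).symm
    · refine Finset.mem_filter.2 ⟨Finset.mem_univ _, fun x hx => ?_⟩
      have := (Finset.mem_filter.1 (Fintype.mem_piFinset.1 hf ⟨x, hx⟩)).2
      rw [← hsample] at this
      exact this
    · refine Fintype.mem_piFinset.2 fun x => Finset.mem_filter.2 ⟨Finset.mem_univ _, ?_⟩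
      rw [← hsample, e.apply_symm_apply]
      exact (Finset.mem_filter.1 hω).2 x x.isLt
  rw [hcard, Nat.cast_prod, Finset.prod_range]
  refine le_trans (Finset.prod_le_prod' fun (x : Fin X) _ =>
    card_bitsValue_le_gaussianReal L N q hL hN hq (w x)) (le_of_eq ?_)
  rw [Finset.prod_mul_distrib, Finset.prod_mul_distrib, Finset.prod_const, Finset.prod_const,
    Finset.card_univ, Fintype.card_fin, ← pow_mul, mul_comm (q + 2 * N) X]

theorem prod_range_mul_eq {α : Type*} [CommMonoid α] (f : ℕ → α) (a b : ℕ) :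
    ∏ x ∈ Finset.range (a * b), f x
      = ∏ i ∈ Finset.range a, ∏ j ∈ Finset.range b, f (i * b + j) := by
  induction a with
  | zero => simp
  | succ a ih => rw [Nat.succ_mul, Finset.prod_range_add, ih, Finset.prod_range_succ]

theorem card_sampleMatrix_eq_le (L N q n k : ℕ) (hL : 2 ≤ L) (hN : N + L = L ^ 2) (hq : 0 < q)
    (W : Fin n → Fin k → ℤ × ℤ) :
    ((Finset.univ.filter fun ω : Fin (n * k * 2 * (q + 2 * N)) → Bool =>
      sampleMatrix n k q N (bitVal ω) = W).card : ℝ≥0∞)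
      ≤ 2 ^ (n * k * 2 * (q + 2 * N)) * (ENNReal.ofReal (Real.exp (2 / L)) ^ (n * k * 2) *
        gaussianMatrix n k (cell ((2 ^ q * L : ℕ) : ℝ) W)) := by
  rcases Finset.eq_empty_or_nonempty (Finset.univ.filter
    fun ω : Fin (n * k * 2 * (q + 2 * N)) → Bool =>
      sampleMatrix n k q N (bitVal ω) = W) with h | ⟨ω₀, hω₀⟩
  · rw [h]; simp
  have h0 := (Finset.mem_filter.1 hω₀).2
  have hle := card_samples_eq_le L N q (n * k * 2) hL hN hq (sample q N (bitVal ω₀))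
  have hset : (Finset.univ.filter fun ω : Fin (n * k * 2 * (q + 2 * N)) → Bool =>
      sampleMatrix n k q N (bitVal ω) = W) ⊆ Finset.univ.filter
        fun ω : Fin (n * k * 2 * (q + 2 * N)) → Bool =>
        ∀ x < n * k * 2, sample q N (bitVal ω) x = sample q N (bitVal ω₀) x := by
    intro ω hω
    refine Finset.mem_filter.2 ⟨Finset.mem_univ _, fun x hx => ?_⟩
    have h1 : sampleMatrix n k q N (bitVal ω) = sampleMatrix n k q N (bitVal ω₀) :=
      (Finset.mem_filter.1 hω).2.trans h0.symm
    -- Sample x belongs to the matrix entry number x / 2, as its real or imaginary part according to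
    -- the parity of x.
    have hx2 : x / 2 < n * k := by omega
    have hk : 0 < k := Nat.pos_of_ne_zero fun h => by simp [h] at hx2
    have hi : x / 2 / k < n := Nat.div_lt_of_lt_mul (by rwa [mul_comm] at hx2)
    have h2 := congrFun (congrFun h1 ⟨x / 2 / k, hi⟩) ⟨x / 2 % k, Nat.mod_lt _ hk⟩
    simp only [sampleMatrix, Nat.div_add_mod' (x / 2) k, Prod.mk.injEq] at h2
    rcases Nat.mod_two_eq_zero_or_one x with hx' | hx'
    · have : x / 2 * 2 = x := by omega
      rw [this] at h2; exact h2.1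
    · have : x / 2 * 2 + 1 = x := by omega
      rw [this] at h2; exact h2.2
  refine le_trans (by exact_mod_cast Finset.card_le_card hset) (hle.trans_eq ?_)
  congr 2
  rw [gaussianMatrix_cell, prod_range_mul_eq, prod_range_mul_eq, ← h0, Finset.prod_range]
  refine Finset.prod_congr rfl fun i _ => ?_
  rw [Finset.prod_range]
  refine Finset.prod_congr rfl fun j _ => ?_
  rw [Finset.prod_range_succ, Finset.prod_range_one]
  rfl

/-- If all samples in `F` have cells contained in `G`, then the fraction of bit sequences that
yield a sample in `F` is at most a constant times the Gaussian probability of `G`. -/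
theorem card_sampleMatrix_mem_le (L N q n k : ℕ) (hL : 2 ≤ L) (hN : N + L = L ^ 2) (hq : 0 < q)
    (p : (Fin (n * k * 2 * (q + 2 * N)) → Bool) → Prop) [DecidablePred p]
    (G : Set (Fin n → Fin k → ℂ))
    (hG : ∀ ω, p ω → cell ((2 ^ q * L : ℕ) : ℝ) (sampleMatrix n k q N (bitVal ω)) ⊆ G) :
    ((Finset.univ.filter p).card : ℝ≥0∞) ≤ 2 ^ (n * k * 2 * (q + 2 * N)) *
      (ENNReal.ofReal (Real.exp (2 / L)) ^ (n * k * 2) * gaussianMatrix n k G) := by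
  classical
  let Ws := (Finset.univ.filter p).image fun ω => sampleMatrix n k q N (bitVal ω)
  have hcard : (Finset.univ.filter p).card ≤ ∑ W ∈ Ws,
      (Finset.univ.filter fun ω : Fin (n * k * 2 * (q + 2 * N)) → Bool =>
        sampleMatrix n k q N (bitVal ω) = W).card := by
    rw [Finset.card_eq_sum_card_image (fun ω => sampleMatrix n k q N (bitVal ω))]
    refine Finset.sum_le_sum fun W _ => Finset.card_le_card fun ω hω => ?_
    exact Finset.mem_filter.2 ⟨Finset.mem_univ _, (Finset.mem_filter.1 hω).2⟩
  calc _ ≤ ∑ W ∈ Ws, ((Finset.univ.filter fun ω : Fin (n * k * 2 * (q + 2 * N)) → Bool =>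
        sampleMatrix n k q N (bitVal ω) = W).card : ℝ≥0∞) := by exact_mod_cast hcard
    _ ≤ ∑ W ∈ Ws, 2 ^ (n * k * 2 * (q + 2 * N)) *
          (ENNReal.ofReal (Real.exp (2 / L)) ^ (n * k * 2) *
            gaussianMatrix n k (cell ((2 ^ q * L : ℕ) : ℝ) W)) :=
        Finset.sum_le_sum fun W _ => card_sampleMatrix_eq_le L N q n k hL hN hq W
    -- Cells of distinct sample matrices are disjoint, so their measures add up to that of their
    -- union, and this union lies in G.
    _ = 2 ^ (n * k * 2 * (q + 2 * N)) * (ENNReal.ofReal (Real.exp (2 / L)) ^ (n * k * 2) *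
          gaussianMatrix n k (⋃ W ∈ Ws, cell ((2 ^ q * L : ℕ) : ℝ) W)) := by
        rw [measure_biUnion_finset (fun W _ W' _ h => disjoint_cell _ h)
          fun W _ => measurableSet_cell _ W, Finset.mul_sum, Finset.mul_sum]
    _ ≤ _ := by
        gcongr
        refine Set.iUnion₂_subset fun W hW => ?_
        obtain ⟨ω, hω, rfl⟩ := Finset.mem_image.1 hW
        exact hG ω (Finset.mem_filter.1 hω).2

/-! ### The parameters of the reduction -/

/-- A constant that is large in terms of `k`. -/
def slack (k : ℕ) : ℕ := 20 * (k + 1) ^ 2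

/-- An integer of the order of `√n`. -/
def gridRoot (k n : ℕ) : ℕ := slack k * (Nat.sqrt n + 1)

/-- The oracle is called with the scalings `M / (M + j)`, `j ≤ k`, for this `M`. -/
def nodeBase (k n b : ℕ) : ℕ := gridRoot k n * 2 ^ Nat.size b

/-- Half the number of fair bits in the coarse part of a sample. -/
def coarseBits (k n : ℕ) : ℕ := gridRoot k n ^ 2 * (gridRoot k n ^ 2 - 1)

/-- The number of fine bits of a sample. -/
def fineBits (p b : ℕ) : ℕ := p + Nat.size b

/-- The inverse of the error bound with which the oracle is called. -/
def queryError (k n a b : ℕ) : ℕ := a * (k + 1) * (2 * nodeBase k n b) ^ k * (n + k) ^ k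

/-- The inverse of the failure probability with which the oracle is called. -/
def queryFailure (k b : ℕ) : ℕ := 72 * (k + 1) * b

/-- The number of bits of the oracle's answers that are read. -/
def answerBits (k n p b : ℕ) : ℕ := p + 1 + 2 * n * (8 * slack k ^ 2 + 2 * n + b)

/-- The total number of coin flips. -/
def coinCount (k n p b : ℕ) : ℕ := n * k * 2 * (fineBits p b + 2 * coarseBits k n)

theorem slack_ge (k : ℕ) : 20 ≤ slack k := by
  have : 1 ≤ (k + 1) ^ 2 := Nat.one_le_pow _ _ (by omega)
  rw [slack]; omega

theorem gridRoot_ge (k n : ℕ) : 20 ≤ gridRoot k n :=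
  (slack_ge k).trans (Nat.le_mul_of_pos_right _ (by omega))

/-- The relation N + L = L² demanded by the sampling bound, with L the square of `gridRoot`. -/
theorem coarseBits_add (k n : ℕ) : coarseBits k n + gridRoot k n ^ 2 = (gridRoot k n ^ 2) ^ 2 := by
  obtain ⟨m, hm⟩ : ∃ m, gridRoot k n ^ 2 = m + 1 :=
    ⟨gridRoot k n ^ 2 - 1, by have := gridRoot_ge k n; have : 0 < gridRoot k n ^ 2 := by positivity
                              omega⟩
  rw [coarseBits, hm]; simp; ring

theorem gridRoot_sq_ge (k n : ℕ) : slack k ^ 2 * n ≤ gridRoot k n ^ 2 := by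
  rw [gridRoot, mul_pow]
  exact Nat.mul_le_mul_left _ (Nat.lt_succ_sqrt' n).le

theorem gridRoot_sq_le (k n : ℕ) (hn : 0 < n) : gridRoot k n ^ 2 ≤ 4 * slack k ^ 2 * n := by
  rw [gridRoot, mul_pow]
  have h1 := Nat.sqrt_le' n
  have h2 : 1 ≤ Nat.sqrt n := Nat.sqrt_pos.2 hn
  have : (Nat.sqrt n + 1) ^ 2 ≤ 4 * n := by nlinarith
  calc _ ≤ slack k ^ 2 * (4 * n) := Nat.mul_le_mul_left _ this
    _ = _ := by ring

theorem lt_nodeBase (k n b : ℕ) : k < nodeBase k n b := by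
  have h1 : k < slack k := by rw [slack]; nlinarith
  have h2 : slack k ≤ gridRoot k n := Nat.le_mul_of_pos_right _ (by omega)
  exact (h1.trans_le h2).trans_le (Nat.le_mul_of_pos_right _ (by positivity))

/-- The integers that represent a scaled sample. -/
def scaledSample (k n b j : ℕ) {l : ℕ} (W : Fin n → Fin l → ℤ × ℤ) : Fin n → Fin l → ℤ × ℤ :=
  fun i c => ((W i c).1 / (gridRoot k n * (nodeBase k n b + j) : ℕ),
    (W i c).2 / (gridRoot k n * (nodeBase k n b + j) : ℕ))

/-- The `j`-th query to the oracle. -/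
def nodeQuery (k n p a b j : ℕ) (Z : Fin n → Fin n → ℤ × ℤ) (W : Fin n → Fin k → ℤ × ℤ) :
    List ℤ :=
  sigmaQuery (k := k) p (queryError k n a b) (queryFailure k b)
    fun i => Fin.append (Z i) (scaledSample k n b j W i)

/-- The scaling factor of the `j`-th query. -/
noncomputable def nodeScale (k n b j : ℕ) : ℝ := (nodeBase k n b : ℝ) / (nodeBase k n b + j)

/-- The estimate of `|Per X|²` computed from the answers to the queries. -/
noncomputable def estimate (k n p b : ℕ) (z : ℕ → ℤ) : ℝ :=
  ((n + k).choose n : ℝ) * ∑ j ∈ Finset.range (k + 1),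
    (((nodeBase k n b : ℝ) + j) ^ (2 * k) / (weightDen k (nodeBase k n b) j : ℝ)) *
      ((z j : ℝ) / 2 ^ p)

theorem nodeScale_pos (k n b j : ℕ) : 0 < nodeScale k n b j := by
  have : 0 < nodeBase k n b := (Nat.zero_le _).trans_lt (lt_nodeBase k n b)
  rw [nodeScale]; positivity

theorem nodeScale_le_one (k n b j : ℕ) : nodeScale k n b j ≤ 1 := by
  have : 0 < nodeBase k n b := (Nat.zero_le _).trans_lt (lt_nodeBase k n b)
  rw [nodeScale, div_le_one (by positivity)]
  linarith [(Nat.cast_nonneg j : (0 : ℝ) ≤ j)]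

/-- The grid is designed for this identity: as M = gridRoot · 2^(size b), the factor 2^p · M/(M+j)
equals the grid density 2^q · gridRoot² divided by the integer gridRoot · (M+j). The floor of a
quotient by a positive integer depends only on the floor of the dividend. -/
theorem floor_scale (k n p b j : ℕ) (y : ℝ) :
    ⌊2 ^ p * (nodeScale k n b j * y)⌋ = ⌊((2 ^ fineBits p b * gridRoot k n ^ 2 : ℕ) : ℝ) * y⌋ /
      (gridRoot k n * (nodeBase k n b + j) : ℕ) := by
  have h1 : 0 < nodeBase k n b := (Nat.zero_le _).trans_lt (lt_nodeBase k n b)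
  have h2 : 0 < gridRoot k n := by have := gridRoot_ge k n; omega
  rw [← Int.floor_div_natCast]
  congr 1
  rw [nodeScale, fineBits]
  have h3 : (nodeBase k n b : ℝ) = gridRoot k n * 2 ^ Nat.size b := by
    rw [nodeBase]; push_cast; ring
  have h4 : (0 : ℝ) < gridRoot k n := by exact_mod_cast h2
  have h5 : (0 : ℝ) < (nodeBase k n b : ℝ) + j := by positivity
  push_cast
  rw [pow_add]
  field_simp
  rw [h3]; ring

/-- All Y in the cell of a sample give one and the same query, at every node. So the answer obtained
from the sample may be judged at any point of the cell. -/
theorem roundMatrix_extend {k n p b j : ℕ} {X : Fin n → Fin n → ℂ} {Y : Fin n → Fin k → ℂ}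
    {W : Fin n → Fin k → ℤ × ℤ}
    (hY : Y ∈ cell ((2 ^ fineBits p b * gridRoot k n ^ 2 : ℕ) : ℝ) W) :
    roundMatrix p (extend (nodeScale k n b j) X Y)
      = fun i => Fin.append (roundMatrix p X i) (scaledSample k n b j W i) := by
  funext i c
  refine Fin.addCases (fun u => ?_) (fun u => ?_) c
  · simp [roundMatrix, extend]
  · simp only [roundMatrix, extend, Fin.append_right, Complex.re_ofReal_mul,
      Complex.im_ofReal_mul, floor_scale, (hY i u).1, (hY i u).2, scaledSample]

theorem bitVal_nonneg {T : ℕ} (ω : Fin T → Bool) (i : ℕ) : 0 ≤ bitVal ω i := by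
  rw [bitVal]; split <;> simp

theorem bitVal_le_one {T : ℕ} (ω : Fin T → Bool) (i : ℕ) : bitVal ω i ≤ 1 := by
  rw [bitVal]; split
  · have := Bool.toNat_le (ω ⟨i, by assumption⟩)
    exact_mod_cast this
  · norm_num

theorem sum_two_pow_range (q : ℕ) : ∑ y ∈ Finset.range q, (2 : ℤ) ^ y = 2 ^ q - 1 := by
  induction q with
  | zero => simp
  | succ q ih => rw [Finset.sum_range_succ, ih]; ring

theorem sample_bounds (q N : ℕ) (g : ℕ → ℤ) (h0 : ∀ i, 0 ≤ g i) (h1 : ∀ i, g i ≤ 1) (x : ℕ) :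
    -(2 ^ q * (N + 1) : ℤ) ≤ sample q N g x ∧ sample q N g x + 1 ≤ 2 ^ q * (N + 1) := by
  have hq : (0 : ℤ) < 2 ^ q := by positivity
  have ha0 : 0 ≤ ∑ y ∈ Finset.range q, 2 ^ y * g (x * (q + 2 * N) + y) :=
    Finset.sum_nonneg fun y _ => mul_nonneg (by positivity) (h0 _)
  have ha1 : ∑ y ∈ Finset.range q, 2 ^ y * g (x * (q + 2 * N) + y) ≤ 2 ^ q - 1 := by
    rw [← sum_two_pow_range]
    exact Finset.sum_le_sum fun y _ => mul_le_of_le_one_right (by positivity) (h1 _)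
  have hb0 : 0 ≤ ∑ y ∈ Finset.range (2 * N), g (x * (q + 2 * N) + q + y) :=
    Finset.sum_nonneg fun y _ => h0 _
  have hb1 : ∑ y ∈ Finset.range (2 * N), g (x * (q + 2 * N) + q + y) ≤ 2 * N := by
    refine (Finset.sum_le_card_nsmul _ _ 1 fun y _ => h1 _).trans_eq ?_
    simp
  have hb2 := mul_nonneg hq.le hb0
  have hb3 := mul_le_mul_of_nonneg_left hb1 hq.le
  have hh : (0 : ℤ) ≤ 2 ^ q / 2 := by positivity
  have hh' : (2 : ℤ) ^ q / 2 ≤ 2 ^ q := Int.ediv_le_self _ hq.le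
  simp only [sample]
  constructor <;> nlinarith

/-- Samples have modulus at most 2^q (N+1) ≤ 2^q L², while the grid density is 2^q L. So both parts
of each entry are at most L. -/
theorem norm_le_of_mem_cell {k n p b : ℕ} {Y : Fin n → Fin k → ℂ} {T : ℕ} {ω : Fin T → Bool}
    (hY : Y ∈ cell ((2 ^ fineBits p b * gridRoot k n ^ 2 : ℕ) : ℝ)
      (sampleMatrix n k (fineBits p b) (coarseBits k n) (bitVal ω))) (i : Fin n) (j : Fin k) :
    ‖Y i j‖ ≤ 2 * (gridRoot k n ^ 2 : ℕ) := by
  set q := fineBits p b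
  set N := coarseBits k n with hN
  set L := gridRoot k n ^ 2 with hL
  have hNL : N + L = L ^ 2 := coarseBits_add k n
  have hL1 : 1 ≤ L := by
    have := gridRoot_ge k n
    exact Nat.one_le_pow _ _ (by omega)
  have key : ∀ (y : ℝ) (x : ℕ), ⌊((2 ^ q * L : ℕ) : ℝ) * y⌋ = sample q N (bitVal ω) x →
      |y| ≤ L := by
    intro y x hy
    obtain ⟨h1, h2⟩ := sample_bounds q N (bitVal ω) (bitVal_nonneg ω) (bitVal_le_one ω) x
    rw [← hy] at h1 h2
    have h3 := Int.floor_le (((2 ^ q * L : ℕ) : ℝ) * y)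
    have h4 := Int.lt_floor_add_one (((2 ^ q * L : ℕ) : ℝ) * y)
    have h1' : -((2 : ℝ) ^ q * (N + 1)) ≤ ⌊((2 ^ q * L : ℕ) : ℝ) * y⌋ := by exact_mod_cast h1
    have h2' : (⌊((2 ^ q * L : ℕ) : ℝ) * y⌋ : ℝ) + 1 ≤ (2 : ℝ) ^ q * (N + 1) := by exact_mod_cast h2
    have hN1 : (N : ℝ) + 1 ≤ L * L := by
      have : N + 1 ≤ L * L := by rw [← sq, ← hNL]; omega
      exact_mod_cast this
    have hq : (0 : ℝ) < 2 ^ q := by positivity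
    have hLp : (0 : ℝ) < L := by exact_mod_cast hL1
    push_cast at h3 h4 h1' h2'
    have h5 : (2 : ℝ) ^ q * (N + 1) ≤ 2 ^ q * L * L := by
      rw [mul_assoc]; exact mul_le_mul_of_nonneg_left hN1 hq.le
    have hpos : (0 : ℝ) < 2 ^ q * L := by positivity
    refine abs_le.2 ⟨?_, ?_⟩
    · refine le_of_mul_le_mul_left ?_ hpos
      linarith
    · refine le_of_mul_le_mul_left ?_ hpos
      linarith
  have h1 := key _ _ (hY i j).1
  have h2 := key _ _ (hY i j).2
  have := Complex.norm_le_abs_re_add_abs_im (Y i j)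
  linarith

/-! ### Size and measurability of the temperament -/

theorem perSq_le {n : ℕ} (X : Fin n → Fin n → ℂ) (B : ℝ)
    (hX : ∀ i j, ‖X i j‖ ≤ B) : perSq X ≤ ((n.factorial : ℝ) * B ^ n) ^ 2 := by
  rw [perSq]
  refine pow_le_pow_left₀ (norm_nonneg _) ?_ 2
  rw [Matrix.permanent]
  refine (norm_sum_le _ _).trans ?_
  refine (Finset.sum_le_card_nsmul _ _ (B ^ n) fun σ _ => ?_).trans_eq ?_
  · rw [norm_prod]
    refine (Finset.prod_le_prod (fun _ _ => norm_nonneg _) fun i _ => hX (σ i) i).trans_eq ?_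
    simp
  · simp [Finset.card_univ, Fintype.card_perm]

theorem perSq_nonneg {n : ℕ} (X : Fin n → Fin n → ℂ) : 0 ≤ perSq X := sq_nonneg _

theorem temperament_nonneg {n k : ℕ} (A : Fin n → Fin (n + k) → ℂ) : 0 ≤ temperament A :=
  div_nonneg (Finset.sum_nonneg fun _ _ => perSq_nonneg _) (Nat.cast_nonneg _)

theorem card_columnChoices_le (n k : ℕ) :
    Fintype.card (Fin n ↪o Fin (n + k)) ≤ (n + k).choose n := by
  have := Finset.card_le_card_of_injOn (s := (Finset.univ : Finset (Fin n ↪o Fin (n + k))))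
    (t := (Finset.univ : Finset (Fin (n + k))).powersetCard n)
    (fun S => Finset.univ.image S) (by
      intro S _
      refine Finset.mem_coe.2 (Finset.mem_powersetCard.2 ⟨Finset.subset_univ _, ?_⟩)
      rw [Finset.card_image_of_injective _ S.injective]; simp) (by
      intro S _ S' _ h
      refine OrderEmbedding.range_inj.1 ?_
      simpa using congrArg (fun s : Finset (Fin (n + k)) => (s : Set (Fin (n + k)))) h)
  simpa using this

theorem temperament_le {n k : ℕ} (A : Fin n → Fin (n + k) → ℂ) (B : ℝ)
    (hA : ∀ i j, ‖A i j‖ ≤ B) : temperament A ≤ ((n.factorial : ℝ) * B ^ n) ^ 2 := by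
  have hc : (0 : ℝ) < ((n + k).choose n : ℝ) := by
    exact_mod_cast Nat.choose_pos (Nat.le_add_right n k)
  rw [temperament, div_le_iff₀ hc]
  refine (Finset.sum_le_card_nsmul _ _ _ fun S _ => perSq_le _ B fun i j => hA i (S j)).trans ?_
  rw [nsmul_eq_mul, mul_comm]
  refine mul_le_mul_of_nonneg_left ?_ (by positivity)
  rw [Finset.card_univ]
  exact_mod_cast card_columnChoices_le n k

theorem measurable_temperament (n k : ℕ) :
    Measurable fun A : Fin n → Fin (n + k) → ℂ => temperament A := by
  unfold temperament perSq Matrix.permanent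
  refine Measurable.div_const (Finset.measurable_sum _ fun S _ => ?_) _
  refine Measurable.pow_const (Measurable.norm (Finset.measurable_sum _ fun σ _ =>
    Finset.measurable_prod _ fun i _ => ?_)) 2
  simp only [Matrix.of_apply]
  fun_prop

theorem measurable_roundMatrix (n m p : ℕ) :
    Measurable fun A : Fin n → Fin m → ℂ => roundMatrix p A := by
  unfold roundMatrix
  refine measurable_pi_lambda _ fun i => measurable_pi_lambda _ fun j => Measurable.prodMk ?_ ?_
  · fun_prop
  · fun_prop

/-! ### The success probability of the reduction -/

/-- The answers to the queries computed from `X` and a sequence of fair bits. -/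
noncomputable def nodeAnswer (O : Oracle) (k p a b : ℕ) {n : ℕ} (Z : Fin n → Fin n → ℤ × ℤ)
    (ω : Fin (coinCount k n p b) → Bool) (j : ℕ) : ℤ :=
  O (nodeQuery k n p a b j Z (sampleMatrix n k (fineBits p b) (coarseBits k n) (bitVal ω)))

/-- The coin flips that lead to a good estimate. -/
def GoodCoins (O : Oracle) (k p a b : ℕ) {n : ℕ} (X : Fin n → Fin n → ℂ)
    (ω : Fin (coinCount k n p b) → Bool) : Prop :=
  (∀ j ≤ k, |nodeAnswer O k p a b (roundMatrix p X) ω j| ≤ 2 ^ answerBits k n p b) ∧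
    |estimate k n p b (nodeAnswer O k p a b (roundMatrix p X) ω) - perSq X|
      ≤ 1 / (a : ℝ) * (n.factorial : ℝ)

/-- The matrices on which the oracle errs. -/
def badMatrices (O : Oracle) (k n p m d : ℕ) : Set (Fin n → Fin (n + k) → ℂ) :=
  {A | ¬ |(O (sigmaQuery p m d (roundMatrix p A)) : ℝ) / 2 ^ p - temperament A| ≤
      1 / (m : ℝ) * (n.factorial : ℝ)}

theorem measurableSet_badMatrices (O : Oracle) (k n p m d : ℕ) :
    MeasurableSet (badMatrices O k n p m d) := by
  -- The oracle is an arbitrary function, but it sees a matrix only through its rounding, which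
  -- takes countably many values.
  have h1 : Measurable fun A : Fin n → Fin (n + k) → ℂ =>
      (O (sigmaQuery p m d (roundMatrix p A)) : ℝ) :=
    (measurable_of_countable fun Z : Fin n → Fin (n + k) → ℤ × ℤ =>
      (O (sigmaQuery p m d Z) : ℝ)).comp (measurable_roundMatrix n (n + k) p)
  have h2 := measurable_temperament n k
  exact (measurableSet_le ((h1.div_const _).sub h2).abs measurable_const).compl

theorem measure_badMatrices_le {O : Oracle} {k n p m d : ℕ} (hO : SolvesSigmaGPE O k n p m d) :
    gaussianMatrix n (n + k) (badMatrices O k n p m d) ≤ 1 / (d : ℝ≥0∞) := by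
  have h := hO
  rw [SolvesSigmaGPE] at h
  have hc := prob_compl_eq_one_sub (μ := gaussianMatrix n (n + k))
    (measurableSet_badMatrices O k n p m d)
  have hcompl : (badMatrices O k n p m d)ᶜ =
      {A | |(O (sigmaQuery p m d (roundMatrix p A)) : ℝ) / 2 ^ p - temperament A| ≤
      1 / (m : ℝ) * (n.factorial : ℝ)} := by
    ext A; simp [badMatrices]
  rw [← hcompl, hc] at h
  have h1 : gaussianMatrix n (n + k) (badMatrices O k n p m d) ≤ 1 := prob_le_one
  -- Subtraction is truncated, so the case 1/d ≥ 1, which includes d = 0, is treated apart; there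
  -- the bound is trivial.
  rcases le_total (1 : ℝ≥0∞) (1 / (d : ℝ≥0∞)) with hd | hd
  · exact h1.trans hd
  · exact (ENNReal.sub_le_sub_iff_left h1 (by simp)).1 h

/-- `queryError` is a times the whole extrapolation loss, with binom(n+k, n) = binom(n+k, k)
replaced by the larger (n+k)^k. -/
theorem choose_mul_error_le (k n a b : ℕ) (ha : 0 < a) :
    ((n + k).choose n : ℝ) * ((k + 1) * ((2 * ((nodeBase k n b : ℤ) : ℝ)) ^ k *
      (1 / (queryError k n a b : ℝ) * (n.factorial : ℝ)))) ≤ 1 / (a : ℝ) * (n.factorial : ℝ) := by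
  have hM : 0 < nodeBase k n b := (Nat.zero_le _).trans_lt (lt_nodeBase k n b)
  have hM' : (0 : ℝ) < nodeBase k n b := by exact_mod_cast hM
  have ha' : (0 : ℝ) < a := by exact_mod_cast ha
  have hch : (n + k).choose n ≤ (n + k) ^ k := by
    rw [Nat.choose_symm_add]; exact Nat.choose_le_pow _ _
  have hchp : 0 < (n + k).choose n := Nat.choose_pos (Nat.le_add_right n k)
  have hch' : ((n + k).choose n : ℝ) ≤ ((n : ℝ) + k) ^ k := by exact_mod_cast hch
  have hpos : (0 : ℝ) < ((n : ℝ) + k) ^ k := lt_of_lt_of_le (by exact_mod_cast hchp) hch'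
  rw [queryError]
  push_cast
  rw [show ((n + k).choose n : ℝ) * ((k + 1) * ((2 * (nodeBase k n b : ℝ)) ^ k *
    (1 / (a * (k + 1) * (2 * (nodeBase k n b : ℝ)) ^ k * (n + k) ^ k) * (n.factorial : ℝ))))
    = (((n + k).choose n : ℝ) / (n + k) ^ k) * (1 / (a : ℝ) * (n.factorial : ℝ)) by
      field_simp]
  exact mul_le_of_le_one_left (by positivity) ((div_le_one hpos).2 hch')

/-- Ensures that saturation never alters a correct answer. Both Φ and the allowed error are at most
V^(2n) with V a power of 2; the remaining p + 1 bits account for the scale 2^p and for adding the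
two. -/
theorem answer_bound (k n p b : ℕ) (hn : 0 < n) (hb : 0 < b) (φ ε : ℝ) (z : ℤ) (hε : ε ≤ 1)
    (hφ0 : 0 ≤ φ)
    (hφ : φ ≤ ((n.factorial : ℝ) * ((8 * slack k ^ 2 * n * b : ℕ) : ℝ) ^ n) ^ 2)
    (hz : |(z : ℝ) / 2 ^ p - φ| ≤ ε * (n.factorial : ℝ)) : |z| ≤ 2 ^ answerBits k n p b := by
  set K := slack k with hK
  have hK1 := slack_ge k
  have hfac : (n.factorial : ℝ) ≤ (n : ℝ) ^ n := by exact_mod_cast Nat.factorial_le_pow n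
  have hn' : (1 : ℝ) ≤ n := by exact_mod_cast hn
  set V : ℝ := 2 ^ (8 * K ^ 2 + 2 * n + b) with hV
  have hV1 : (1 : ℝ) ≤ V := one_le_pow₀ (by norm_num)
  have hVge : (n : ℝ) * ((8 * K ^ 2 * n * b : ℕ) : ℝ) ≤ V := by
    have h1 : 8 * K ^ 2 ≤ 2 ^ (8 * K ^ 2) := Nat.lt_two_pow_self.le
    have h2 : n ≤ 2 ^ n := Nat.lt_two_pow_self.le
    have h3 : b ≤ 2 ^ b := Nat.lt_two_pow_self.le
    have : n * (8 * K ^ 2 * n * b) ≤ 2 ^ (8 * K ^ 2 + 2 * n + b) := by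
      calc n * (8 * K ^ 2 * n * b) = (8 * K ^ 2) * (n * n) * b := by ring
        _ ≤ 2 ^ (8 * K ^ 2) * (2 ^ n * 2 ^ n) * 2 ^ b := by gcongr
        _ = _ := by rw [pow_add, pow_add, two_mul, pow_add]
    rw [hV]
    exact_mod_cast this
  have hφ2 : φ ≤ V ^ (2 * n) := by
    refine hφ.trans ?_
    rw [mul_comm 2 n, pow_mul]
    refine pow_le_pow_left₀ (by positivity) ?_ 2
    calc (n.factorial : ℝ) * ((8 * K ^ 2 * n * b : ℕ) : ℝ) ^ n
        ≤ (n : ℝ) ^ n * ((8 * K ^ 2 * n * b : ℕ) : ℝ) ^ n := by gcongr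
      _ = ((n : ℝ) * ((8 * K ^ 2 * n * b : ℕ) : ℝ)) ^ n := by rw [mul_pow]
      _ ≤ _ := by gcongr
  have hfac2 : (n.factorial : ℝ) ≤ V ^ (2 * n) := by
    have h8 : (n : ℝ) ≤ V := by
      refine le_trans ?_ hVge
      have : n ≤ n * (8 * K ^ 2 * n * b) := Nat.le_mul_of_pos_right _ (by positivity)
      exact_mod_cast this
    calc (n.factorial : ℝ) ≤ (n : ℝ) ^ n := hfac
      _ ≤ V ^ n := by gcongr
      _ ≤ V ^ (2 * n) := pow_le_pow_right₀ hV1 (by omega)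
  have hle : |(z : ℝ) / 2 ^ p| ≤ 2 * V ^ (2 * n) := by
    have h1 : |(z : ℝ) / 2 ^ p| ≤ |(z : ℝ) / 2 ^ p - φ| + |φ| := by
      have := abs_add_le ((z : ℝ) / 2 ^ p - φ) φ
      rwa [sub_add_cancel] at this
    rw [abs_of_nonneg hφ0] at h1
    have h2 : ε * (n.factorial : ℝ) ≤ 1 * n.factorial := by gcongr
    linarith
  have hp : (0 : ℝ) < 2 ^ p := by positivity
  rw [abs_div, abs_of_pos hp, div_le_iff₀ hp] at hle
  have hfin : (|z| : ℝ) ≤ 2 ^ answerBits k n p b := by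
    refine hle.trans_eq ?_
    rw [answerBits, hV, ← pow_mul, pow_add, pow_add]
    ring
  exact_mod_cast hfin

/-- A matrix of moderate size and a sample for which the oracle does not err yield a good
estimate. -/
theorem goodCoins_of_mem_cell {O : Oracle} {k p a b n : ℕ} (hn : 0 < n) (ha : 0 < a) (hb : 0 < b)
    {X : Fin n → Fin n → ℂ} (hX : ∀ i j, ‖X i j‖ ≤ 2 * ((2 * n * b : ℕ) : ℝ))
    {ω : Fin (coinCount k n p b) → Bool} {Y : Fin n → Fin k → ℂ}
    (hY : Y ∈ cell ((2 ^ fineBits p b * gridRoot k n ^ 2 : ℕ) : ℝ)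
      (sampleMatrix n k (fineBits p b) (coarseBits k n) (bitVal ω)))
    (hgood : ∀ j ≤ k, extend (nodeScale k n b j) X Y ∉
      badMatrices O k n p (queryError k n a b) (queryFailure k b)) :
    GoodCoins O k p a b X ω := by
  have hM : 0 < nodeBase k n b := (Nat.zero_le _).trans_lt (lt_nodeBase k n b)
  have hz : ∀ j ≤ k, |(nodeAnswer O k p a b (roundMatrix p X) ω j : ℝ) / 2 ^ p
      - temperament (extend (nodeScale k n b j) X Y)|
      ≤ 1 / (queryError k n a b : ℝ) * (n.factorial : ℝ) := by
    intro j hj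
    have := hgood j hj
    rw [badMatrices, Set.mem_ofPred_eq, not_not, roundMatrix_extend hY] at this
    exact this
  have hm1 : 1 / (queryError k n a b : ℝ) ≤ 1 := by
    have : 1 ≤ queryError k n a b := Nat.one_le_iff_ne_zero.2 (by
      rw [queryError]; positivity)
    exact div_le_one_of_le₀ (by exact_mod_cast this) (by positivity)
  refine ⟨fun j hj => ?_, ?_⟩
  · refine answer_bound k n p b hn hb _ _ _ hm1 (temperament_nonneg _) ?_ (hz j hj)
    refine temperament_le _ _ fun i c => ?_
    refine Fin.addCases (fun u => ?_) (fun u => ?_) c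
    · simp only [extend, Fin.append_left]
      refine (hX i u).trans ?_
      have : 2 * (2 * n * b) ≤ 8 * slack k ^ 2 * n * b := by
        have h1 : 1 ≤ slack k ^ 2 := Nat.one_le_pow _ _ (by have := slack_ge k; omega)
        have h2 : 1 * (n * b) ≤ slack k ^ 2 * (n * b) := Nat.mul_le_mul_right _ h1
        nlinarith
      exact_mod_cast this
    · simp only [extend, Fin.append_right]
      rw [norm_mul, Complex.norm_real, Real.norm_eq_abs, abs_of_pos (nodeScale_pos k n b j)]
      refine (mul_le_of_le_one_left (norm_nonneg _) (nodeScale_le_one k n b j)).trans ?_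
      refine (norm_le_of_mem_cell hY i u).trans ?_
      have : 2 * gridRoot k n ^ 2 ≤ 8 * slack k ^ 2 * n * b := by
        have h1 := gridRoot_sq_le k n hn
        calc 2 * gridRoot k n ^ 2 ≤ 2 * (4 * slack k ^ 2 * n) := by omega
          _ = 8 * slack k ^ 2 * n := by ring
          _ ≤ _ := Nat.le_mul_of_pos_right _ hb
      exact_mod_cast this
  · have h := abs_extrapolation_sub_perSq_le X Y (nodeBase k n b) (by exact_mod_cast hM)
      (by exact_mod_cast (lt_nodeBase k n b).le)
      (fun j => (nodeAnswer O k p a b (roundMatrix p X) ω j : ℝ) / 2 ^ p)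
      (1 / (queryError k n a b : ℝ) * (n.factorial : ℝ)) (fun j hj => by
        simpa [nodeScale] using hz j hj)
    refine le_trans ?_ (h.trans (choose_mul_error_le k n a b ha))
    simp [estimate]

/-- From 1 - c² ≤ 2k/M the left side is at most 4k³n/M². The constant 20(k+1)² in `slack` gives M² ≥
400(k+1)⁴ n b², which exceeds what is needed since 288 k³(k+1) ≤ 400(k+1)⁴. -/
theorem scale_defect_le (k n b j : ℕ) (hn : 0 < n) (hb : 0 < b) (hj : j ≤ k) :
    ((k * n : ℕ) : ℝ) * (1 - nodeScale k n b j ^ 2) ^ 2 ≤ 1 / (72 * (k + 1) * b) := by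
  have hM : 0 < nodeBase k n b := (Nat.zero_le _).trans_lt (lt_nodeBase k n b)
  have hM' : (0 : ℝ) < nodeBase k n b := by exact_mod_cast hM
  have hc0 := nodeScale_pos k n b j
  have hc1 := nodeScale_le_one k n b j
  have hk0 : (0 : ℝ) ≤ k := Nat.cast_nonneg k
  have hb1 : (1 : ℝ) ≤ b := by exact_mod_cast hb
  have hn1 : (1 : ℝ) ≤ n := by exact_mod_cast hn
  have hdef : 1 - nodeScale k n b j ^ 2 ≤ 2 * k / nodeBase k n b := by
    have h1 : 1 - nodeScale k n b j ≤ k / nodeBase k n b := by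
      rw [nodeScale, one_sub_div (by positivity), add_sub_cancel_left]
      have : (j : ℝ) ≤ k := by exact_mod_cast hj
      gcongr
      linarith [(Nat.cast_nonneg j : (0 : ℝ) ≤ j)]
    have h2 : 1 - nodeScale k n b j ^ 2 = (1 - nodeScale k n b j) * (1 + nodeScale k n b j) := by
      ring
    rw [h2, mul_div_assoc]
    have h3 : (0 : ℝ) ≤ k / nodeBase k n b := by positivity
    nlinarith
  have hdef0 : 0 ≤ 1 - nodeScale k n b j ^ 2 := by
    have := pow_le_one₀ (n := 2) hc0.le hc1
    linarith
  have hMge : (400 : ℝ) * (k + 1) ^ 4 * n * b ^ 2 ≤ (nodeBase k n b : ℝ) ^ 2 := by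
    have h1 := gridRoot_sq_ge k n
    have h2 : b ≤ 2 ^ Nat.size b := (Nat.lt_size_self b).le
    have : 400 * (k + 1) ^ 4 * n * b ^ 2 ≤ nodeBase k n b ^ 2 := by
      rw [nodeBase, mul_pow]
      refine Nat.mul_le_mul (le_trans (le_of_eq ?_) h1) (Nat.pow_le_pow_left h2 2)
      rw [slack]; ring
    exact_mod_cast this
  calc ((k * n : ℕ) : ℝ) * (1 - nodeScale k n b j ^ 2) ^ 2
      ≤ ((k * n : ℕ) : ℝ) * (2 * k / nodeBase k n b) ^ 2 := by gcongr
    _ = (k * n) * (4 * k ^ 2) / (nodeBase k n b : ℝ) ^ 2 := by push_cast; ring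
    _ ≤ (k * n) * (4 * k ^ 2) / ((400 : ℝ) * (k + 1) ^ 4 * n * b ^ 2) := by gcongr
    _ ≤ 1 / (72 * (k + 1) * b) := by
        rw [div_le_div_iff₀ (by positivity) (by positivity)]
        have h1 : (k : ℝ) * (4 * k ^ 2) * (72 * (k + 1)) ≤ 400 * (k + 1) ^ 4 := by
          have h3 : (k : ℝ) ^ 3 ≤ (k + 1) ^ 3 := by gcongr; linarith
          have h4 : (0 : ℝ) ≤ (k + 1) ^ 4 := by positivity
          nlinarith
        have h2 : (b : ℝ) ≤ b ^ 2 := by nlinarith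
        calc (k : ℝ) * n * (4 * (k : ℝ) ^ 2) * (72 * ((k : ℝ) + 1) * b)
            = ((k : ℝ) * (4 * (k : ℝ) ^ 2) * (72 * ((k : ℝ) + 1))) * n * b := by ring
          _ ≤ (400 * ((k : ℝ) + 1) ^ 4) * n * (b : ℝ) ^ 2 := by gcongr
          _ = _ := by ring

/-- The total exponent is 4nk / gridRoot², at most 1 by the choice of `slack`, and e < 3. -/
theorem exp_ratio_le (k n : ℕ) :
    ENNReal.ofReal (Real.exp (2 / (gridRoot k n ^ 2 : ℕ))) ^ (n * k * 2) ≤ 3 := by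
  have hL : 400 * (k + 1) ^ 4 * n ≤ gridRoot k n ^ 2 := by
    refine le_trans (le_of_eq ?_) (gridRoot_sq_ge k n)
    rw [slack]; ring
  have h4 : 4 * (n * k) ≤ gridRoot k n ^ 2 := by
    refine le_trans ?_ hL
    have : k ≤ (k + 1) ^ 4 := (Nat.le_succ k).trans (Nat.le_self_pow (by norm_num) _)
    nlinarith
  have hpos : 0 < gridRoot k n ^ 2 := by have := gridRoot_ge k n; positivity
  rw [← ENNReal.ofReal_pow (by positivity), ← Real.exp_nat_mul,
    show (3 : ℝ≥0∞) = ENNReal.ofReal 3 by simp]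
  refine ENNReal.ofReal_le_ofReal ?_
  have h1 : ((n * k * 2 : ℕ) : ℝ) * (2 / (gridRoot k n ^ 2 : ℕ)) ≤ 1 := by
    rw [mul_div_assoc', div_le_one (by exact_mod_cast hpos)]
    have : n * k * 2 * 2 ≤ gridRoot k n ^ 2 := by linarith
    exact_mod_cast this
  have := Real.exp_le_exp.2 h1
  linarith [Real.exp_one_lt_d9]

theorem three_mul_le_two_pow {c T : ℕ} (h : (c : ℝ≥0∞) ≤ 2 ^ T * (3 * (1 / 9))) :
    3 * c ≤ 2 ^ T := by
  have h39 : (3 : ℝ≥0∞) * (3 * (1 / 9)) = 1 := by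
    rw [← mul_assoc, one_div]; norm_num
    exact ENNReal.mul_inv_cancel (by norm_num) (by norm_num)
  have : (3 : ℝ≥0∞) * (c : ℝ≥0∞) ≤ 2 ^ T := by
    calc (3 : ℝ≥0∞) * (c : ℝ≥0∞) ≤ 3 * (2 ^ T * (3 * (1 / 9))) := by gcongr
      _ = 2 ^ T * (3 * (3 * (1 / 9))) := by ring
      _ = _ := by rw [h39, mul_one]
  exact_mod_cast this

/-- The sampling bound at the parameters of the reduction. Keeping T as a variable with an equation
prevents the type of the bit strings from being unfolded. -/
theorem card_coins_le {k n p b T : ℕ} (hb : 0 < b) (hT : T = coinCount k n p b)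
    (P : (Fin T → Bool) → Prop) [DecidablePred P] (G : Set (Fin n → Fin k → ℂ))
    (hG : ∀ ω, P ω → cell ((2 ^ fineBits p b * gridRoot k n ^ 2 : ℕ) : ℝ)
      (sampleMatrix n k (fineBits p b) (coarseBits k n) (bitVal ω)) ⊆ G) {η : ℝ≥0∞}
    (hη : gaussianMatrix n k G ≤ η) :
    ((Finset.univ.filter P).card : ℝ≥0∞) ≤ 2 ^ T * (3 * η) := by
  rw [coinCount] at hT
  subst hT
  have hcard := card_sampleMatrix_mem_le (gridRoot k n ^ 2) (coarseBits k n) (fineBits p b) n k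
    (by have := gridRoot_ge k n; nlinarith) (coarseBits_add k n)
    (by rw [fineBits]; have := Nat.size_pos.2 hb; omega) P G hG
  refine le_trans hcard ?_
  gcongr
  exact exp_ratio_le k n

/-- With probability at least `1 - 1 / b` over `X`, at least two thirds of the coin flips lead to a
good estimate. -/
theorem many_goodCoins {O : Oracle} {k p a b n : ℕ} (hn : 0 < n) (ha : 0 < a) (hb : 0 < b)
    (hO : SolvesSigmaGPE O k n p (queryError k n a b) (queryFailure k b)) :
    1 - 1 / (b : ℝ≥0∞) ≤ gaussianMatrix n n {X | 2 * 2 ^ coinCount k n p b ≤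
      3 * Nat.card {ω : Fin (coinCount k n p b) → Bool // GoodCoins O k p a b X ω}} := by
  classical
  set B := badMatrices O k n p (queryError k n a b) (queryFailure k b) with hB
  have hBm : MeasurableSet B := measurableSet_badMatrices _ _ _ _ _ _
  let G : Set ((Fin n → Fin n → ℂ) × (Fin n → Fin k → ℂ)) :=
    ⋃ j ∈ Finset.range (k + 1), {z | extend (nodeScale k n b j) z.1 z.2 ∈ B}
  have hGm : MeasurableSet G := Finset.measurableSet_biUnion _ fun j _ =>
    measurable_extend n k _ hBm
  have hb' : (0 : ℝ) < b := by exact_mod_cast hb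
  have hb1 : (1 : ℝ) ≤ b := by exact_mod_cast hb
  have hn' : (0 : ℝ) < n := by exact_mod_cast hn
  have hd : (1 : ℝ≥0∞) / (queryFailure k b : ℝ≥0∞) = ENNReal.ofReal (1 / (72 * (k + 1) * b)) := by
    rw [queryFailure, ENNReal.ofReal_div_of_pos (by positivity), ENNReal.ofReal_one]
    congr 1
    rw [← ENNReal.ofReal_natCast]; push_cast; rfl
  -- With δ' = 1/(72(k+1)b) and the same value for τ, each node contributes 2δ' + 2τ = 4/(72(k+1)b),
  -- and there are k + 1 nodes.
  have hGle : ((gaussianMatrix n n).prod (gaussianMatrix n k)) G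
      ≤ ENNReal.ofReal (1 / (18 * b)) := by
    calc _ ≤ ∑ j ∈ Finset.range (k + 1), ((gaussianMatrix n n).prod (gaussianMatrix n k))
          {z | extend (nodeScale k n b j) z.1 z.2 ∈ B} := measure_biUnion_finset_le _ _
      _ ≤ ∑ _j ∈ Finset.range (k + 1), ENNReal.ofReal (4 / (72 * (k + 1) * b)) := by
          refine Finset.sum_le_sum fun j hj => ?_
          have h := extend_event_le (nodeScale_pos k n b j) (nodeScale_le_one k n b j)
            (scale_defect_le k n b j hn hb (Nat.le_of_lt_succ (Finset.mem_range.1 hj)))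
            (by
              rw [div_le_div_iff₀ (by positivity) (by norm_num)]
              have : (0 : ℝ) ≤ k := Nat.cast_nonneg k
              nlinarith) hBm
          refine h.trans ?_
          have h2 := measure_badMatrices_le hO
          rw [hd] at h2
          calc _ ≤ 2 * ENNReal.ofReal (1 / (72 * (k + 1) * b))
                + ENNReal.ofReal (2 * (1 / (72 * (k + 1) * b))) := by gcongr
            _ = _ := by
                rw [show (2 : ℝ≥0∞) = ENNReal.ofReal 2 by simp,
                  ← ENNReal.ofReal_mul (by norm_num), ← ENNReal.ofReal_add (by positivity)
                  (by positivity)]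
                congr 1; ring
      _ = _ := by
          rw [Finset.sum_const, Finset.card_range, nsmul_eq_mul, ← ENNReal.ofReal_natCast,
            ← ENNReal.ofReal_mul (by positivity)]
          congr 1
          push_cast
          field_simp
          norm_num
  -- By Markov this set has measure at most 9/(18b) = 1/(2b). Off it the fraction of bad coins is at
  -- most 3 · 1/9 = 1/3, where 3 is the cost of sampling.
  let B1 : Set (Fin n → Fin n → ℂ) := {X | 1 / 9 ≤ gaussianMatrix n k (Prod.mk X ⁻¹' G)}
  let B2 : Set (Fin n → Fin n → ℂ) := {X | ∃ i j, 2 * ((2 * n * b : ℕ) : ℝ) < ‖X i j‖}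
  have hB1m : MeasurableSet B1 :=
    measurableSet_le measurable_const (measurable_measure_prodMk_left hGm)
  have hB2m : MeasurableSet B2 := by
    have : B2 = ⋃ i, ⋃ j, {X : Fin n → Fin n → ℂ | 2 * ((2 * n * b : ℕ) : ℝ) < ‖X i j‖} := by
      ext X; simp [B2]
    rw [this]
    exact MeasurableSet.iUnion fun i => MeasurableSet.iUnion fun j =>
      measurableSet_lt measurable_const (by fun_prop)
  have hB1 : gaussianMatrix n n B1 ≤ ENNReal.ofReal (1 / (2 * b)) := by
    have h := mul_meas_ge_le_lintegral (μ := gaussianMatrix n n)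
      (measurable_measure_prodMk_left (ν := gaussianMatrix n k) hGm) (1 / 9)
    rw [← Measure.prod_apply hGm] at h
    have h2 : 9 * (1 / 9 * gaussianMatrix n n B1) ≤ 9 * ENNReal.ofReal (1 / (18 * b)) := by
      gcongr
      exact h.trans hGle
    rw [← mul_assoc, one_div, ENNReal.mul_inv_cancel (by norm_num) (by norm_num), one_mul] at h2
    refine h2.trans_eq ?_
    rw [show (9 : ℝ≥0∞) = ENNReal.ofReal 9 by simp, ← ENNReal.ofReal_mul (by norm_num)]
    congr 1
    field_simp
    norm_num
  -- Chebyshev at t = 2nb gives n²/t² = 1/(4b²).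
  have hB2 : gaussianMatrix n n B2 ≤ ENNReal.ofReal (1 / (2 * b)) := by
    refine (gaussianMatrix_tail n n ((2 * n * b : ℕ) : ℝ) (by positivity)).trans
      (ENNReal.ofReal_le_ofReal ?_)
    push_cast
    rw [div_le_div_iff₀ (by positivity) (by positivity)]
    nlinarith [mul_pos (mul_pos hn' hn') hb']
  -- The set of good X need not be measurable; it is enough that it contains the measurable
  -- complement of the two exceptional sets.
  have hsub : (B1 ∪ B2)ᶜ ⊆ {X | 2 * 2 ^ coinCount k n p b ≤
      3 * Nat.card {ω : Fin (coinCount k n p b) → Bool // GoodCoins O k p a b X ω}} := by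
    intro X hX
    have hX1 : gaussianMatrix n k (Prod.mk X ⁻¹' G) < 1 / 9 := by
      by_contra h
      exact hX (Or.inl (not_lt.1 h))
    have hX2 : ∀ i j, ‖X i j‖ ≤ 2 * ((2 * n * b : ℕ) : ℝ) := by
      intro i j
      by_contra h
      exact hX (Or.inr ⟨i, j, not_le.1 h⟩)
    have hcard2 : ((Finset.univ.filter fun ω : Fin (coinCount k n p b) → Bool =>
        ¬ GoodCoins O k p a b X ω).card : ℝ≥0∞) ≤ 2 ^ coinCount k n p b * (3 * (1 / 9)) := by
      refine card_coins_le hb rfl _ (Prod.mk X ⁻¹' G) ?_ hX1.le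
      intro ω hω Y hY
      by_contra hYG
      refine hω (goodCoins_of_mem_cell hn ha hb hX2 hY fun j hj hmem => hYG ?_)
      exact Set.mem_biUnion (x := j) (by simpa using Nat.lt_succ_of_le hj) hmem
    have hcard3 := three_mul_le_two_pow hcard2
    have htot := Finset.card_filter_add_card_filter_not (s := Finset.univ)
      (fun ω : Fin (coinCount k n p b) → Bool => GoodCoins O k p a b X ω)
    rw [Finset.card_univ, Fintype.card_fun, Fintype.card_bool, Fintype.card_fin] at htot
    simp only [Set.mem_ofPred_eq, Nat.card_eq_fintype_card, Fintype.card_subtype]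
    omega
  refine le_trans ?_ (measure_mono hsub)
  rw [prob_compl_eq_one_sub (hB1m.union hB2m)]
  refine tsub_le_tsub_left ((measure_union_le _ _).trans ((add_le_add hB1 hB2).trans_eq ?_)) _
  rw [← ENNReal.ofReal_add (by positivity) (by positivity), ← ENNReal.ofReal_natCast b,
    ← ENNReal.ofReal_one, ← ENNReal.ofReal_div_of_pos hb']
  congr 1
  field_simp
  norm_num

/-! ### Reasoning about programs -/

/-- Sequential composition of a list of programs. -/
def block : List Cmd → Cmd
  | [] => .const 0 0
  | [c] => c
  | c :: l => .seq c (block l)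

/-- The law of the final configuration after a list of programs. -/
noncomputable def evalList (O : Oracle) (fuel : ℕ) : List Cmd → Config → PMF (Option Config)
  | [], s => PMF.pure (some s)
  | c :: l, s => (eval O fuel c s).bind fun o =>
      match o with
      | none => PMF.pure none
      | some s' => evalList O fuel l s'

/-- Nonemptiness matters: the empty list is translated into a write to cell 0, which is not the
identity. -/
theorem eval_block (O : Oracle) (fuel : ℕ) (l : List Cmd) (hl : l ≠ []) (s : Config) :
    eval O fuel (block l) s = evalList O fuel l s := by
  induction l generalizing s with
  | nil => exact absurd rfl hl
  | cons c l ih =>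
    cases l with
    | nil =>
      simp only [block, evalList]
      conv_lhs => rw [← PMF.bind_pure (eval O fuel c s)]
      congr 1
      funext o
      cases o <;> rfl
    | cons c' l =>
      simp only [block, eval]
      rw [evalList]
      congr 1
      funext o
      cases o with
      | none => rfl
      | some s' => exact ih (by simp) s'

theorem evalList_append (O : Oracle) (fuel : ℕ) (l l' : List Cmd) (s : Config) :
    evalList O fuel (l ++ l') s = (evalList O fuel l s).bind fun o =>
      match o with
      | none => PMF.pure none
      | some s' => evalList O fuel l' s' := by
  induction l generalizing s with
  | nil => simp [evalList]
  | cons c l ih =>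
    rw [List.cons_append, evalList, evalList, PMF.bind_bind]
    congr 1
    funext o
    cases o with
    | none => simp
    | some s' => exact ih s'

/-- The memory whose cells `0, …, ρ - 1` are the registers `R` and whose other cells are given
by `H`. -/
def layout (ρ : ℕ) (R : ℕ → ℤ) (H : ℤ → ℤ) : ℤ → ℤ :=
  fun z => if 0 ≤ z ∧ z < ρ then R z.toNat else H z

theorem layout_reg {ρ x : ℕ} (hx : x < ρ) (R : ℕ → ℤ) (H : ℤ → ℤ) : layout ρ R H x = R x := by
  rw [layout, if_pos ⟨by omega, by omega⟩, Int.toNat_natCast]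

theorem layout_heap {ρ : ℕ} {z : ℤ} (hz : z < 0 ∨ ρ ≤ z) (R : ℕ → ℤ) (H : ℤ → ℤ) :
    layout ρ R H z = H z := by
  rw [layout, if_neg (by omega)]

theorem update_layout_reg {ρ d : ℕ} (hd : d < ρ) (R : ℕ → ℤ) (H : ℤ → ℤ) (v : ℤ) :
    Function.update (layout ρ R H) d v = layout ρ (Function.update R d v) H := by
  funext z
  by_cases hz : z = d
  · subst hz
    rw [Function.update_self, layout_reg hd, Function.update_self]
  · rw [Function.update_of_ne hz, layout, layout]
    split_ifs with h
    · rw [Function.update_of_ne]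
      omega
    · rfl

theorem update_layout_heap {ρ : ℕ} {a : ℤ} (ha : a < 0 ∨ ρ ≤ a) (R : ℕ → ℤ) (H : ℤ → ℤ) (v : ℤ) :
    Function.update (layout ρ R H) a v = layout ρ R (Function.update H a v) := by
  funext z
  by_cases hz : z = a
  · subst hz
    rw [Function.update_self, layout_heap ha, Function.update_self]
  · rw [Function.update_of_ne hz, layout, layout]
    split_ifs with h
    · rfl
    · rw [Function.update_of_ne hz]

theorem bitLen_le {Λ : ℕ} {z : ℤ} (h : |z| < 2 ^ Λ) : bitLen z ≤ Λ := by
  rw [bitLen, Nat.size_le]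
  zify
  exact h

/-- All memory cells hold numbers of at most `Λ` binary digits. -/
def Bounded (Λ : ℕ) (R : ℕ → ℤ) (H : ℤ → ℤ) : Prop :=
  (∀ i, |R i| < 2 ^ Λ) ∧ ∀ z, |H z| < 2 ^ Λ

theorem Bounded.reg {Λ : ℕ} {R : ℕ → ℤ} {H : ℤ → ℤ} (h : Bounded Λ R H) (d : ℕ) {v : ℤ}
    (hv : |v| < 2 ^ Λ) : Bounded Λ (Function.update R d v) H := by
  refine ⟨fun i => ?_, h.2⟩
  rw [Function.update_apply]
  split_ifs
  exacts [hv, h.1 i]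

theorem Bounded.heap {Λ : ℕ} {R : ℕ → ℤ} {H : ℤ → ℤ} (h : Bounded Λ R H) (a : ℤ) {v : ℤ}
    (hv : |v| < 2 ^ Λ) : Bounded Λ R (Function.update H a v) := by
  refine ⟨h.1, fun i => ?_⟩
  rw [Function.update_apply]
  split_ifs
  exacts [hv, h.2 i]

/-- Started with registers `R` and heap `H`, the programs in the list `l` terminate in time at
most `N κ`, keep all cells `Λ`-bounded, and establish `Q`. -/
def Runs (O : Oracle) (Λ κ ρ : ℕ) (l : List Cmd) (R : ℕ → ℤ) (H : ℤ → ℤ) (N : ℕ)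
    (Q : (ℕ → ℤ) → (ℤ → ℤ) → Prop) : Prop :=
  1 + 3 * Λ ≤ κ → Bounded Λ R H → ∃ R' H', Bounded Λ R' H' ∧ Q R' H' ∧
    ∀ fuel τ, N * κ < fuel → ∃ t ≤ N * κ,
      evalList O fuel l ⟨layout ρ R H, τ⟩ = PMF.pure (some ⟨layout ρ R' H', τ + t⟩)

section Rules

variable {O : Oracle} {Λ κ ρ : ℕ} {l : List Cmd} {R : ℕ → ℤ} {H : ℤ → ℤ} {N : ℕ}
  {Q : (ℕ → ℤ) → (ℤ → ℤ) → Prop}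

theorem Runs.nil (h : Q R H) : Runs O Λ κ ρ [] R H N Q :=
  fun _ hB => ⟨R, H, hB, h, fun _ _ _ => ⟨0, Nat.zero_le _, rfl⟩⟩

/-- Boundedness is a precondition inside `Runs`, so it may be assumed while a triple is proved. It
is used where the size of a result is inherited from the contents of memory. -/
theorem Runs.of_bounded (h : Bounded Λ R H → Runs O Λ κ ρ l R H N Q) : Runs O Λ κ ρ l R H N Q :=
  fun hκ hB => h hB hκ hB

theorem Runs.mono {Q' : (ℕ → ℤ) → (ℤ → ℤ) → Prop} {N' : ℕ} (h : Runs O Λ κ ρ l R H N Q)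
    (hN : N ≤ N') (hQ : ∀ R H, Bounded Λ R H → Q R H → Q' R H) : Runs O Λ κ ρ l R H N' Q' := by
  intro hκ hB
  obtain ⟨R', H', hB', hQ', he⟩ := h hκ hB
  have hle : N * κ ≤ N' * κ := Nat.mul_le_mul_right _ hN
  refine ⟨R', H', hB', hQ R' H' hB' hQ', fun fuel τ hf => ?_⟩
  obtain ⟨t, ht, h'⟩ := he fuel τ (hle.trans_lt hf)
  exact ⟨t, ht.trans hle, h'⟩

/-- A single step. -/
theorem Runs.step {c : Cmd} {R' : ℕ → ℤ} {H' : ℤ → ℤ}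
    (hc : 1 + 3 * Λ ≤ κ → Bounded Λ R H → Bounded Λ R' H' ∧ ∀ fuel τ, ∃ t ≤ κ,
      eval O fuel c ⟨layout ρ R H, τ⟩ = PMF.pure (some ⟨layout ρ R' H', τ + t⟩))
    (h : Runs O Λ κ ρ l R' H' N Q) : Runs O Λ κ ρ (c :: l) R H (N + 1) Q := by
  intro hκ hB
  obtain ⟨hB', he⟩ := hc hκ hB
  obtain ⟨R'', H'', hB'', hQ, he'⟩ := h hκ hB'
  refine ⟨R'', H'', hB'', hQ, fun fuel τ hf => ?_⟩
  obtain ⟨t, ht, h1⟩ := he fuel τ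
  obtain ⟨t', ht', h2⟩ := he' fuel (τ + t) (by rw [Nat.succ_mul] at hf; omega)
  refine ⟨t + t', by rw [Nat.succ_mul]; omega, ?_⟩
  rw [evalList, h1, PMF.pure_bind, ← add_assoc]
  exact h2

theorem Runs.const {d : ℕ} {z : ℤ} (hb : |z| < 2 ^ Λ)
    (h : Runs O Λ κ ρ l (Function.update R d z) H N Q) (hr : d < ρ := by decide) :
    Runs O Λ κ ρ (.const d z :: l) R H (N + 1) Q := by
  refine Runs.step (fun hκ hB => ⟨hB.reg d hb, fun fuel τ => ⟨1 + bitLen z, ?_, ?_⟩⟩) h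
  · have := bitLen_le hb; omega
  · rw [eval, Config.write, update_layout_reg hr]

theorem Runs.add {d x y : ℕ} (v : ℤ) (hv : R x + R y = v) (hb : |v| < 2 ^ Λ)
    (h : Runs O Λ κ ρ l (Function.update R d v) H N Q)
    (hr : d < ρ ∧ x < ρ ∧ y < ρ := by decide) :
    Runs O Λ κ ρ (.add d x y :: l) R H (N + 1) Q := by
  subst hv
  refine Runs.step (fun hκ hB => ⟨hB.reg d hb, fun fuel τ => ⟨1 + bitLen (R x) + bitLen (R y), ?_, ?_⟩⟩) h
  · have := bitLen_le (hB.1 x); have := bitLen_le (hB.1 y); omega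
  · simp only [eval, Config.write, layout_reg hr.2.1, layout_reg hr.2.2, update_layout_reg hr.1]

theorem Runs.sub {d x y : ℕ} (v : ℤ) (hv : R x - R y = v) (hb : |v| < 2 ^ Λ)
    (h : Runs O Λ κ ρ l (Function.update R d v) H N Q)
    (hr : d < ρ ∧ x < ρ ∧ y < ρ := by decide) :
    Runs O Λ κ ρ (.sub d x y :: l) R H (N + 1) Q := by
  subst hv
  refine Runs.step (fun hκ hB => ⟨hB.reg d hb, fun fuel τ => ⟨1 + bitLen (R x) + bitLen (R y), ?_, ?_⟩⟩) h
  · have := bitLen_le (hB.1 x); have := bitLen_le (hB.1 y); omega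
  · simp only [eval, Config.write, layout_reg hr.2.1, layout_reg hr.2.2, update_layout_reg hr.1]

theorem Runs.mul {d x y : ℕ} (v : ℤ) (hv : R x * R y = v) (hb : |v| < 2 ^ Λ)
    (h : Runs O Λ κ ρ l (Function.update R d v) H N Q)
    (hr : d < ρ ∧ x < ρ ∧ y < ρ := by decide) :
    Runs O Λ κ ρ (.mul d x y :: l) R H (N + 1) Q := by
  subst hv
  refine Runs.step (fun hκ hB => ⟨hB.reg d hb, fun fuel τ => ⟨1 + bitLen (R x) + bitLen (R y), ?_, ?_⟩⟩) h
  · have := bitLen_le (hB.1 x); have := bitLen_le (hB.1 y); omega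
  · simp only [eval, Config.write, layout_reg hr.2.1, layout_reg hr.2.2, update_layout_reg hr.1]

theorem Runs.div {d x y : ℕ} (v : ℤ) (hv : R x / R y = v) (hb : |v| < 2 ^ Λ)
    (h : Runs O Λ κ ρ l (Function.update R d v) H N Q)
    (hr : d < ρ ∧ x < ρ ∧ y < ρ := by decide) :
    Runs O Λ κ ρ (.div d x y :: l) R H (N + 1) Q := by
  subst hv
  refine Runs.step (fun hκ hB => ⟨hB.reg d hb, fun fuel τ => ⟨1 + bitLen (R x) + bitLen (R y), ?_, ?_⟩⟩) h
  · have := bitLen_le (hB.1 x); have := bitLen_le (hB.1 y); omega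
  · simp only [eval, Config.write, layout_reg hr.2.1, layout_reg hr.2.2, update_layout_reg hr.1]

theorem Runs.load {d x : ℕ} (a v : ℤ) (hx : R x = a) (ha : a < 0 ∨ (ρ : ℤ) ≤ a) (hv : H a = v)
    (h : Runs O Λ κ ρ l (Function.update R d v) H N Q)
    (hr : d < ρ ∧ x < ρ := by decide) :
    Runs O Λ κ ρ (.load d x :: l) R H (N + 1) Q := by
  subst hx hv
  refine Runs.step (fun hκ hB => ⟨hB.reg d (hB.2 _), fun fuel τ => ⟨1 + bitLen (R x) + bitLen (H (R x)), ?_, ?_⟩⟩) h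
  · have := bitLen_le (hB.1 x); have := bitLen_le (hB.2 (R x)); omega
  · simp only [eval, Config.write, layout_reg hr.2, layout_heap ha, update_layout_reg hr.1]

theorem Runs.store {d x : ℕ} (a v : ℤ) (hd : R d = a) (ha : a < 0 ∨ (ρ : ℤ) ≤ a) (hv : R x = v)
    (h : Runs O Λ κ ρ l R (Function.update H a v) N Q)
    (hr : d < ρ ∧ x < ρ := by decide) :
    Runs O Λ κ ρ (.store d x :: l) R H (N + 1) Q := by
  subst hd hv
  refine Runs.step (fun hκ hB => ⟨hB.heap _ (hB.1 x), fun fuel τ => ⟨1 + bitLen (R d) + bitLen (R x), ?_, ?_⟩⟩) h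
  · have := bitLen_le (hB.1 d); have := bitLen_le (hB.1 x); omega
  · simp only [eval, Config.write, layout_reg hr.1, layout_reg hr.2, update_layout_heap ha]

theorem block_eq_map (s : Config) (base : ℤ) (len : ℕ) :
    s.block base len = (List.range len).map fun i : ℕ => s.mem (base + i) := by
  simp [Config.block, ← List.map_eq_flatMap, Function.comp_def]

theorem bitLenList_le {L : List ℤ} (h : ∀ z ∈ L, |z| < 2 ^ Λ) : bitLenList L ≤ L.length * Λ := by
  rw [bitLenList, ← List.length_map (f := bitLen)]
  refine List.sum_le_card_nsmul _ _ fun x hx => ?_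
  obtain ⟨z, hz, rfl⟩ := List.mem_map.1 hx
  exact bitLen_le (h z hz)

/-- The cost of this command grows with the query and with the number of answer bits to be read,
hence the separate lower bound on κ. -/
theorem Runs.ask {d x t b : ℕ} (base : ℤ) (len lim : ℕ) (query : List ℤ)
    (hx : R x = base) (ht : R t = len) (hl : R b = lim) (hbase : (ρ : ℤ) ≤ base)
    (hq : (List.range len).map (fun i : ℕ => H (base + i)) = query)
    (hcost : 1 + 3 * Λ + len + len * Λ + lim ≤ κ)
    (hb : |saturate lim (O query)| < 2 ^ Λ)
    (h : Runs O Λ κ ρ l (Function.update R d (saturate lim (O query))) H N Q)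
    (hr : d < ρ ∧ x < ρ ∧ t < ρ ∧ b < ρ := by decide) :
    Runs O Λ κ ρ (.ask d x t b :: l) R H (N + 1) Q := by
  have hblock : ∀ τ, Config.block ⟨layout ρ R H, τ⟩ base len = query := by
    intro τ
    rw [← hq, block_eq_map]
    refine List.map_congr_left fun i _ => layout_heap ?_ R H
    right; omega
  refine Runs.step (fun hκ hB => ⟨hB.reg d hb, fun fuel τ => ⟨1 + bitLen (R x) + bitLen (R t) +
    bitLen (R b) + len + bitLenList query + lim, ?_, ?_⟩⟩) h
  · have h1 : bitLenList query ≤ len * Λ := by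
      have := bitLenList_le (Λ := Λ) (L := query) (by
        intro z hz
        rw [← hq] at hz
        obtain ⟨i, -, rfl⟩ := List.mem_map.1 hz
        exact hB.2 _)
      rwa [← hq, List.length_map, List.length_range, hq] at this
    have := bitLen_le (hB.1 x); have := bitLen_le (hB.1 t); have := bitLen_le (hB.1 b)
    omega
  · simp only [eval, Config.write, layout_reg hr.2.1, layout_reg hr.2.2.1, layout_reg hr.2.2.2,
      hx, ht, hl, Int.toNat_natCast, hblock, update_layout_reg hr.1]

/-- Sequential composition. -/
theorem Runs.seq {c : Cmd} {P : (ℕ → ℤ) → (ℤ → ℤ) → Prop} {N₁ : ℕ}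
    (h₁ : Runs O Λ κ ρ [c] R H N₁ P)
    (h₂ : ∀ R' H', Bounded Λ R' H' → P R' H' → Runs O Λ κ ρ l R' H' N Q) :
    Runs O Λ κ ρ (c :: l) R H (N + N₁) Q := by
  intro hκ hB
  obtain ⟨R', H', hB', hP, he⟩ := h₁ hκ hB
  obtain ⟨R'', H'', hB'', hQ, he'⟩ := h₂ R' H' hB' hP hκ hB'
  refine ⟨R'', H'', hB'', hQ, fun fuel τ hf => ?_⟩
  rw [Nat.add_mul] at hf
  obtain ⟨t, ht, h1⟩ := he fuel τ (by omega)
  obtain ⟨t', ht', h2⟩ := he' fuel (τ + t) (by omega)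
  refine ⟨t + t', by rw [Nat.add_mul]; omega, ?_⟩
  have h1' : eval O fuel c ⟨layout ρ R H, τ⟩ = PMF.pure (some ⟨layout ρ R' H', τ + t⟩) := by
    rw [← h1, ← eval_block O fuel [c] (by simp)]; rfl
  rw [evalList, h1', PMF.pure_bind, ← add_assoc]
  exact h2

theorem Runs.append {l' : List Cmd} {P : (ℕ → ℤ) → (ℤ → ℤ) → Prop} {N₁ : ℕ}
    (h₁ : Runs O Λ κ ρ l' R H N₁ P)
    (h₂ : ∀ R' H', Bounded Λ R' H' → P R' H' → Runs O Λ κ ρ l R' H' N Q) :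
    Runs O Λ κ ρ (l' ++ l) R H (N + N₁) Q := by
  intro hκ hB
  obtain ⟨R', H', hB', hP, he⟩ := h₁ hκ hB
  obtain ⟨R'', H'', hB'', hQ, he'⟩ := h₂ R' H' hB' hP hκ hB'
  refine ⟨R'', H'', hB'', hQ, fun fuel τ hf => ?_⟩
  rw [Nat.add_mul] at hf
  obtain ⟨t, ht, h1⟩ := he fuel τ (by omega)
  obtain ⟨t', ht', h2⟩ := he' fuel (τ + t) (by omega)
  refine ⟨t + t', by rw [Nat.add_mul]; omega, ?_⟩
  rw [evalList_append, h1, PMF.pure_bind, ← add_assoc]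
  exact h2

theorem Runs.ite {r : ℕ} {l₁ l₂ : List Cmd} (hl₁ : l₁ ≠ []) (hl₂ : l₂ ≠ [])
    (h₁ : 0 < R r → Runs O Λ κ ρ l₁ R H N Q) (h₂ : R r ≤ 0 → Runs O Λ κ ρ l₂ R H N Q)
    (hr : r < ρ := by decide) :
    Runs O Λ κ ρ [.ite r (block l₁) (block l₂)] R H (N + 1) Q := by
  intro hκ hB
  have hbit := bitLen_le (hB.1 r)
  by_cases hpos : 0 < R r
  · obtain ⟨R', H', hB', hQ, he⟩ := h₁ hpos hκ hB
    refine ⟨R', H', hB', hQ, fun fuel τ hf => ?_⟩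
    rw [Nat.succ_mul] at hf
    obtain ⟨t, ht, h1⟩ := he fuel (τ + (1 + bitLen (R r))) (by omega)
    refine ⟨1 + bitLen (R r) + t, by rw [Nat.succ_mul]; omega, ?_⟩
    rw [← eval_block O fuel _ (by simp), block, eval]
    simp only [layout_reg hr, if_pos hpos, Config.tick]
    rw [eval_block O fuel _ hl₁, h1, add_assoc]
  · obtain ⟨R', H', hB', hQ, he⟩ := h₂ (not_lt.1 hpos) hκ hB
    refine ⟨R', H', hB', hQ, fun fuel τ hf => ?_⟩
    rw [Nat.succ_mul] at hf
    obtain ⟨t, ht, h1⟩ := he fuel (τ + (1 + bitLen (R r))) (by omega)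
    refine ⟨1 + bitLen (R r) + t, by rw [Nat.succ_mul]; omega, ?_⟩
    rw [← eval_block O fuel _ (by simp), block, eval]
    simp only [layout_reg hr, if_neg hpos, Config.tick]
    rw [eval_block O fuel _ hl₂, h1, add_assoc]

/-- A loop that is run `cnt` times, with invariant `I i` after `i` runs of its body. -/
theorem Runs.loop {r : ℕ} {body : List Cmd} (cnt Nb : ℕ) (I : ℕ → (ℕ → ℤ) → (ℤ → ℤ) → Prop)
    (h0 : I 0 R H)
    (hstep : ∀ i < cnt, ∀ R H, Bounded Λ R H → I i R H →
      0 < R r ∧ Runs O Λ κ ρ body R H Nb (I (i + 1)))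
    (hend : ∀ R H, I cnt R H → R r ≤ 0) (hbody : body ≠ [] := by simp) (hr : r < ρ := by decide) :
    Runs O Λ κ ρ [.loop r (block body)] R H (cnt * (Nb + 1) + 1) (I cnt) := by
  intro hκ hB
  -- Induction on the number j of rounds still to come. Tests and fuel are separate here, because
  -- `iterate` counts down its tests while every run of the body receives the same fuel. When no
  -- round remains the body is not run and the fuel is irrelevant.
  have key : ∀ j i, i + j = cnt → ∀ R H, Bounded Λ R H → I i R H →
      ∃ R' H', Bounded Λ R' H' ∧ I cnt R' H' ∧ ∀ fuel τ tests, (Nb + 1) * κ < fuel ∨ j = 0 →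
        j < tests → ∃ t ≤ (j * (Nb + 1) + 1) * κ,
        iterate r (eval O fuel (block body)) tests ⟨layout ρ R H, τ⟩
          = PMF.pure (some ⟨layout ρ R' H', τ + t⟩) := by
    intro j
    induction j with
    | zero =>
      intro i hi R H hB hI
      rw [Nat.add_zero] at hi
      subst hi
      refine ⟨R, H, hB, hI, fun fuel τ tests _ ht => ?_⟩
      obtain ⟨u, rfl⟩ : ∃ u, tests = u + 1 := ⟨tests - 1, by omega⟩
      have hneg := not_lt.2 (hend R H hI)
      have hbit := bitLen_le (hB.1 r)
      refine ⟨1 + bitLen (R r), by rw [zero_mul, zero_add, one_mul]; omega, ?_⟩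
      rw [iterate]
      simp only [layout_reg hr, if_neg hneg, Config.tick]
    | succ j ih =>
      intro i hi R H hB hI
      obtain ⟨hpos, hrun⟩ := hstep i (by omega) R H hB hI
      obtain ⟨R₁, H₁, hB₁, hI₁, he₁⟩ := hrun hκ hB
      obtain ⟨R₂, H₂, hB₂, hI₂, he₂⟩ := ih (i + 1) (by omega) R₁ H₁ hB₁ hI₁
      refine ⟨R₂, H₂, hB₂, hI₂, fun fuel τ tests hf ht => ?_⟩
      have hf' : (Nb + 1) * κ < fuel := by rcases hf with h | h; exacts [h, absurd h (by omega)]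
      obtain ⟨u, rfl⟩ : ∃ u, tests = u + 1 := ⟨tests - 1, by omega⟩
      have hbit := bitLen_le (hB.1 r)
      obtain ⟨t₁, ht₁, h1⟩ := he₁ fuel (τ + (1 + bitLen (R r))) (by
        rw [Nat.succ_mul] at hf'; omega)
      obtain ⟨t₂, ht₂, h2⟩ := he₂ fuel (τ + (1 + bitLen (R r)) + t₁) u (Or.inl hf') (by omega)
      refine ⟨1 + bitLen (R r) + t₁ + t₂, ?_, ?_⟩
      · have : ((j + 1) * (Nb + 1) + 1) * κ = (j * (Nb + 1) + 1) * κ + (Nb * κ + κ) := by ring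
        rw [this]; omega
      · rw [iterate]
        simp only [layout_reg hr, if_pos hpos, Config.tick]
        rw [eval_block O fuel _ hbody, h1, PMF.pure_bind]
        simp only []
        rw [h2]
        congr 3
        omega
  obtain ⟨R', H', hB', hI', he⟩ := key cnt 0 (by omega) R H hB h0
  refine ⟨R', H', hB', hI', fun fuel τ hf => ?_⟩
  have hcnt : cnt < fuel := by
    refine lt_of_le_of_lt ?_ hf
    have : 1 ≤ κ := by omega
    calc cnt ≤ cnt * (Nb + 1) + 1 := by nlinarith
      _ ≤ _ := Nat.le_mul_of_pos_right _ this
  have hf' : (Nb + 1) * κ < fuel ∨ cnt = 0 := by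
    rcases Nat.eq_zero_or_pos cnt with h | h
    · exact Or.inr h
    · left
      refine lt_of_le_of_lt (Nat.mul_le_mul_right _ ?_) hf
      nlinarith
  obtain ⟨t, ht, h⟩ := he fuel τ fuel hf' hcnt
  refine ⟨t, ht, ?_⟩
  rw [← eval_block O fuel _ (by simp), block, eval]
  exact h

end Rules

/-! ### Coin flips -/

/-- The inductive step of the coin loop: a fair bit followed by T independent fair bits. -/
theorem uniform_cons (T : ℕ) :
    (PMF.uniformOfFintype Bool).bind (fun r => (PMF.uniformOfFintype (Fin T → Bool)).map
      fun ω => (Fin.cons r ω : Fin (T + 1) → Bool)) = PMF.uniformOfFintype (Fin (T + 1) → Bool) := by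
  ext ω
  rw [PMF.bind_apply, tsum_fintype]
  have h : ∀ r : Bool, ((PMF.uniformOfFintype (Fin T → Bool)).map
      fun ω => (Fin.cons r ω : Fin (T + 1) → Bool)) ω
      = if r = ω 0 then ((2 : ℝ≥0∞) ^ T)⁻¹ else 0 := by
    intro r
    rw [PMF.map_apply, tsum_eq_single (Fin.tail ω)]
    · have : (ω = Fin.cons r (Fin.tail ω)) ↔ r = ω 0 := by
        constructor
        · intro h; rw [h]; simp
        · rintro rfl; exact (Fin.cons_self_tail ω).symm
      simp only [this]
      simp
    · intro ω' hω'
      rw [if_neg]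
      rintro rfl
      exact hω' (by simp)
  simp only [h, PMF.uniformOfFintype_apply]
  rw [Finset.sum_eq_single (ω 0)]
  · rw [if_pos rfl, ← ENNReal.mul_inv (by simp) (by simp)]
    simp [pow_succ, mul_comm]
  · intro r _ hr; rw [if_neg hr, mul_zero]
  · simp

theorem bitVal_cons_zero {T : ℕ} (r : Bool) (ω : Fin T → Bool) :
    bitVal (Fin.cons r ω : Fin (T + 1) → Bool) 0 = if r then 1 else 0 := by
  rw [bitVal, dif_pos (by omega)]
  cases r <;> rfl

theorem bitVal_cons_succ {T : ℕ} (r : Bool) (ω : Fin T → Bool) (y : ℕ) :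
    bitVal (Fin.cons r ω : Fin (T + 1) → Bool) (y + 1) = bitVal ω y := by
  rw [bitVal, bitVal]
  by_cases h : y < T
  · rw [dif_pos (by omega), dif_pos h]
    rfl
  · rw [dif_neg (by omega), dif_neg h]

/-- Registers `R` whose first 30 entries are the parameters `P`. -/
def Agree (P R : ℕ → ℤ) : Prop := ∀ i < 30, R i = P i

theorem Agree.update {P R : ℕ → ℤ} (h : Agree P R) {d : ℕ} {v : ℤ} (hd : 30 ≤ d := by decide) :
    Agree P (Function.update R d v) := by
  intro i hi
  rw [Function.update_of_ne (by omega)]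
  exact h i hi

/-- Write a fair bit to the cell that register 31 points at. -/
def coinBody : List Cmd := [.coin 32, .store 31 32, .add 31 31 4, .sub 30 30 4]

/-- All randomness is collected here into one uniform bit string ω. Registers, heap and elapsed time
become functions of ω, and everything executed afterwards is deterministic. -/
theorem iterate_coinBody {O : Oracle} {Λ κ : ℕ} {P : ℕ → ℤ} (hP : P 4 = 1) (hκ : 1 + 3 * Λ ≤ κ)
    (hΛ : 0 < Λ) (T : ℕ) : ∀ (B : ℤ) (R : ℕ → ℤ) (H : ℤ → ℤ), 64 ≤ B → B + T < 2 ^ Λ →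
    Bounded Λ R H → Agree P R → R 30 = T → R 31 = B →
    ∀ fuel τ tests, 3 * κ < fuel → T < tests →
    ∃ (R' : (Fin T → Bool) → ℕ → ℤ) (H' : (Fin T → Bool) → ℤ → ℤ) (t : (Fin T → Bool) → ℕ),
      iterate 30 (eval O fuel (block coinBody)) tests ⟨layout 64 R H, τ⟩
        = (PMF.uniformOfFintype (Fin T → Bool)).map
          (fun ω => some ⟨layout 64 (R' ω) (H' ω), τ + t ω⟩) ∧
      ∀ ω, t ω ≤ (5 * T + 1) * κ ∧ Bounded Λ (R' ω) (H' ω) ∧ Agree P (R' ω) ∧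
        (∀ y < T, H' ω (B + y) = bitVal ω y) ∧ ∀ z < B, H' ω z = H z := by
  induction T with
  | zero =>
    intro B R H _ _ hB hA h30 h31 fuel τ tests _ ht
    obtain ⟨u, rfl⟩ : ∃ u, tests = u + 1 := ⟨tests - 1, by omega⟩
    refine ⟨fun _ => R, fun _ => H, fun _ => 1 + bitLen (R 30), ?_, fun ω => ⟨?_, hB, hA, ?_, ?_⟩⟩
    · rw [iterate]
      simp only [layout_reg (show 30 < 64 by decide), Config.tick]
      rw [if_neg (by rw [h30]; simp)]
      exact (PMF.map_const _ _).symm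
    · have := bitLen_le (hB.1 30)
      show 1 + bitLen (R 30) ≤ _
      omega
    · intro y hy; omega
    · intro z _; rfl
  | succ T ih =>
    intro B R H h64 hBT hB hA h30 h31 fuel τ tests hf ht
    obtain ⟨u, rfl⟩ : ∃ u, tests = u + 1 := ⟨tests - 1, by omega⟩
    push_cast at hBT
    have h2 : (1 : ℤ) < 2 ^ Λ := one_lt_pow₀ (by norm_num) (by omega)
    have hbody : ∀ r : Bool, ∃ R' H', Bounded Λ R' H' ∧ (Agree P R' ∧ R' 30 = T ∧ R' 31 = B + 1 ∧
        H' = Function.update H B (if r then 1 else 0)) ∧ ∀ fuel τ, 3 * κ < fuel →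
        ∃ t ≤ 3 * κ, evalList O fuel [.store 31 32, .add 31 31 4, .sub 30 30 4]
          ⟨layout 64 (Function.update R 32 (if r then 1 else 0)) H, τ⟩
            = PMF.pure (some ⟨layout 64 R' H', τ + t⟩) := by
      intro r
      have hr : |(if r then 1 else 0 : ℤ)| < 2 ^ Λ := by
        cases r
        · simp
        · simpa using h2
      have h4 : R 4 = 1 := (hA 4 (by decide)).trans hP
      have : Runs O Λ κ 64 [.store 31 32, .add 31 31 4, .sub 30 30 4]
          (Function.update R 32 (if r then 1 else 0)) H 3
          (fun R' H' => Agree P R' ∧ R' 30 = T ∧ R' 31 = B + 1 ∧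
            H' = Function.update H B (if r then 1 else 0)) := by
        refine Runs.store B (if r then 1 else 0) (by simp [h31]) (by right; exact_mod_cast h64)
          (by simp) ?_
        refine Runs.add (B + 1) (by simp [h31, h4]) (by rw [abs_of_nonneg] <;> omega) ?_
        refine Runs.sub (T : ℤ) (by simp [h30, h4]) (by rw [abs_of_nonneg] <;> omega) ?_
        exact Runs.nil ⟨hA.update.update.update, by simp, by simp, rfl⟩
      exact this hκ (hB.reg 32 hr)
    choose R₁ H₁ hB₁ hQ₁ he₁ using hbody
    have hih := fun r τ => ih (B + 1) (R₁ r) (H₁ r) (by omega) (by omega) (hB₁ r) (hQ₁ r).1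
      (hQ₁ r).2.1 (hQ₁ r).2.2.1 fuel τ u hf (by omega)
    have he₁' := fun r => he₁ r fuel (τ + (1 + bitLen (R 30)) + 1) hf
    choose t₁ ht₁ he₁ using he₁'
    have hih' := fun r => hih r (τ + (1 + bitLen (R 30)) + 1 + t₁ r)
    choose R₂ H₂ t₂ heq hpost using hih'
    have hcb : ∀ s, eval O fuel (block coinBody) s
        = evalList O fuel [.coin 32, .store 31 32, .add 31 31 4, .sub 30 30 4] s :=
      fun s => eval_block O fuel coinBody (by simp [coinBody]) s
    refine ⟨fun ω => R₂ (ω 0) (Fin.tail ω), fun ω => H₂ (ω 0) (Fin.tail ω),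
      fun ω => 1 + bitLen (R 30) + 1 + t₁ (ω 0) + t₂ (ω 0) (Fin.tail ω), ?_, fun ω => ?_⟩
    · rw [iterate]
      simp only [layout_reg (show 30 < 64 by decide), Config.tick]
      rw [if_pos (by rw [h30]; positivity), hcb, evalList,
        eval, PMF.bind_bind, PMF.bind_map, ← uniform_cons, PMF.map_bind]
      congr 1
      funext r
      simp only [Function.comp, Config.write, update_layout_reg (show 32 < 64 by decide)]
      rw [he₁ r, PMF.pure_bind]
      simp only []
      rw [heq r, PMF.map_comp]
      congr 1
      funext ω
      simp only [Function.comp, Fin.cons_zero, Fin.tail_cons, add_assoc]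
    · obtain ⟨h1, h2, h3, h4, h5⟩ := hpost (ω 0) (Fin.tail ω)
      have hω : ω = Fin.cons (ω 0) (Fin.tail ω) := (Fin.cons_self_tail ω).symm
      have hbit := bitLen_le (hB.1 30)
      have ht := ht₁ (ω 0)
      refine ⟨?_, h2, h3, ?_, ?_⟩
      -- One round consists of a test, a flip and three further commands, each of cost at most κ.
      · have : (5 * (T + 1) + 1) * κ = (5 * T + 1) * κ + 5 * κ := by ring
        rw [this]
        show 1 + bitLen (R 30) + 1 + t₁ (ω 0) + t₂ (ω 0) (Fin.tail ω) ≤ _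
        omega
      · intro y hy
        show H₂ (ω 0) (Fin.tail ω) _ = _
        conv_rhs => rw [hω]
        cases y with
        | zero =>
          rw [bitVal_cons_zero, Nat.cast_zero, add_zero,
            h5 B (by omega), (hQ₁ (ω 0)).2.2.2]
          simp
        | succ y =>
          rw [bitVal_cons_succ, ← h4 y (by omega)]
          congr 1; push_cast; ring
      · intro z hz
        show H₂ (ω 0) (Fin.tail ω) _ = _
        rw [h5 z (by omega), (hQ₁ (ω 0)).2.2.2, Function.update_of_ne (by omega)]

/-! ### Computing the parameters -/

/-- Number of oracle query cells. -/
def queryLength (k n : ℕ) : ℕ := 5 + 2 * n * (n + k)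

/-- The parameters kept in registers `0, …, 29`. -/
def params (k n p a b : ℕ) : ℕ → ℤ := fun i =>
  [-((p + a : ℕ) : ℤ), (p : ℕ), (a : ℕ), (b : ℕ), 1, (n : ℕ), (k : ℕ), 2, (slack k : ℕ),
    (gridRoot k n : ℕ), (gridRoot k n ^ 2 : ℕ), (coarseBits k n : ℕ), (2 ^ Nat.size b : ℕ),
    (fineBits p b : ℕ), (nodeBase k n b : ℕ), (queryError k n a b : ℕ), (queryFailure k b : ℕ),
    (answerBits k n p b : ℕ), (2 ^ p : ℕ), (2 ^ fineBits p b : ℕ),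
    (coarseBits k n * 2 ^ fineBits p b + 2 ^ fineBits p b / 2 : ℕ), (2 * coarseBits k n : ℕ),
    (coinCount k n p b : ℕ), (2 * n : ℕ), (queryLength k n : ℕ), (64 + queryLength k n : ℕ),
    (2 * n * k : ℕ), (64 + queryLength k n + 2 * n * k : ℕ), (2 * k : ℕ), 0].getD i 0

/-- A bound for the numbers that occur in the computation of the parameters. -/
def paramBound (k n p a b : ℕ) : ℕ :=
  100 + p + a + b + 4 * n ^ 2 + 4 * n + 2 * k + k * n + 8 * slack k ^ 2 + gridRoot k n ^ 2 ^ 2 + 2 ^ fineBits p b +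
    nodeBase k n b + 2 * nodeBase k n b * (n + k) + a * (k + 1) + (n + k) + queryError k n a b + queryFailure k b +
    answerBits k n p b + 2 * (coarseBits k n + 1) * 2 ^ fineBits p b + 2 * (fineBits p b + 2 * coarseBits k n) +
    coinCount k n p b + queryLength k n + 2 * n * k

/-- The first `m` registers hold the numbers `P`. -/
def AgreeTo (m : ℕ) (P R : ℕ → ℤ) : Prop := ∀ i < m, R i = P i

theorem AgreeTo.step {m : ℕ} {P R : ℕ → ℤ} (h : AgreeTo m P R) {v : ℤ} (hv : v = P m) :
    AgreeTo (m + 1) P (Function.update R m v) := by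
  intro i hi
  rcases Nat.lt_succ_iff_lt_or_eq.1 hi with h' | rfl
  · rw [Function.update_of_ne (by omega)]
    exact h i h'
  · simp [hv]

theorem AgreeTo.scratch {m d : ℕ} {P R : ℕ → ℤ} (h : AgreeTo m P R) {v : ℤ}
    (hd : m ≤ d := by decide) : AgreeTo m P (Function.update R d v) := by
  intro i hi
  rw [Function.update_of_ne (by omega)]
  exact h i hi

theorem abs_cast_lt {Λ G v : ℕ} (hG : G < 2 ^ Λ) (h : v ≤ G) : |(v : ℤ)| < 2 ^ Λ := by
  rw [abs_of_nonneg (by positivity)]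
  exact_mod_cast h.trans_lt hG

theorem abs_lt_of_le {Λ G : ℕ} {v : ℤ} (hG : G < 2 ^ Λ) (h₁ : v ≤ G) (h₂ : -(G : ℤ) ≤ v) :
    |v| < 2 ^ Λ :=
  lt_of_le_of_lt (abs_le.2 ⟨h₂, h₁⟩) (by exact_mod_cast hG)

/-- Compute `L₁ = gridRoot k n`, its square, and `coarseBits k n`. -/
def gridCode (k : ℕ) : List Cmd :=
  [.const 6 k, .const 7 2, .const 8 (slack k), .const 31 0, .add 30 5 4,
    .loop 30 (block [.add 31 31 4, .mul 32 31 31, .add 30 5 4, .sub 30 30 32]),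
    .mul 9 8 31, .mul 10 9 9, .sub 31 10 4, .mul 11 10 31]

/-- Compute `2 ^ size b`, `fineBits p b` and `nodeBase k n b`. -/
def scaleCode : List Cmd :=
  [.const 31 1, .const 32 0, .add 32 32 1, .const 30 0, .add 30 30 3,
    .loop 30 (block [.div 30 30 7, .add 31 31 31, .add 32 32 4]),
    .const 30 0, .add 12 31 30, .add 13 32 30, .mul 14 9 12]

/-- Compute `queryError k n a b`, `queryFailure k b` and `answerBits k n p b`. -/
def errorCode (k : ℕ) : List Cmd :=
  [.const 33 (k + 1 : ℕ), .mul 33 2 33, .add 32 5 6, .mul 32 14 32, .mul 32 32 7, .const 30 k,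
    .loop 30 (block [.mul 33 33 32, .sub 30 30 4]),
    .const 31 0, .add 15 33 31, .const 31 (72 * (k + 1) : ℕ), .mul 16 31 3,
    .const 31 (8 * slack k ^ 2 : ℕ), .add 32 5 5, .add 31 31 32, .add 31 31 3, .mul 31 32 31,
    .add 31 31 1, .add 17 31 4]

/-- Compute the remaining parameters. -/
def addressCode : List Cmd :=
  [.const 31 1, .const 30 0, .add 30 30 1, .loop 30 (block [.add 31 31 31, .sub 30 30 4]),
    .const 30 0, .add 18 31 30, .mul 19 18 12, .mul 31 11 19, .div 32 19 7, .add 20 31 32,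
    .add 21 11 11, .add 31 13 21, .mul 31 31 7, .mul 32 5 6, .mul 22 32 31, .add 23 5 5,
    .add 31 5 6, .mul 31 23 31, .const 32 5, .add 24 31 32, .const 31 64, .add 25 31 24,
    .mul 26 23 6, .add 27 25 26, .add 28 6 6, .const 29 0]

section

variable {O : Oracle} {Λ κ k n p a b : ℕ} {R : ℕ → ℤ} {H : ℤ → ℤ}

/-- The integer square root is found by counting s upwards while n + 1 - s² > 0; the loop stops
precisely at s = √n + 1 (rounded down root), the factor that occurs in `gridRoot`. -/
theorem runs_gridCode (hG : paramBound k n p a b < 2 ^ Λ)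
    (h : AgreeTo 6 (params k n p a b) R) :
    Runs O Λ κ 64 (gridCode k) R H (5 * n + 20) fun R' H' =>
      AgreeTo 12 (params k n p a b) R' ∧ H' = H := by
  have h4 : R 4 = 1 := h 4 (by decide)
  have h5 : R 5 = n := h 5 (by decide)
  have hf := Nat.zero_le (2 ^ fineBits p b)
  have hs : 1 ≤ slack k := by have := slack_ge k; omega
  have hL : gridRoot k n ^ 2 ≤ paramBound k n p a b := by
    have : gridRoot k n ^ 2 ≤ gridRoot k n ^ 2 ^ 2 :=
      Nat.pow_le_pow_right (by have := gridRoot_ge k n; omega) (by norm_num)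
    rw [paramBound]; omega
  have hL1 : gridRoot k n ≤ gridRoot k n ^ 2 := Nat.le_self_pow (by norm_num) _
  have hN : coarseBits k n ≤ paramBound k n p a b := by
    have := coarseBits_add k n
    rw [paramBound, show gridRoot k n ^ 2 ^ 2 = (gridRoot k n ^ 2) ^ 2 by ring]
    omega
  have hr : Nat.sqrt n + 1 ≤ gridRoot k n := Nat.le_mul_of_pos_left _ hs
  have hr2 : (Nat.sqrt n + 1) ^ 2 ≤ gridRoot k n ^ 2 := Nat.pow_le_pow_left hr 2
  have hnG : n + 100 + k ≤ paramBound k n p a b := by rw [paramBound]; omega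
  have hsG : slack k ≤ paramBound k n p a b := by
    have : slack k ≤ slack k ^ 2 := Nat.le_self_pow (by norm_num) _
    rw [paramBound]; omega
  refine Runs.mono (N := 4 + ((Nat.sqrt n + 1) * (4 + 1) + 1) + 5) ?_ ?_ fun _ _ _ hQ => hQ
  · unfold gridCode
    refine Runs.const (abs_cast_lt hG (by omega)) ?_
    refine Runs.const (abs_cast_lt (v := 2) hG (by omega)) ?_
    refine Runs.const (abs_cast_lt hG hsG) ?_
    refine Runs.const (abs_cast_lt (v := 0) hG (by omega)) ?_
    refine Runs.add ((n + 1 : ℕ) : ℤ) (by simp [h4, h5]) (abs_cast_lt hG (by omega)) ?_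
    refine Runs.seq (Runs.loop (Nat.sqrt n + 1) 4
      (fun s R H' => AgreeTo 9 (params k n p a b) R ∧ R 31 = (s : ℕ) ∧ R 30 = n + 1 - s ^ 2 ∧ H' = H)
      ⟨(((h.step rfl).step rfl).step rfl).scratch.scratch, by simp, by simp, rfl⟩ ?_ ?_) ?_
    · rintro i hi R H' - ⟨hA, h31, h30, rfl⟩
      have h4 : R 4 = 1 := hA 4 (by decide)
      have h5 : R 5 = n := hA 5 (by decide)
      have hin : i ^ 2 ≤ n := by
        have := Nat.sqrt_le' n
        have : i ^ 2 ≤ Nat.sqrt n ^ 2 := Nat.pow_le_pow_left (by omega) 2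
        omega
      have hi2 : (i + 1) ^ 2 ≤ (Nat.sqrt n + 1) ^ 2 := Nat.pow_le_pow_left (by omega) 2
      refine ⟨by rw [h30]; zify at hin; omega, ?_⟩
      refine Runs.add ((i + 1 : ℕ) : ℤ) (by simp [h4, h31]) (abs_cast_lt hG (by omega)) ?_
      refine Runs.mul (((i + 1) ^ 2 : ℕ) : ℤ) (by simp; ring) (abs_cast_lt hG (by omega)) ?_
      refine Runs.add ((n + 1 : ℕ) : ℤ) (by simp [h4, h5]) (abs_cast_lt hG (by omega)) ?_
      refine Runs.sub ((n : ℤ) + 1 - ((i + 1 : ℕ) : ℤ) ^ 2) (by simp)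
        (abs_lt_of_le hG ?_ ?_) ?_
      · have : (0 : ℤ) ≤ ((i + 1 : ℕ) : ℤ) ^ 2 := by positivity
        zify at hnG; omega
      · zify at hi2 hr2 hL; push_cast; linarith
      · exact Runs.nil ⟨hA.scratch.scratch.scratch.scratch, by simp, by simp, rfl⟩
    · rintro R H' ⟨hA, h31, h30, rfl⟩
      have := Nat.lt_succ_sqrt' n
      rw [h30]
      zify at this
      push_cast at this ⊢
      linarith
    · rintro R H' - ⟨hA, h31, h30, rfl⟩
      have h4 : R 4 = 1 := hA 4 (by decide)
      have h8 : R 8 = slack k := hA 8 (by decide)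
      refine Runs.mul (gridRoot k n : ℤ) (by simp [h8, h31, gridRoot])
        (abs_cast_lt hG (by omega)) ?_
      refine Runs.mul ((gridRoot k n ^ 2 : ℕ) : ℤ) (by simp; ring)
        (abs_cast_lt hG (by omega)) ?_
      refine Runs.sub ((gridRoot k n ^ 2 - 1 : ℕ) : ℤ) ?_
        (abs_cast_lt hG (by omega)) ?_
      · have : 1 ≤ gridRoot k n ^ 2 := Nat.one_le_pow _ _ (by omega)
        rw [Nat.cast_sub this]
        simp [h4]
      refine Runs.mul (coarseBits k n : ℤ) (by simp [coarseBits]) (abs_cast_lt hG hN) ?_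
      exact Runs.nil (N := 0)
        ⟨(((hA.step rfl).step rfl).scratch).step rfl, rfl⟩
  · have := Nat.sqrt_le_self n
    omega

/-- Halving b down to 0 takes `Nat.size b` rounds. Doubling a register in each round produces
2^(size b), and a counter started at p produces the number of fine bits. -/
theorem runs_scaleCode (hG : paramBound k n p a b < 2 ^ Λ)
    (h : AgreeTo 12 (params k n p a b) R) :
    Runs O Λ κ 64 scaleCode R H (4 * b + 20) fun R' H' =>
      AgreeTo 15 (params k n p a b) R' ∧ H' = H := by
  have hb : R 3 = b := h 3 (by decide)
  have hp : R 1 = p := h 1 (by decide)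
  have hf := Nat.zero_le (2 ^ fineBits p b)
  have hfp : 2 ^ fineBits p b ≤ paramBound k n p a b := by rw [paramBound]; omega
  have hβ : 2 ^ Nat.size b ≤ 2 ^ fineBits p b :=
    Nat.pow_le_pow_right (by norm_num) (by rw [fineBits]; omega)
  have hq : fineBits p b ≤ paramBound k n p a b := (Nat.lt_two_pow_self).le.trans hfp
  have hbG : p + b + 100 ≤ paramBound k n p a b := by rw [paramBound]; omega
  have hsb : Nat.size b ≤ b := Nat.size_le.2 Nat.lt_two_pow_self
  refine Runs.mono (N := 4 + (Nat.size b * (3 + 1) + 1) + 5) ?_ ?_ fun _ _ _ hQ => hQ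
  · unfold scaleCode
    refine Runs.const (abs_cast_lt (v := 1) hG (by omega)) ?_
    refine Runs.const (abs_cast_lt (v := 0) hG (by omega)) ?_
    refine Runs.add (p : ℤ) (by simp [hp]) (abs_cast_lt hG (by omega)) ?_
    refine Runs.const (abs_cast_lt (v := 0) hG (by omega)) ?_
    refine Runs.add (b : ℤ) (by simp [hb]) (abs_cast_lt hG (by omega)) ?_
    refine Runs.seq (Runs.loop (Nat.size b) 3
      (fun s R H' => AgreeTo 12 (params k n p a b) R ∧ R 30 = (b / 2 ^ s : ℕ) ∧
        R 31 = (2 ^ s : ℕ) ∧ R 32 = (p + s : ℕ) ∧ H' = H)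
      ⟨h.scratch.scratch.scratch.scratch.scratch, by simp, by simp, by simp, rfl⟩ ?_ ?_) ?_
    · rintro i hi R H' - ⟨hA, h30, h31, h32, rfl⟩
      have h4 : R 4 = 1 := hA 4 (by decide)
      have h7 : R 7 = 2 := hA 7 (by decide)
      have hpos : 0 < b / 2 ^ i := Nat.div_pos (Nat.lt_size.1 hi) (by positivity)
      have hp2 : 2 ^ (i + 1) ≤ 2 ^ Nat.size b := Nat.pow_le_pow_right (by norm_num) hi
      have hdiv : b / 2 ^ (i + 1) ≤ b := Nat.div_le_self _ _
      refine ⟨by rw [h30]; exact_mod_cast hpos, ?_⟩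
      refine Runs.div ((b / 2 ^ (i + 1) : ℕ) : ℤ)
        (by rw [h30, h7, pow_succ, ← Nat.div_div_eq_div_mul]; norm_cast)
        (abs_cast_lt hG (by omega)) ?_
      refine Runs.add ((2 ^ (i + 1) : ℕ) : ℤ) (by simp [h31]; ring) (abs_cast_lt hG (by omega)) ?_
      refine Runs.add ((p + (i + 1) : ℕ) : ℤ) (by simp [h32, h4]; ring)
        (abs_cast_lt hG (by omega)) ?_
      exact Runs.nil ⟨hA.scratch.scratch.scratch, by simp, by simp, by simp, rfl⟩
    · rintro R H' ⟨hA, h30, h31, h32, rfl⟩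
      rw [h30, Nat.div_eq_of_lt (Nat.lt_size_self b)]
      simp
    · rintro R H' - ⟨hA, h30, h31, h32, rfl⟩
      have h9 : R 9 = gridRoot k n := hA 9 (by decide)
      -- There is no copy command; a register is copied by adding a register that holds 0. Later
      -- code uses register 29 for this.
      refine Runs.const (abs_cast_lt (v := 0) hG (by omega)) ?_
      refine Runs.add ((2 ^ Nat.size b : ℕ) : ℤ) (by simp [h31]) (abs_cast_lt hG (by omega)) ?_
      refine Runs.add (fineBits p b : ℤ) (by simp [h32, fineBits]) (abs_cast_lt hG (by omega)) ?_
      refine Runs.mul (nodeBase k n b : ℤ) (by simp [h9, nodeBase]) (abs_cast_lt hG ?_) ?_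
      · rw [paramBound]; omega
      exact Runs.nil (N := 0) ⟨((hA.scratch.step rfl).step rfl).step rfl, rfl⟩
  · omega

/-- The two k-th powers in `queryError` are computed as one power of 2M(n+k). As this base is at
least 1, the intermediate values stay below the final one. -/
theorem runs_errorCode (hn : 0 < n) (hb : 0 < b) (hG : paramBound k n p a b < 2 ^ Λ)
    (h : AgreeTo 15 (params k n p a b) R) :
    Runs O Λ κ 64 (errorCode k) R H (3 * k + 20) fun R' H' =>
      AgreeTo 18 (params k n p a b) R' ∧ H' = H := by
  have h2 : R 2 = a := h 2 (by decide)
  have h5 : R 5 = n := h 5 (by decide)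
  have h6 : R 6 = k := h 6 (by decide)
  have h7 : R 7 = 2 := h 7 (by decide)
  have h14 : R 14 = nodeBase k n b := h 14 (by decide)
  have hf := Nat.zero_le (2 ^ fineBits p b)
  have hM := lt_nodeBase k n b
  have hpos : 0 < 2 * nodeBase k n b * (n + k) := by
    have : 0 < nodeBase k n b := by omega
    positivity
  have hMG : 2 * nodeBase k n b * (n + k) ≤ paramBound k n p a b := by rw [paramBound]; omega
  have hM1 : nodeBase k n b * (n + k) ≤ 2 * nodeBase k n b * (n + k) := by nlinarith
  have hmG : queryError k n a b ≤ paramBound k n p a b := by rw [paramBound]; omega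
  have hdG : queryFailure k b ≤ paramBound k n p a b := by rw [paramBound]; omega
  have hlG : answerBits k n p b ≤ paramBound k n p a b := by rw [paramBound]; omega
  have hakG : a * (k + 1) ≤ paramBound k n p a b := by rw [paramBound]; omega
  have hnG : n + k + 100 ≤ paramBound k n p a b := by rw [paramBound]; omega
  have hkG : k + 1 + 100 + 2 * n ≤ paramBound k n p a b := by rw [paramBound]; omega
  have hsG : 8 * slack k ^ 2 + 2 * n + b + 100 ≤ paramBound k n p a b := by rw [paramBound]; omega
  refine Runs.mono (N := 11 + (k * (2 + 1) + 1) + 6) ?_ ?_ fun _ _ _ hQ => hQ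
  · unfold errorCode
    refine Runs.const (abs_cast_lt hG (by omega)) ?_
    refine Runs.mul ((a * (k + 1) : ℕ) : ℤ) (by simp [h2]) (abs_cast_lt hG hakG) ?_
    refine Runs.add ((n + k : ℕ) : ℤ) (by simp [h5, h6]) (abs_cast_lt hG (by omega)) ?_
    refine Runs.mul ((nodeBase k n b * (n + k) : ℕ) : ℤ) (by simp [h14])
      (abs_cast_lt hG (by omega)) ?_
    refine Runs.mul ((2 * nodeBase k n b * (n + k) : ℕ) : ℤ) (by simp [h7]; ring)
      (abs_cast_lt hG (by omega)) ?_
    refine Runs.const (abs_cast_lt hG (by omega)) ?_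
    refine Runs.seq (Runs.loop k 2
      (fun s R H' => AgreeTo 15 (params k n p a b) R ∧ R 30 = k - s ∧
        R 32 = (2 * nodeBase k n b * (n + k) : ℕ) ∧
        R 33 = (a * (k + 1) * (2 * nodeBase k n b * (n + k)) ^ s : ℕ) ∧ H' = H)
      ⟨h.scratch.scratch.scratch.scratch.scratch.scratch, by simp, by simp, by simp, rfl⟩ ?_ ?_) ?_
    · rintro i hi R H' - ⟨hA, h30, h32, h33, rfl⟩
      have h4 : R 4 = 1 := hA 4 (by decide)
      have hpow : a * (k + 1) * (2 * nodeBase k n b * (n + k)) ^ (i + 1) ≤ queryError k n a b := by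
        rw [queryError, mul_assoc _ (_ ^ k) (_ ^ k), ← mul_pow]
        exact Nat.mul_le_mul_left _ (Nat.pow_le_pow_right hpos hi)
      refine ⟨by rw [h30]; zify at hi; omega, ?_⟩
      refine Runs.mul ((a * (k + 1) * (2 * nodeBase k n b * (n + k)) ^ (i + 1) : ℕ) : ℤ)
        (by rw [h32, h33, pow_succ]; push_cast; ring) (abs_cast_lt hG (hpow.trans hmG)) ?_
      refine Runs.sub ((k : ℤ) - (i + 1 : ℕ)) (by simp [h30, h4]; ring)
        (abs_lt_of_le hG (by omega) (by omega)) ?_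
      exact Runs.nil ⟨hA.scratch.scratch, by simp, by simp [h32], by simp, rfl⟩
    · rintro R H' ⟨hA, h30, -⟩
      rw [h30]; simp
    · rintro R H' - ⟨hA, h30, h32, h33, rfl⟩
      have h1 : R 1 = p := hA 1 (by decide)
      have h3 : R 3 = b := hA 3 (by decide)
      have h4 : R 4 = 1 := hA 4 (by decide)
      have h5 : R 5 = n := hA 5 (by decide)
      have hl1 : 2 * n * (8 * slack k ^ 2 + 2 * n + b) + p + 1 = answerBits k n p b := by
        rw [answerBits]; ring
      refine Runs.const (abs_cast_lt (v := 0) hG (by omega)) ?_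
      refine Runs.add (queryError k n a b : ℤ) ?_ (abs_cast_lt hG hmG) ?_
      · simp [h33, queryError, mul_pow]
        ring
      refine Runs.const (abs_cast_lt hG ?_) ?_
      · refine le_trans ?_ hdG
        rw [queryFailure]
        exact Nat.le_mul_of_pos_right _ hb
      refine Runs.mul (queryFailure k b : ℤ) (by simp [h3, queryFailure]) (abs_cast_lt hG hdG) ?_
      refine Runs.const (abs_cast_lt hG (by omega)) ?_
      refine Runs.add ((2 * n : ℕ) : ℤ) (by simp [h5]; ring) (abs_cast_lt hG (by omega)) ?_
      refine Runs.add ((8 * slack k ^ 2 + 2 * n : ℕ) : ℤ) (by simp)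
        (abs_cast_lt hG (by omega)) ?_
      refine Runs.add ((8 * slack k ^ 2 + 2 * n + b : ℕ) : ℤ) (by simp [h3])
        (abs_cast_lt hG (by omega)) ?_
      refine Runs.mul ((2 * n * (8 * slack k ^ 2 + 2 * n + b) : ℕ) : ℤ) (by simp)
        (abs_cast_lt hG (by omega)) ?_
      refine Runs.add ((2 * n * (8 * slack k ^ 2 + 2 * n + b) + p : ℕ) : ℤ) (by simp [h1])
        (abs_cast_lt hG (by omega)) ?_
      refine Runs.add (answerBits k n p b : ℤ) (by simp [h4, ← hl1]) (abs_cast_lt hG hlG) ?_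
      exact Runs.nil (N := 0)
        ⟨(((hA.scratch.step rfl).scratch.step rfl).scratch.scratch.scratch.scratch.scratch.scratch).step
          rfl, rfl⟩
  · omega

/-- The power 2^p is computed by p doublings, which is affordable because p counts in unary. -/
theorem runs_addressCode (hG : paramBound k n p a b < 2 ^ Λ)
    (h : AgreeTo 18 (params k n p a b) R) :
    Runs O Λ κ 64 addressCode R H (3 * p + 30) fun R' H' =>
      AgreeTo 30 (params k n p a b) R' ∧ H' = H := by
  have h1 : R 1 = p := h 1 (by decide)
  have hf := Nat.zero_le (2 ^ fineBits p b)
  have hf1 := Nat.one_le_two_pow (n := fineBits p b)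
  have hQ2 : 2 ^ fineBits p b / 2 ≤ 2 ^ fineBits p b := Nat.div_le_self _ _
  have hfG : 2 ^ fineBits p b ≤ paramBound k n p a b := by rw [paramBound]; omega
  have hpq : 2 ^ p ≤ 2 ^ fineBits p b :=
    Nat.pow_le_pow_right (by norm_num) (by rw [fineBits]; omega)
  have hpG : p + 100 ≤ paramBound k n p a b := by rw [paramBound]; omega
  have hqG : 2 * (coarseBits k n + 1) * 2 ^ fineBits p b ≤ paramBound k n p a b := by
    rw [paramBound]; omega
  have hq1 : coarseBits k n * 2 ^ fineBits p b + 2 ^ fineBits p b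
      ≤ 2 * (coarseBits k n + 1) * 2 ^ fineBits p b := by nlinarith
  have hNG : 2 * (fineBits p b + 2 * coarseBits k n) ≤ paramBound k n p a b := by
    rw [paramBound]; omega
  have hTG : coinCount k n p b ≤ paramBound k n p a b := by rw [paramBound]; omega
  have hnG : 4 * n + 2 * k + k * n + 100 ≤ paramBound k n p a b := by rw [paramBound]; omega
  have hBG : 64 + queryLength k n + 2 * n * k ≤ paramBound k n p a b := by rw [paramBound]; omega
  refine Runs.mono (N := 22 + (p * (2 + 1) + 1) + 3) ?_ ?_ fun _ _ _ hQ => hQ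
  · unfold addressCode
    refine Runs.const (abs_cast_lt (v := 1) hG (by omega)) ?_
    refine Runs.const (abs_cast_lt (v := 0) hG (by omega)) ?_
    refine Runs.add (p : ℤ) (by simp [h1]) (abs_cast_lt hG (by omega)) ?_
    refine Runs.seq (Runs.loop p 2
      (fun s R H' => AgreeTo 18 (params k n p a b) R ∧ R 30 = p - s ∧ R 31 = (2 ^ s : ℕ) ∧ H' = H)
      ⟨h.scratch.scratch.scratch, by simp, by simp, rfl⟩ ?_ ?_) ?_
    · rintro i hi R H' - ⟨hA, h30, h31, rfl⟩
      have h4 : R 4 = 1 := hA 4 (by decide)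
      have hp2 : 2 ^ (i + 1) ≤ 2 ^ p := Nat.pow_le_pow_right (by norm_num) hi
      refine ⟨by rw [h30]; zify at hi; omega, ?_⟩
      refine Runs.add ((2 ^ (i + 1) : ℕ) : ℤ) (by simp [h31]; ring) (abs_cast_lt hG (by omega)) ?_
      refine Runs.sub ((p : ℤ) - (i + 1 : ℕ)) (by simp [h30, h4]; ring)
        (abs_lt_of_le hG (by omega) (by omega)) ?_
      exact Runs.nil ⟨hA.scratch.scratch, by simp, by simp, rfl⟩
    · rintro R H' ⟨hA, h30, -⟩
      rw [h30]; simp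
    · rintro R H' - ⟨hA, h30, h31, rfl⟩
      have h5 : R 5 = n := hA 5 (by decide)
      have h6 : R 6 = k := hA 6 (by decide)
      have h7 : R 7 = 2 := hA 7 (by decide)
      have h11 : R 11 = coarseBits k n := hA 11 (by decide)
      have h12 : R 12 = (2 ^ Nat.size b : ℕ) := hA 12 (by decide)
      have h13 : R 13 = fineBits p b := hA 13 (by decide)
      refine Runs.const (abs_cast_lt (v := 0) hG (by omega)) ?_
      refine Runs.add ((2 ^ p : ℕ) : ℤ) (by simp [h31]) (abs_cast_lt hG (by omega)) ?_
      refine Runs.mul ((2 ^ fineBits p b : ℕ) : ℤ) (by simp [h12, fineBits, pow_add])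
        (abs_cast_lt hG (by omega)) ?_
      refine Runs.mul ((coarseBits k n * 2 ^ fineBits p b : ℕ) : ℤ) (by simp [h11])
        (abs_cast_lt hG (by omega)) ?_
      refine Runs.div ((2 ^ fineBits p b / 2 : ℕ) : ℤ) (by simp [h7]) (abs_cast_lt hG (by omega)) ?_
      refine Runs.add ((coarseBits k n * 2 ^ fineBits p b + 2 ^ fineBits p b / 2 : ℕ) : ℤ)
        (by simp) (abs_cast_lt hG (by omega)) ?_
      refine Runs.add ((2 * coarseBits k n : ℕ) : ℤ) (by simp [h11]; ring)
        (abs_cast_lt hG (by omega)) ?_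
      refine Runs.add ((fineBits p b + 2 * coarseBits k n : ℕ) : ℤ) (by simp [h13])
        (abs_cast_lt hG (by omega)) ?_
      refine Runs.mul ((2 * (fineBits p b + 2 * coarseBits k n) : ℕ) : ℤ) (by simp [h7]; ring)
        (abs_cast_lt hG (by omega)) ?_
      refine Runs.mul ((k * n : ℕ) : ℤ) (by simp [h5, h6]; ring) (abs_cast_lt hG (by omega)) ?_
      refine Runs.mul (coinCount k n p b : ℤ) (by simp [coinCount]; ring) (abs_cast_lt hG hTG) ?_
      refine Runs.add ((2 * n : ℕ) : ℤ) (by simp [h5]; ring) (abs_cast_lt hG (by omega)) ?_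
      refine Runs.add ((n + k : ℕ) : ℤ) (by simp [h5, h6]) (abs_cast_lt hG (by omega)) ?_
      refine Runs.mul ((2 * n * (n + k) : ℕ) : ℤ) (by simp)
        (abs_cast_lt hG (by rw [queryLength] at hBG; omega)) ?_
      refine Runs.const (abs_cast_lt (v := 5) hG (by omega)) ?_
      refine Runs.add (queryLength k n : ℤ) (by simp [queryLength]; ring)
        (abs_cast_lt hG (by omega)) ?_
      refine Runs.const (abs_cast_lt (v := 64) hG (by omega)) ?_
      refine Runs.add ((64 + queryLength k n : ℕ) : ℤ) (by simp) (abs_cast_lt hG (by omega)) ?_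
      refine Runs.mul ((2 * n * k : ℕ) : ℤ) (by simp [h6]) (abs_cast_lt hG (by omega)) ?_
      refine Runs.add ((64 + queryLength k n + 2 * n * k : ℕ) : ℤ) (by simp)
        (abs_cast_lt hG (by omega)) ?_
      refine Runs.add ((2 * k : ℕ) : ℤ) (by simp [h6]; ring) (abs_cast_lt hG (by omega)) ?_
      refine Runs.const (abs_cast_lt (v := 0) hG (by omega)) ?_
      have h20 : AgreeTo 18 (params k n p a b) (Function.update R 30 0) := hA.scratch
      exact Runs.nil (N := 0)
        ⟨((((((((((((h20.step rfl).step rfl).scratch.scratch.step rfl).step rfl).scratch.scratch.scratch.step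
          rfl).step rfl).scratch.scratch.scratch.step rfl).scratch.step rfl).step rfl).step rfl).step
          rfl).step rfl), rfl⟩
  · omega

end

/-! ### Moving the input -/

/-- Move the matrix entries from the cells `4, 5, …` to the cells `-(p + a), -(p + a) - 1, …`. -/
def inputCode : List Cmd :=
  [.add 1 1 0, .sub 0 0 1, .sub 0 0 2, .store 0 4, .const 4 1, .sub 0 0 4, .store 0 5, .sub 0 0 4,
    .store 0 6, .sub 0 0 4, .store 0 7, .sub 0 0 4, .store 0 8, .const 5 4, .add 5 0 5, .add 7 1 5,
    .add 7 7 2, .mul 7 7 7, .add 7 7 7, .const 5 9,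
    .loop 7 (block [.sub 0 0 4, .load 6 5, .store 0 6, .add 5 5 4, .sub 7 7 4]),
    .add 0 0 5, .const 5 5, .sub 0 0 5, .add 5 1 0, .add 5 5 2, .sub 1 1 5]

theorem update_agree_down {D : ℤ} {H : ℤ → ℤ} {e : ℕ → ℤ} {m : ℕ} {c v : ℤ}
    (h : ∀ x < m, H (D - (x : ℕ)) = e x) (hc : c = D - m) (hv : v = e m) :
    ∀ x < m + 1, Function.update H c v (D - (x : ℕ)) = e x := by
  intro x hx
  rcases Nat.lt_succ_iff_lt_or_eq.1 hx with h' | rfl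
  · rw [Function.update_of_ne (by omega)]
    exact h x h'
  · rw [hc, Function.update_self, hv]

/-- At the start cells 0 to 8 belong to the input area and no scratch register is reserved. The
cells of n and p are overwritten by -(p+a) and p+n: the former is a negative address, so a free
place below all data, and with a still at hand both n and p can be recovered. The five cells 4 to 8
are saved one by one, which frees registers for a loop that moves the rest. -/
theorem runs_inputCode {O : Oracle} {Λ κ k n p a b : ℕ} {R : ℕ → ℤ} {H : ℤ → ℤ} (ha : 0 < a)
    (hG : paramBound k n p a b < 2 ^ Λ) (h0 : R 0 = n) (h1 : R 1 = p) (h2 : R 2 = a) (h3 : R 3 = b)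
    (e : ℕ → ℤ) (heR : ∀ x < 5, R (4 + x) = e x) (heH : ∀ x : ℕ, 5 ≤ x → H (4 + x) = e x) :
    Runs O Λ κ 9 inputCode R H (12 * n ^ 2 + 40) fun R' H' =>
      AgreeTo 6 (params k n p a b) R' ∧ ∀ x < 2 * n ^ 2, H' (-((p + a : ℕ) : ℤ) - (x : ℕ)) = e x := by
  have hf := Nat.zero_le (2 ^ fineBits p b)
  have hle : 100 + p + a + b + 4 * n ^ 2 + 4 * n ≤ paramBound k n p a b := by
    rw [paramBound]; omega
  have he0 : R 4 = e 0 := heR 0 (by decide)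
  have he1 : R 5 = e 1 := heR 1 (by decide)
  have he2 : R 6 = e 2 := heR 2 (by decide)
  have he3 : R 7 = e 3 := heR 3 (by decide)
  have he4 : R 8 = e 4 := heR 4 (by decide)
  obtain ⟨D, hD⟩ : ∃ D : ℤ, D = -((p + a : ℕ) : ℤ) := ⟨_, rfl⟩
  have hD' : D = -(p + a) := by rw [hD]; push_cast; ring
  rw [← hD]
  obtain ⟨s, hs⟩ : ∃ s : ℕ, s = n ^ 2 := ⟨_, rfl⟩
  rw [← hs] at hle ⊢
  have hs' : (n : ℤ) * n = s := by rw [hs]; push_cast; ring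
  refine Runs.mono (N := 6 + (2 * s * (5 + 1) + 1) + 20) ?_ ?_ fun _ _ _ hQ => hQ
  · unfold inputCode
    refine Runs.add ((p + n : ℕ) : ℤ) (by simp [h1, h0]) (abs_cast_lt hG (by omega)) ?_
    refine Runs.sub (-(p : ℤ)) (by simp [h0]) (abs_lt_of_le hG (by omega) (by omega)) ?_
    refine Runs.sub D (by simp [h2, hD']; ring) (abs_lt_of_le hG (by omega) (by omega)) ?_
    refine Runs.store D (e 0) (by simp) (by omega) (by simp [he0]) ?_
    refine Runs.const (abs_cast_lt (v := 1) hG (by omega)) ?_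
    refine Runs.sub (D - 1) (by simp) (abs_lt_of_le hG (by omega) (by omega)) ?_
    refine Runs.store (D - 1) (e 1) (by simp) (by omega) (by simp [he1]) ?_
    refine Runs.sub (D - 2) (by simp; ring) (abs_lt_of_le hG (by omega) (by omega)) ?_
    refine Runs.store (D - 2) (e 2) (by simp) (by omega) (by simp [he2]) ?_
    refine Runs.sub (D - 3) (by simp; ring) (abs_lt_of_le hG (by omega) (by omega)) ?_
    refine Runs.store (D - 3) (e 3) (by simp) (by omega) (by simp [he3]) ?_
    refine Runs.sub (D - 4) (by simp; ring) (abs_lt_of_le hG (by omega) (by omega)) ?_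
    refine Runs.store (D - 4) (e 4) (by simp) (by omega) (by simp [he4]) ?_
    refine Runs.const (abs_cast_lt (v := 4) hG (by omega)) ?_
    refine Runs.add D (by simp) (abs_lt_of_le hG (by omega) (by omega)) ?_
    refine Runs.add ((n : ℤ) - a) (by simp [hD']; ring) (abs_lt_of_le hG (by omega) (by omega)) ?_
    refine Runs.add (n : ℤ) (by simp [h2]) (abs_cast_lt hG (by omega)) ?_
    refine Runs.mul (s : ℤ) (by simp [hs']) (abs_cast_lt hG (by omega)) ?_
    refine Runs.add ((2 * s : ℕ) : ℤ) (by simp; ring) (abs_cast_lt hG (by omega)) ?_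
    refine Runs.const (abs_cast_lt (v := 9) hG (by omega)) ?_
    -- The loop moves 2n² cells beyond the five already saved, which is more than necessary and
    -- harmless, since e is defined at all positions.
    refine Runs.seq (Runs.loop (2 * s) 5
      (fun i R H => R 0 = D - 4 - i ∧ R 1 = (p + n : ℕ) ∧ R 2 = a ∧ R 3 = b ∧ R 4 = 1 ∧
        R 5 = 9 + i ∧ R 7 = (2 * s : ℕ) - i ∧ (∀ x < 5 + i, H (D - (x : ℕ)) = e x) ∧
        ∀ x : ℕ, 5 ≤ x → H (4 + x) = e x)
      ⟨by simp, by simp, by simp [h2], by simp [h3], by simp, by simp, by simp, ?_, ?_⟩ ?_ ?_) ?_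
    · exact update_agree_down (update_agree_down (update_agree_down (update_agree_down
        (update_agree_down (fun x hx => absurd hx (Nat.not_lt_zero x)) (by simp) rfl) (by simp) rfl)
        (by simp) rfl) (by simp) rfl) (by simp) rfl
    · intro x hx
      iterate 5 rw [Function.update_of_ne (by omega)]
      exact heH x hx
    · rintro i hi R H - ⟨h0, h1, h2, h3, h4, h5, h7, hd, hu⟩
      refine ⟨by rw [h7]; omega, ?_⟩
      refine Runs.sub (D - 4 - (i + 1 : ℕ)) (by simp [h0, h4]; ring)
        (abs_lt_of_le hG (by omega) (by omega)) ?_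
      refine Runs.load (4 + (5 + i : ℕ)) (e (5 + i)) (by simp [h5]; ring) (by omega)
        (hu _ (by omega)) ?_
      refine Runs.store (D - 4 - (i + 1 : ℕ)) (e (5 + i)) (by simp) (by omega) (by simp) ?_
      refine Runs.add (9 + (i + 1 : ℕ)) (by simp [h4, h5]; ring)
        (abs_lt_of_le hG (by omega) (by omega)) ?_
      refine Runs.sub ((2 * s : ℕ) - (i + 1 : ℕ)) (by simp [h4, h7]; ring)
        (abs_lt_of_le hG (by omega) (by omega)) ?_
      refine Runs.nil ⟨by simp, by simp [h1], by simp [h2], by simp [h3], by simp [h4], by simp,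
        by simp, ?_, ?_⟩
      · exact update_agree_down hd
          (show _ = D - ((5 + i : ℕ) : ℤ) by push_cast; ring) rfl
      · intro x hx
        rw [Function.update_of_ne (by omega)]
        exact hu x hx
    · rintro R H ⟨-, -, -, -, -, -, h7, -⟩
      rw [h7]; simp
    · rintro R H - ⟨h0, h1, h2, h3, h4, h5, h7, hd, -⟩
      refine Runs.add (D + 5) (by simp [h0, h5]; ring) (abs_lt_of_le hG (by omega) (by omega)) ?_
      refine Runs.const (abs_cast_lt (v := 5) hG (by omega)) ?_
      refine Runs.sub D (by simp) (abs_lt_of_le hG (by omega) (by omega)) ?_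
      -- As D = -(p+a), adding D and then a to p + n restores n, and subtracting n from p + n
      -- restores p.
      refine Runs.add ((n : ℤ) - a) (by simp [h1, hD']; ring)
        (abs_lt_of_le hG (by omega) (by omega)) ?_
      refine Runs.add (n : ℤ) (by simp [h2]) (abs_cast_lt hG (by omega)) ?_
      refine Runs.sub (p : ℤ) (by simp [h1]) (abs_cast_lt hG (by omega)) ?_
      refine Runs.nil (N := 0) ⟨?_, fun x hx => hd x (by omega)⟩
      intro i hi
      interval_cases i
      · simp [params, hD']
      · simp [params]
      · simp [params, h2]
      · simp [params, h3]
      · simp [params, h4]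
      · simp [params]
  · omega

/-- Any memory contents can be viewed as registers and heap. -/
theorem layout_self (ρ : ℕ) (m : ℤ → ℤ) : layout ρ (fun i => m i) m = m := by
  funext z
  rw [layout]
  split_ifs with h
  · rw [Int.toNat_of_nonneg h.1]
  · rfl

/-- Lets the boundary between registers and heap move from 9 to 64 once the input is out of the way.
-/
theorem Bounded.layout {Λ : ℕ} {R : ℕ → ℤ} {H : ℤ → ℤ} (h : Bounded Λ R H) (ρ : ℕ) :
    Bounded Λ (fun i => layout ρ R H i) (layout ρ R H) := by
  have : ∀ z, |LossyBS.layout ρ R H z| < 2 ^ Λ := by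
    intro z
    rw [LossyBS.layout]
    split_ifs
    exacts [h.1 _, h.2 _]
  exact ⟨fun i => this i, this⟩

/-! ### Decoding the coin flips -/

/-- Compute one sample from the bits that register 31 points at. -/
def sampleBody : List Cmd :=
  [.const 34 0, .const 35 1, .add 32 13 29,
    .loop 32 (block [.load 36 31, .mul 36 35 36, .add 34 34 36, .add 35 35 35, .add 31 31 4,
      .sub 32 32 4]),
    .add 32 21 29,
    .loop 32 (block [.load 36 31, .mul 36 35 36, .add 34 34 36, .add 31 31 4, .sub 32 32 4]),
    .sub 34 34 20, .store 33 34, .add 33 33 4, .sub 30 30 4]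

/-- Replace the coin flips by the samples. -/
def sampleCode : List Cmd :=
  [.add 31 27 29, .add 33 25 29, .add 30 26 29, .loop 30 (block sampleBody)]

/-- The two loops maintain the partial sums of fine and coarse bits. The partial sums stay below 2^q
and 2^q (2N + 1) respectively, so all values fit below G even before the centring constant is
subtracted. -/
theorem runs_sampleBody {O : Oracle} {Λ κ G q N x c : ℕ} {P R : ℕ → ℤ} {H : ℤ → ℤ} {g : ℕ → ℤ}
    {u v : ℤ} (hG : G < 2 ^ Λ) (hA : Agree P R) (h4 : P 4 = 1) (h13 : P 13 = q)
    (h20 : P 20 = (N * 2 ^ q + 2 ^ q / 2 : ℕ)) (h21 : P 21 = (2 * N : ℕ)) (h29 : P 29 = 0)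
    (h0 : ∀ i, 0 ≤ g i) (h1 : ∀ i, g i ≤ 1) (h30 : R 30 = c) (h31 : R 31 = u) (h33 : R 33 = v)
    (hu : 64 ≤ u) (hv : 64 ≤ v) (hH : ∀ y < q + 2 * N, H (u + (y : ℕ)) = g (x * (q + 2 * N) + y))
    (hGq : 2 * (N + 1) * 2 ^ q ≤ G) (hGu : u + q + 2 * N ≤ G) (hGv : v + 1 ≤ G) (hGc : c ≤ G)
    (hc : 0 < c) :
    Runs O Λ κ 64 sampleBody R H (10 * (q + 2 * N) + 10) fun R' H' =>
      Agree P R' ∧ R' 30 = (c : ℤ) - 1 ∧ R' 31 = u + q + 2 * N ∧ R' 33 = v + 1 ∧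
      H' = Function.update H v (sample q N g x) := by
  have hqq : q < 2 ^ q := Nat.lt_two_pow_self
  have hq1 : 2 ^ q ≤ 2 * (N + 1) * 2 ^ q := Nat.le_mul_of_pos_left _ (by omega)
  have hbit : ∀ j i, (0 : ℤ) ≤ 2 ^ j * g i ∧ (2 : ℤ) ^ j * g i ≤ 2 ^ j := fun j i =>
    ⟨mul_nonneg (by positivity) (h0 i), mul_le_of_le_one_right (by positivity) (h1 i)⟩
  have hGq' : (2 * (N + 1) * 2 ^ q : ℤ) ≤ G := by exact_mod_cast hGq
  have hq1' : (2 ^ q : ℤ) ≤ 2 * (N + 1) * 2 ^ q := by exact_mod_cast hq1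
  have hpow : ∀ j ≤ q, (2 : ℤ) ^ j ≤ 2 ^ q := fun j hj => pow_le_pow_right₀ (by norm_num) hj
  have hfine0 : ∀ j, (0 : ℤ) ≤ ∑ y ∈ Finset.range j, 2 ^ y * g (x * (q + 2 * N) + y) := fun j =>
    Finset.sum_nonneg fun y _ => (hbit y _).1
  have hfine : ∀ j, ∑ y ∈ Finset.range j, 2 ^ y * g (x * (q + 2 * N) + y) ≤ (2 : ℤ) ^ j - 1 :=
    fun j => by
      rw [← sum_two_pow_range]
      exact Finset.sum_le_sum fun y _ => (hbit y _).2
  have hc0 : ∀ j, (0 : ℤ) ≤ ∑ y ∈ Finset.range j, g (x * (q + 2 * N) + q + y) := fun j =>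
    Finset.sum_nonneg fun y _ => h0 _
  have hc1 : ∀ j, ∑ y ∈ Finset.range j, g (x * (q + 2 * N) + q + y) ≤ (j : ℤ) := fun j => by
    refine (Finset.sum_le_card_nsmul _ _ 1 fun y _ => h1 _).trans_eq ?_
    simp
  refine Runs.mono (N := 4 + (2 * N * (5 + 1) + 1) + 1 + (q * (6 + 1) + 1) + 3) ?_ ?_
    fun _ _ _ hQ => hQ
  · have a13 := (hA 13 (by decide)).trans h13
    have a29 := (hA 29 (by decide)).trans h29
    unfold sampleBody
    refine Runs.const (abs_cast_lt (v := 0) hG (by omega)) ?_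
    refine Runs.const (abs_cast_lt (v := 1) hG (by omega)) ?_
    refine Runs.add (q : ℤ) (by simp [a13, a29]) (abs_cast_lt hG (by omega)) ?_
    refine Runs.seq (Runs.loop q 6
      (fun j R H' => Agree P R ∧ R 30 = c ∧ R 31 = u + j ∧ R 32 = q - j ∧ R 33 = v ∧
        R 34 = ∑ y ∈ Finset.range j, 2 ^ y * g (x * (q + 2 * N) + y) ∧ R 35 = 2 ^ j ∧ H' = H)
      ⟨hA.update.update.update, by simp [h30], by simp [h31], by simp, by simp [h33], by simp,
        by simp, rfl⟩ ?_ ?_) ?_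
    · rintro j hj R H' - ⟨hA, h30, h31, h32, h33, h34, h35, rfl⟩
      have a4 := (hA 4 (by decide)).trans h4
      have e1 := hbit j (x * (q + 2 * N) + j)
      have e2 := hpow j hj.le
      have e3 := hpow (j + 1) hj
      have e4 := hfine (j + 1)
      have e5 := hfine0 (j + 1)
      have e6 : (0 : ℤ) < 2 ^ (j + 1) := by positivity
      refine ⟨by rw [h32]; omega, ?_⟩
      refine Runs.load (u + (j : ℕ)) (g (x * (q + 2 * N) + j)) h31 (by push_cast; omega)
        (hH j (by omega)) ?_
      refine Runs.mul (2 ^ j * g (x * (q + 2 * N) + j)) (by simp [h35])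
        (abs_lt_of_le hG (by omega) (by omega)) ?_
      refine Runs.add (∑ y ∈ Finset.range (j + 1), 2 ^ y * g (x * (q + 2 * N) + y))
        (by simp [h34, Finset.sum_range_succ]) (abs_lt_of_le hG (by omega) (by omega)) ?_
      refine Runs.add (2 ^ (j + 1)) (by simp [h35]; ring)
        (abs_lt_of_le hG (by omega) (by omega)) ?_
      refine Runs.add (u + (j + 1 : ℕ)) (by simp [h31, a4]; ring)
        (abs_lt_of_le hG (by push_cast; omega) (by push_cast; omega)) ?_
      refine Runs.sub (q - (j + 1 : ℕ)) (by simp [h32, a4]; ring)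
        (abs_lt_of_le hG (by push_cast; omega) (by push_cast; omega)) ?_
      exact Runs.nil ⟨hA.update.update.update.update.update.update, by simp [h30], by simp,
        by simp, by simp [h33], by simp, by simp, rfl⟩
    · rintro R H' ⟨-, -, -, h32, -⟩
      rw [h32]; simp
    · rintro R H' - ⟨hA, h30, h31, h32, h33, h34, h35, rfl⟩
      have a21 := (hA 21 (by decide)).trans h21
      have a29 := (hA 29 (by decide)).trans h29
      have hN : 2 * N ≤ 2 * (N + 1) * 2 ^ q := by
        have := Nat.one_le_two_pow (n := q)
        nlinarith
      refine Runs.add ((2 * N : ℕ) : ℤ) (by simp [a21, a29]) (abs_cast_lt hG (by omega)) ?_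
      refine Runs.seq (Runs.loop (2 * N) 5
        (fun j R H'' => Agree P R ∧ R 30 = c ∧ R 31 = u + q + j ∧ R 32 = (2 * N : ℕ) - j ∧ R 33 = v ∧
          R 34 = ∑ y ∈ Finset.range q, 2 ^ y * g (x * (q + 2 * N) + y)
            + 2 ^ q * ∑ y ∈ Finset.range j, g (x * (q + 2 * N) + q + y) ∧
          R 35 = 2 ^ q ∧ H'' = H')
        ⟨hA.update, by simp [h30], by simp [h31], by simp, by simp [h33], by simp [h34],
          by simp [h35], rfl⟩ ?_ ?_) ?_
      · rintro j hj R H' - ⟨hA, h30, h31, h32, h33, h34, h35, rfl⟩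
        have a4 := (hA 4 (by decide)).trans h4
        have e1 := hbit q (x * (q + 2 * N) + q + j)
        have e4 := hfine q
        have e5 := hfine0 q
        have e6 : (0 : ℤ) ≤ 2 ^ q * ∑ y ∈ Finset.range (j + 1), g (x * (q + 2 * N) + q + y) :=
          mul_nonneg (by positivity) (hc0 _)
        have e7 : 2 ^ q * ∑ y ∈ Finset.range (j + 1), g (x * (q + 2 * N) + q + y)
            ≤ (2 : ℤ) ^ q * (2 * N) :=
          mul_le_mul_of_nonneg_left ((hc1 _).trans (by exact_mod_cast hj)) (by positivity)
        have e8 : (2 * (N + 1) * 2 ^ q : ℤ) = 2 ^ q * (2 * N) + 2 * 2 ^ q := by ring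
        have e9 : (0 : ℤ) < 2 ^ q := by positivity
        refine ⟨by rw [h32]; omega, ?_⟩
        refine Runs.load (u + ((q + j : ℕ) : ℤ)) (g (x * (q + 2 * N) + q + j))
          (by rw [h31]; push_cast; ring) (by push_cast; omega)
          (by rw [hH _ (by omega), add_assoc]) ?_
        refine Runs.mul (2 ^ q * g (x * (q + 2 * N) + q + j)) (by simp [h35])
          (abs_lt_of_le hG (by omega) (by omega)) ?_
        refine Runs.add (∑ y ∈ Finset.range q, 2 ^ y * g (x * (q + 2 * N) + y)
            + 2 ^ q * ∑ y ∈ Finset.range (j + 1), g (x * (q + 2 * N) + q + y))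
          (by simp [h34, Finset.sum_range_succ]; ring) (abs_lt_of_le hG (by omega) (by omega)) ?_
        refine Runs.add (u + q + (j + 1 : ℕ)) (by simp [h31, a4]; ring)
          (abs_lt_of_le hG (by push_cast; omega) (by push_cast; omega)) ?_
        refine Runs.sub ((2 * N : ℕ) - (j + 1 : ℕ)) (by simp [h32, a4]; ring)
          (abs_lt_of_le hG (by push_cast; omega) (by push_cast; omega)) ?_
        exact Runs.nil ⟨hA.update.update.update.update.update, by simp [h30], by simp,
          by simp, by simp [h33], by simp, by simp [h35], rfl⟩
      · rintro R H' ⟨-, -, -, h32, -⟩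
        rw [h32]; simp
      · rintro R H' - ⟨hA, h30, h31, h32, h33, h34, h35, rfl⟩
        have a4 := (hA 4 (by decide)).trans h4
        have a20 := (hA 20 (by decide)).trans h20
        have hs := sample_bounds q N g h0 h1 x
        have e8 : (2 * (N + 1) * 2 ^ q : ℤ) = 2 * (2 ^ q * (N + 1)) := by ring
        have e9 : (0 : ℤ) < 2 ^ q * (N + 1) := by positivity
        refine Runs.sub (sample q N g x) (by simp [h34, a20, sample])
          (abs_lt_of_le hG (by omega) (by omega)) ?_
        refine Runs.store v (sample q N g x) (by simp [h33]) (by push_cast; omega) (by simp) ?_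
        refine Runs.add (v + 1) (by simp [h33, a4]) (abs_lt_of_le hG (by omega) (by omega)) ?_
        refine Runs.sub ((c : ℤ) - 1) (by simp [h30, a4])
          (abs_lt_of_le hG (by omega) (by omega)) ?_
        exact Runs.nil (N := 0) ⟨hA.update.update.update, by simp, by simp [h31], by simp, rfl⟩
  · omega

/-- Samples are written to an area of 2nk cells directly below the coins, so no unread bit is
overwritten. -/
theorem runs_sampleCode {O : Oracle} {Λ κ k n p a b : ℕ} {R : ℕ → ℤ} {H : ℤ → ℤ} {g : ℕ → ℤ}
    (hG : paramBound k n p a b < 2 ^ Λ) (hA : Agree (params k n p a b) R)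
    (h0 : ∀ i, 0 ≤ g i) (h1 : ∀ i, g i ≤ 1)
    (hH : ∀ y < coinCount k n p b, H ((64 + queryLength k n + 2 * n * k : ℕ) + (y : ℕ)) = g y) :
    Runs O Λ κ 64 sampleCode R H
      (2 * n * k * (10 * (fineBits p b + 2 * coarseBits k n) + 11) + 4) fun R' H' =>
        Agree (params k n p a b) R' ∧
        (∀ x < 2 * n * k, H' ((64 + queryLength k n : ℕ) + (x : ℕ))
          = sample (fineBits p b) (coarseBits k n) g x) ∧
        ∀ z < ((64 + queryLength k n : ℕ) : ℤ), H' z = H z := by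
  have a25 : R 25 = (64 + queryLength k n : ℕ) := hA 25 (by decide)
  have a26 : R 26 = (2 * n * k : ℕ) := hA 26 (by decide)
  have a27 : R 27 = (64 + queryLength k n + 2 * n * k : ℕ) := hA 27 (by decide)
  have a29 : R 29 = 0 := hA 29 (by decide)
  have hf := Nat.zero_le (2 ^ fineBits p b)
  have hT : coinCount k n p b = 2 * n * k * (fineBits p b + 2 * coarseBits k n) := by
    rw [coinCount]; ring
  have hGT : 100 + coinCount k n p b + queryLength k n + 2 * n * k ≤ paramBound k n p a b := by
    rw [paramBound]; omega
  have hGq : 2 * (coarseBits k n + 1) * 2 ^ fineBits p b ≤ paramBound k n p a b := by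
    rw [paramBound]; omega
  obtain ⟨w, hw⟩ : ∃ w, w = fineBits p b + 2 * coarseBits k n := ⟨_, rfl⟩
  obtain ⟨V, hV⟩ : ∃ V, V = 64 + queryLength k n := ⟨_, rfl⟩
  obtain ⟨c, hc⟩ : ∃ c, c = 2 * n * k := ⟨_, rfl⟩
  rw [← hV, ← hc] at a27
  rw [← hV] at a25
  rw [← hc] at a26
  rw [← hV, ← hc] at hH
  rw [← hw, ← hc] at hT
  rw [← hc] at hGT
  rw [← hV, ← hc, ← hw]
  have hstep : ∀ i < c, i * w + w ≤ c * w := fun i hi => by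
    calc i * w + w = (i + 1) * w := by ring
      _ ≤ c * w := Nat.mul_le_mul_right _ hi
  refine Runs.mono (N := 0 + (c * (10 * w + 10 + 1) + 1) + 3) ?_
    (by rw [show 10 * w + 10 + 1 = 10 * w + 11 by ring]; omega) fun _ _ _ hQ => hQ
  unfold sampleCode
  refine Runs.add ((V + c : ℕ) : ℤ) (by simp [a27, a29]) (abs_cast_lt hG (by omega)) ?_
  refine Runs.add (V : ℤ) (by simp [a25, a29]) (abs_cast_lt hG (by omega)) ?_
  refine Runs.add (c : ℤ) (by simp [a26, a29]) (abs_cast_lt hG (by omega)) ?_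
  refine Runs.seq (Runs.loop c (10 * w + 10)
    (fun x R' H' => Agree (params k n p a b) R' ∧ R' 30 = c - x ∧ R' 31 = (V + c + x * w : ℕ) ∧
      R' 33 = (V + x : ℕ) ∧
      (∀ i < x, H' ((V : ℕ) + (i : ℕ)) = sample (fineBits p b) (coarseBits k n) g i) ∧
      ∀ z : ℤ, (z < (V : ℕ) ∨ ((V + c : ℕ) : ℤ) ≤ z) → H' z = H z)
    ⟨hA.update.update.update, by simp, by simp, by simp, by simp, fun _ _ => rfl⟩ ?_ ?_
      (by simp [sampleBody])) ?_
  · rintro x hx R' H' - ⟨hA, h30, h31, h33, hs, hz⟩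
    refine ⟨by rw [h30]; omega, ?_⟩
    have hxw := hstep x hx
    refine Runs.mono (runs_sampleBody (c := c - x) (x := x) (g := g) hG hA rfl rfl rfl rfl rfl h0 h1
      (by rw [h30]; omega) h31 h33 (by push_cast; omega) (by push_cast; omega) ?_ hGq
      (by push_cast; omega) (by push_cast; omega) (by omega) (by omega)) (by rw [hw]) ?_
    · intro y hy
      rw [← hw] at hy ⊢
      rw [hz _ (by push_cast; omega), ← hH _ (by omega)]
      congr 1; push_cast; ring
    · rintro R'' H'' - ⟨hA, h30, h31, h33, rfl⟩
      refine ⟨hA, by rw [h30]; push_cast; omega, ?_, by rw [h33]; push_cast; ring, ?_, ?_⟩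
      · rw [h31]
        have : (w : ℤ) = fineBits p b + 2 * coarseBits k n := by rw [hw]; push_cast; ring
        push_cast
        rw [this]; ring
      · intro i hi
        rcases Nat.lt_succ_iff_lt_or_eq.1 hi with h' | rfl
        · rw [Function.update_of_ne (by push_cast; omega)]
          exact hs i h'
        · push_cast
          rw [Function.update_self]
      · intro z hz'
        rw [Function.update_of_ne (by push_cast at hz' ⊢; omega)]
        exact hz z hz'
  · rintro R' H' ⟨-, h30, -⟩
    rw [h30]; simp
  · rintro R' H' - ⟨hA, -, -, -, hs, hz⟩
    exact Runs.nil ⟨hA, hs, fun z h => hz z (Or.inl h)⟩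

/-! ### Asking the oracle -/

/-- The sequence of entries of a matrix, continued by zeros. -/
def entryFn {n m : ℕ} (Z : Fin n → Fin m → ℤ × ℤ) (x : ℕ) : ℤ := (entries Z).getD x 0

theorem entries_eq_map_of_apply {n m : ℕ} (Z : Fin n → Fin m → ℤ × ℤ) (f : ℕ → ℤ)
    (h : ∀ (i : Fin n) (c : Fin m), f (i * (m * 2) + (c * 2 + 0)) = (Z i c).1 ∧
      f (i * (m * 2) + (c * 2 + 1)) = (Z i c).2) :
    entries Z = (List.range (n * (m * 2))).map f := by
  rw [← List.map_coe_finRange_eq_range, List.map_map, ← List.ofFn_eq_map, List.ofFn_mul, entries]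
  congr 2
  funext i
  rw [List.ofFn_mul]
  congr 2
  funext c
  simp only [Function.comp, List.ofFn_succ, List.ofFn_zero]
  rw [← (h i c).1, ← (h i c).2]
  simp

theorem exists_entries_eq_map {n m : ℕ} (Z : Fin n → Fin m → ℤ × ℤ) :
    ∃ f : ℕ → ℤ, ∀ (i : Fin n) (c : Fin m), f (i * (m * 2) + (c * 2 + 0)) = (Z i c).1 ∧
      f (i * (m * 2) + (c * 2 + 1)) = (Z i c).2 := by
  refine ⟨fun x => if h : x / (m * 2) < n ∧ x % (m * 2) / 2 < m then
    if x % 2 = 0 then (Z ⟨_, h.1⟩ ⟨_, h.2⟩).1 else (Z ⟨_, h.1⟩ ⟨_, h.2⟩).2 else 0, fun i c => ?_⟩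
  have hc := c.2
  have key : ∀ s < 2, ((i : ℕ) * (m * 2) + (c * 2 + s)) / (m * 2) = i ∧
      ((i : ℕ) * (m * 2) + (c * 2 + s)) % (m * 2) / 2 = c ∧
      ((i : ℕ) * (m * 2) + (c * 2 + s)) % 2 = s := by
    intro s hs
    have hlt : c * 2 + s < m * 2 := by omega
    refine ⟨?_, ?_, ?_⟩
    · rw [mul_comm, Nat.mul_add_div (by omega), Nat.div_eq_of_lt hlt, add_zero]
    · rw [mul_comm, Nat.mul_add_mod, Nat.mod_eq_of_lt hlt]
      omega
    · rw [← mul_assoc]; omega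
  obtain ⟨h1, h2, h3⟩ := key 0 (by norm_num)
  obtain ⟨h4, h5, h6⟩ := key 1 (by norm_num)
  constructor
  · simp only [h1, h2, h3, i.2, c.2]
    simp
  · simp only [h4, h5, h6, i.2, c.2]
    simp

/-- Replaces the nested list by a function of the position i · 2m + 2c + s, the form in which loops
read and write it. -/
theorem entries_eq_map {n m : ℕ} (Z : Fin n → Fin m → ℤ × ℤ) :
    entries Z = (List.range (n * (m * 2))).map (entryFn Z) := by
  obtain ⟨f, hf⟩ := exists_entries_eq_map Z
  have h := entries_eq_map_of_apply Z f hf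
  rw [h]
  refine List.map_congr_left fun x hx => ?_
  rw [entryFn, h]
  simp [List.getD, List.mem_range.1 hx]

theorem entryFn_apply {n m : ℕ} (Z : Fin n → Fin m → ℤ × ℤ) (i : Fin n) (c : Fin m) :
    entryFn Z (i * (m * 2) + c * 2) = (Z i c).1 ∧
      entryFn Z (i * (m * 2) + c * 2 + 1) = (Z i c).2 := by
  obtain ⟨f, hf⟩ := exists_entries_eq_map Z
  have h := entries_eq_map_of_apply Z f hf
  have key : ∀ s < 2, (i : ℕ) * (m * 2) + (c * 2 + s) < n * (m * 2) := by
    intro s hs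
    have h1 : c * 2 + s < m * 2 := by have := c.2; omega
    have h2 : ((i : ℕ) + 1) * (m * 2) ≤ n * (m * 2) := Nat.mul_le_mul_right _ i.2
    rw [Nat.succ_mul] at h2
    omega
  have k0 := key 0 (by norm_num)
  have k1 := key 1 (by norm_num)
  constructor
  · rw [← (hf i c).1, entryFn, h]
    simp only [add_zero] at k0
    simp [List.getD, k0]
  · rw [← (hf i c).2, entryFn, h, add_assoc]
    simp [List.getD, k1]

/-- Registers that differ from `R₀` only between `30` and `39`. -/
def Frame (R₀ R : ℕ → ℤ) : Prop := ∀ i, i < 30 ∨ 40 ≤ i → R i = R₀ i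

theorem Frame.update {R₀ R : ℕ → ℤ} (h : Frame R₀ R) {d : ℕ} {v : ℤ}
    (hd : 30 ≤ d ∧ d < 40 := by decide) : Frame R₀ (Function.update R d v) := by
  intro i hi
  rw [Function.update_of_ne (by omega)]
  exact h i hi

/-- Write one row of the query. -/
def rowBody : List Cmd :=
  [.add 36 23 29,
    .loop 36 (block [.load 37 33, .store 31 37, .sub 33 33 4, .add 31 31 4, .sub 36 36 4]),
    .add 36 28 29,
    .loop 36 (block [.load 37 34, .div 37 37 44, .store 31 37, .add 34 34 4, .add 31 31 4,
      .sub 36 36 4]),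
    .sub 35 35 4]

/-- Write the query and ask the oracle. -/
def queryCode : List Cmd :=
  [.const 31 64, .store 31 5, .add 31 31 4, .store 31 6, .add 31 31 4, .store 31 1, .add 31 31 4,
    .store 31 15, .add 31 31 4, .store 31 16, .add 31 31 4, .add 33 0 29, .add 34 25 29,
    .add 35 5 29, .loop 35 (block rowBody), .const 31 64, .ask 37 31 24 17]

theorem update_agree_up {D : ℤ} {H : ℤ → ℤ} {e : ℕ → ℤ} {m : ℕ} {c v : ℤ}
    (h : ∀ x < m, H (D + (x : ℕ)) = e x) (hc : c = D + m) (hv : v = e m) :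
    ∀ x < m + 1, Function.update H c v (D + (x : ℕ)) = e x := by
  intro x hx
  rcases Nat.lt_succ_iff_lt_or_eq.1 hx with h' | rfl
  · rw [Function.update_of_ne (by omega)]
    exact h x h'
  · rw [hc, Function.update_self, hv]

/-- The entries of X are read downwards from negative addresses, the samples upwards. The samples
are divided on the fly by register 44, so one stored sample serves all nodes. -/
theorem runs_rowBody {O : Oracle} {Λ κ G r m₁ m₂ c : ℕ} {R₀ R : ℕ → ℤ} {H₀ H : ℤ → ℤ}
    {qf : ℕ → ℤ} {u v V : ℤ} (hG : G < 2 ^ Λ) (hF : Frame R₀ R) (h4 : R₀ 4 = 1) (h23 : R₀ 23 = m₁)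
    (h28 : R₀ 28 = m₂) (h29 : R₀ 29 = 0)
    (h31 : R 31 = 69 + r) (h33 : R 33 = u) (h34 : R 34 = v) (h35 : R 35 = c)
    (hq₁ : ∀ t < m₁, H₀ (u - (t : ℕ)) = qf (r + t))
    (hq₂ : ∀ t < m₂, H₀ (v + (t : ℕ)) / R₀ 44 = qf (r + m₁ + t))
    (hH : ∀ x < r, H (69 + (x : ℕ)) = qf x) (hH₀ : ∀ z : ℤ, z < 69 ∨ V ≤ z → H z = H₀ z)
    (hu : u < 0) (hv : V ≤ v) (hV : 69 + r + m₁ + m₂ ≤ V) (hc : 0 < c)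
    (hGu : -(G : ℤ) ≤ u - m₁) (hGv : v + m₂ ≤ G) (hGc : c ≤ G) :
    Runs O Λ κ 64 rowBody R H (6 * m₁ + 7 * m₂ + 5) fun R' H' =>
      Frame R₀ R' ∧ R' 31 = 69 + (r + m₁ + m₂ : ℕ) ∧ R' 33 = u - m₁ ∧ R' 34 = v + m₂ ∧
      R' 35 = (c : ℤ) - 1 ∧ (∀ x < r + m₁ + m₂, H' (69 + (x : ℕ)) = qf x) ∧
      ∀ z : ℤ, z < 69 ∨ V ≤ z → H' z = H₀ z := by
  refine Runs.mono (N := 1 + (m₂ * (6 + 1) + 1) + 1 + (m₁ * (5 + 1) + 1) + 1) ?_ (by omega)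
    fun _ _ _ hQ => hQ
  have a23 := (hF 23 (by decide)).trans h23
  have a29 := (hF 29 (by decide)).trans h29
  unfold rowBody
  refine Runs.add (m₁ : ℤ) (by simp [a23, a29]) (abs_lt_of_le hG (by omega) (by omega)) ?_
  refine Runs.seq (Runs.loop m₁ 5
    (fun t R H => Frame R₀ R ∧ R 31 = 69 + (r + t : ℕ) ∧ R 33 = u - t ∧ R 34 = v ∧ R 35 = c ∧
      R 36 = m₁ - t ∧ (∀ x < r + t, H (69 + (x : ℕ)) = qf x) ∧
      ∀ z : ℤ, z < 69 ∨ V ≤ z → H z = H₀ z)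
    ⟨hF.update, by simp [h31], by simp [h33], by simp [h34], by simp [h35], by simp, hH, hH₀⟩
    ?_ ?_) ?_
  · rintro t ht R H - ⟨hF, h31, h33, h34, h35, h36, hH, hH₀⟩
    have a4 := (hF 4 (by decide)).trans h4
    refine ⟨by rw [h36]; omega, ?_⟩
    refine Runs.load (u - t) (qf (r + t)) h33 (by omega)
      (by rw [hH₀ _ (by omega), hq₁ t ht]) ?_
    refine Runs.store (69 + (r + t : ℕ)) (qf (r + t)) (by simp [h31]) (by omega) (by simp) ?_
    refine Runs.sub (u - (t + 1 : ℕ)) (by simp [h33, a4]; ring)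
      (abs_lt_of_le hG (by omega) (by omega)) ?_
    refine Runs.add (69 + (r + (t + 1) : ℕ)) (by simp [h31, a4]; ring)
      (abs_lt_of_le hG (by omega) (by omega)) ?_
    refine Runs.sub (m₁ - (t + 1 : ℕ)) (by simp [h36, a4]; ring)
      (abs_lt_of_le hG (by omega) (by omega)) ?_
    refine Runs.nil ⟨hF.update.update.update.update, by simp, by simp, by simp [h34],
      by simp [h35], by simp, update_agree_up hH rfl rfl, fun z hz => ?_⟩
    rw [Function.update_of_ne (by omega)]
    exact hH₀ z hz
  · rintro R H ⟨-, -, -, -, -, h36, -⟩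
    rw [h36]; simp
  · rintro R H - ⟨hF, h31, h33, h34, h35, h36, hH, hH₀⟩
    have a28 := (hF 28 (by decide)).trans h28
    have a29 := (hF 29 (by decide)).trans h29
    refine Runs.add (m₂ : ℤ) (by simp [a28, a29]) (abs_lt_of_le hG (by omega) (by omega)) ?_
    refine Runs.seq (Runs.loop m₂ 6
      (fun t R H => Frame R₀ R ∧ R 31 = 69 + (r + m₁ + t : ℕ) ∧ R 33 = u - m₁ ∧ R 34 = v + t ∧
        R 35 = c ∧ R 36 = m₂ - t ∧ (∀ x < r + m₁ + t, H (69 + (x : ℕ)) = qf x) ∧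
        ∀ z : ℤ, z < 69 ∨ V ≤ z → H z = H₀ z)
      ⟨hF.update, by simp [h31], by simp [h33], by simp [h34], by simp [h35], by simp, hH, hH₀⟩
      ?_ ?_) ?_
    · rintro t ht R H - ⟨hF, h31, h33, h34, h35, h36, hH, hH₀⟩
      have a4 := (hF 4 (by decide)).trans h4
      have a44 := hF 44 (by decide)
      refine ⟨by rw [h36]; omega, ?_⟩
      refine Runs.load (v + t) (H₀ (v + t)) h34 (by omega) (by rw [hH₀ _ (by omega)]) ?_
      -- The size of the quotient is inherited from the dividend, a memory cell already known to be
      -- bounded.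
      refine Runs.of_bounded fun hB => ?_
      have hb := hB.1 37
      rw [Function.update_self] at hb
      refine Runs.div (qf (r + m₁ + t)) (by simp [a44, hq₂ t ht]) ?_ ?_
      · rw [← hq₂ t ht]
        refine lt_of_le_of_lt ?_ hb
        exact Int.abs_ediv_le_abs _ _
      refine Runs.store (69 + (r + m₁ + t : ℕ)) (qf (r + m₁ + t)) (by simp [h31]) (by omega)
        (by simp) ?_
      refine Runs.add (v + (t + 1 : ℕ)) (by simp [h34, a4]; ring)
        (abs_lt_of_le hG (by omega) (by omega)) ?_
      refine Runs.add (69 + (r + m₁ + (t + 1) : ℕ)) (by simp [h31, a4]; ring)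
        (abs_lt_of_le hG (by omega) (by omega)) ?_
      refine Runs.sub (m₂ - (t + 1 : ℕ)) (by simp [h36, a4]; ring)
        (abs_lt_of_le hG (by omega) (by omega)) ?_
      refine Runs.nil ⟨hF.update.update.update.update.update, by simp, by simp [h33], by simp,
        by simp [h35], by simp, update_agree_up hH rfl rfl, fun z hz => ?_⟩
      rw [Function.update_of_ne (by omega)]
      exact hH₀ z hz
    · rintro R H ⟨-, -, -, -, -, h36, -⟩
      rw [h36]; simp
    · rintro R H - ⟨hF, h31, h33, h34, h35, h36, hH, hH₀⟩
      have a4 := (hF 4 (by decide)).trans h4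
      refine Runs.sub ((c : ℤ) - 1) (by simp [h35, a4]) (abs_lt_of_le hG (by omega) (by omega)) ?_
      exact Runs.nil (N := 0) ⟨hF.update, by simp [h31], by simp [h33], by simp [h34], by simp,
        hH, hH₀⟩

theorem abs_saturate_le (l : ℕ) (z : ℤ) : |saturate l z| ≤ 2 ^ l := by
  have : (0 : ℤ) < 2 ^ l := by positivity
  rw [saturate, abs_le]
  constructor
  · exact le_max_left _ _
  · exact max_le (by omega) (min_le_left _ _)

theorem saturate_of_abs_le {l : ℕ} {z : ℤ} (h : |z| ≤ 2 ^ l) : saturate l z = z := by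
  rw [abs_le] at h
  rw [saturate, min_eq_right h.2, max_eq_right h.1]

theorem two_mul_add_cases {m t : ℕ} (ht : t < m * 2) :
    ∃ c : Fin m, t = c * 2 ∨ t = c * 2 + 1 :=
  ⟨⟨t / 2, by omega⟩, by simp only; omega⟩

theorem entryFn_append_left {n m k : ℕ} (Z : Fin n → Fin m → ℤ × ℤ) (Y : Fin n → Fin k → ℤ × ℤ)
    {i t : ℕ} (hi : i < n) (ht : t < m * 2) :
    entryFn (fun i => Fin.append (Z i) (Y i)) (i * ((m + k) * 2) + t)
      = entryFn Z (i * (m * 2) + t) := by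
  obtain ⟨c, rfl | rfl⟩ := two_mul_add_cases ht
  · rw [(entryFn_apply Z ⟨i, hi⟩ c).1]
    have := (entryFn_apply (fun i => Fin.append (Z i) (Y i)) ⟨i, hi⟩ (Fin.castAdd k c)).1
    simpa using this
  · rw [← add_assoc, ← add_assoc, (entryFn_apply Z ⟨i, hi⟩ c).2]
    have := (entryFn_apply (fun i => Fin.append (Z i) (Y i)) ⟨i, hi⟩ (Fin.castAdd k c)).2
    simpa using this

theorem entryFn_append_right {n m k : ℕ} (Z : Fin n → Fin m → ℤ × ℤ) (Y : Fin n → Fin k → ℤ × ℤ)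
    {i t : ℕ} (hi : i < n) (ht : t < k * 2) :
    entryFn (fun i => Fin.append (Z i) (Y i)) (i * ((m + k) * 2) + m * 2 + t)
      = entryFn Y (i * (k * 2) + t) := by
  obtain ⟨c, rfl | rfl⟩ := two_mul_add_cases ht
  · rw [(entryFn_apply Y ⟨i, hi⟩ c).1]
    have := (entryFn_apply (fun i => Fin.append (Z i) (Y i)) ⟨i, hi⟩ (Fin.natAdd m c)).1
    simp only [Fin.val_natAdd, Fin.append_right] at this
    rw [← this]
    congr 1; ring
  · rw [← add_assoc (i * (k * 2)), (entryFn_apply Y ⟨i, hi⟩ c).2]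
    have := (entryFn_apply (fun i => Fin.append (Z i) (Y i)) ⟨i, hi⟩ (Fin.natAdd m c)).2
    simp only [Fin.val_natAdd, Fin.append_right] at this
    rw [← this]
    congr 1; ring

theorem entryFn_scaledSample {k n b j l : ℕ} (W : Fin n → Fin l → ℤ × ℤ) {i t : ℕ} (hi : i < n)
    (ht : t < l * 2) : entryFn (scaledSample k n b j W) (i * (l * 2) + t)
      = entryFn W (i * (l * 2) + t) / (gridRoot k n * (nodeBase k n b + j) : ℕ) := by
  obtain ⟨c, rfl | rfl⟩ := two_mul_add_cases ht
  · rw [(entryFn_apply W ⟨i, hi⟩ c).1, (entryFn_apply _ ⟨i, hi⟩ c).1, scaledSample]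
  · rw [← add_assoc, (entryFn_apply W ⟨i, hi⟩ c).2, (entryFn_apply _ ⟨i, hi⟩ c).2, scaledSample]

theorem entryFn_sampleMatrix {n k q N : ℕ} {g : ℕ → ℤ} {i t : ℕ} (hi : i < n)
    (ht : t < k * 2) :
    entryFn (sampleMatrix n k q N g) (i * (k * 2) + t) = sample q N g (i * (k * 2) + t) := by
  obtain ⟨c, rfl | rfl⟩ := two_mul_add_cases ht
  · rw [(entryFn_apply _ ⟨i, hi⟩ c).1, sampleMatrix]
    simp only []
    congr 1; ring
  · rw [← add_assoc, (entryFn_apply _ ⟨i, hi⟩ c).2, sampleMatrix]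
    simp only []
    congr 1; ring

/-- Row i of the query starts i(2n+2k) cells after the five header cells. Nothing outside the query
area changes in the heap, so the stored input and samples remain available for the next node. -/
theorem runs_queryCode {O : Oracle} {Λ κ k n p a b j : ℕ} {R : ℕ → ℤ} {H : ℤ → ℤ} {g : ℕ → ℤ}
    {Z : Fin n → Fin n → ℤ × ℤ} (ha : 0 < a)
    (hG : paramBound k n p a b < 2 ^ Λ) (hlim : answerBits k n p b < Λ)
    (hκ : 1 + 3 * Λ + queryLength k n + queryLength k n * Λ + answerBits k n p b ≤ κ)
    (hA : Agree (params k n p a b) R)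
    (h44 : R 44 = (gridRoot k n * (nodeBase k n b + j) : ℕ))
    (hZ : ∀ x < 2 * n ^ 2, H (-((p + a : ℕ) : ℤ) - (x : ℕ)) = entryFn Z x)
    (hW : ∀ x < 2 * n * k, H ((64 + queryLength k n : ℕ) + (x : ℕ))
      = sample (fineBits p b) (coarseBits k n) g x) :
    Runs O Λ κ 64 queryCode R H (n * (12 * n + 14 * k + 6) + 17) fun R' H' =>
      Frame R R' ∧ (∀ z : ℤ, z < 64 ∨ ((64 + queryLength k n : ℕ) : ℤ) ≤ z → H' z = H z) ∧
      R' 37 = saturate (answerBits k n p b) (O (nodeQuery k n p a b j Z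
        (sampleMatrix n k (fineBits p b) (coarseBits k n) g))) := by
  have hf := Nat.zero_le (2 ^ fineBits p b)
  have hG1 : 100 + p + a + 4 * n ^ 2 + 4 * n + 2 * k + queryFailure k b + queryError k n a b +
      queryLength k n + 2 * n * k ≤ paramBound k n p a b := by
    rw [paramBound]; omega
  obtain ⟨D, hD⟩ : ∃ D : ℤ, D = -((p + a : ℕ) : ℤ) := ⟨_, rfl⟩
  obtain ⟨qf, hqf⟩ : ∃ qf, qf = entryFn fun i => Fin.append (Z i) (scaledSample k n b j
    (sampleMatrix n k (fineBits p b) (coarseBits k n) g) i) := ⟨_, rfl⟩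
  have a0 : R 0 = D := (hA 0 (by decide)).trans hD.symm
  have a1 : R 1 = p := hA 1 (by decide)
  have a4 : R 4 = 1 := hA 4 (by decide)
  have a5 : R 5 = n := hA 5 (by decide)
  have a6 : R 6 = k := hA 6 (by decide)
  have a15 : R 15 = queryError k n a b := hA 15 (by decide)
  have a16 : R 16 = queryFailure k b := hA 16 (by decide)
  have a23 : R 23 = (2 * n : ℕ) := hA 23 (by decide)
  have a25 : R 25 = (64 + queryLength k n : ℕ) := hA 25 (by decide)
  have a28 : R 28 = (2 * k : ℕ) := hA 28 (by decide)
  have a29 : R 29 = 0 := hA 29 (by decide)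
  rw [← hD] at hZ
  have hlen : queryLength k n = 5 + n * (2 * n + 2 * k) := by rw [queryLength]; ring
  have hq₁ : ∀ i < n, ∀ t < 2 * n, H (D - (i * (2 * n) : ℕ) - (t : ℕ))
      = qf (i * (2 * n + 2 * k) + t) := by
    intro i hi t ht
    have hlt : i * (2 * n) + t < 2 * n ^ 2 := by
      have : (i + 1) * (2 * n) ≤ n * (2 * n) := Nat.mul_le_mul_right _ hi
      rw [Nat.succ_mul] at this
      have h2 : n * (2 * n) = 2 * n ^ 2 := by ring
      omega
    have e1 := entryFn_append_left Z (scaledSample k n b j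
      (sampleMatrix n k (fineBits p b) (coarseBits k n) g)) hi (t := t) (by omega)
    rw [← hqf] at e1
    rw [show 2 * n + 2 * k = (n + k) * 2 by ring, e1, show n * 2 = 2 * n by ring, ← hZ _ hlt]
    congr 1; push_cast; ring
  have hq₂ : ∀ i < n, ∀ t < 2 * k, H ((64 + queryLength k n + i * (2 * k) : ℕ) + (t : ℕ)) / R 44
      = qf (i * (2 * n + 2 * k) + 2 * n + t) := by
    intro i hi t ht
    have hlt : i * (2 * k) + t < 2 * n * k := by
      have : (i + 1) * (2 * k) ≤ n * (2 * k) := Nat.mul_le_mul_right _ hi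
      rw [Nat.succ_mul] at this
      have h2 : n * (2 * k) = 2 * n * k := by ring
      omega
    have e1 := entryFn_append_right Z (scaledSample k n b j
      (sampleMatrix n k (fineBits p b) (coarseBits k n) g)) hi (t := t) (by omega)
    rw [← hqf] at e1
    rw [show i * (2 * n + 2 * k) + 2 * n + t = i * ((n + k) * 2) + n * 2 + t by ring, e1,
      entryFn_scaledSample _ hi (by omega), entryFn_sampleMatrix hi (by omega), h44,
      show k * 2 = 2 * k by ring, ← hW _ hlt]
    congr 2; push_cast; ring
  refine Runs.mono (N := 2 + (n * (6 * (2 * n) + 7 * (2 * k) + 5 + 1) + 1) + 14) ?_ ?_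
    fun _ _ _ hQ => hQ
  · unfold queryCode
    refine Runs.const (abs_cast_lt (v := 64) hG (by omega)) ?_
    refine Runs.store 64 n (by simp) (by right; norm_num) (by simp [a5]) ?_
    refine Runs.add 65 (by simp [a4]) (abs_cast_lt (v := 65) hG (by omega)) ?_
    refine Runs.store 65 k (by simp) (by right; norm_num) (by simp [a6]) ?_
    refine Runs.add 66 (by simp [a4]) (abs_cast_lt (v := 66) hG (by omega)) ?_
    refine Runs.store 66 p (by simp) (by right; norm_num) (by simp [a1]) ?_
    refine Runs.add 67 (by simp [a4]) (abs_cast_lt (v := 67) hG (by omega)) ?_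
    refine Runs.store 67 (queryError k n a b) (by simp) (by right; norm_num) (by simp [a15]) ?_
    refine Runs.add 68 (by simp [a4]) (abs_cast_lt (v := 68) hG (by omega)) ?_
    refine Runs.store 68 (queryFailure k b) (by simp) (by right; norm_num) (by simp [a16]) ?_
    refine Runs.add 69 (by simp [a4]) (abs_cast_lt (v := 69) hG (by omega)) ?_
    refine Runs.add D (by simp [a0, a29]) (abs_lt_of_le hG (by omega) (by omega)) ?_
    refine Runs.add ((64 + queryLength k n : ℕ) : ℤ) (by simp [a25, a29])
      (abs_cast_lt hG (by omega)) ?_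
    refine Runs.add (n : ℤ) (by simp [a5, a29]) (abs_cast_lt hG (by omega)) ?_
    obtain ⟨H₀, hH₀⟩ : ∃ H₀, H₀ = Function.update (Function.update (Function.update (Function.update
      (Function.update H 64 (n : ℤ)) 65 (k : ℤ)) 66 (p : ℤ)) 67 (queryError k n a b : ℤ)) 68
      (queryFailure k b : ℤ) := ⟨_, rfl⟩
    rw [← hH₀]
    have hH₀H : ∀ z : ℤ, z < 64 ∨ 69 ≤ z → H₀ z = H z := by
      intro z hz
      rw [hH₀]
      iterate 5 rw [Function.update_of_ne (by omega)]
    refine Runs.seq (Runs.loop n (6 * (2 * n) + 7 * (2 * k) + 5)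
      (fun i R' H' => Frame R R' ∧ R' 31 = 69 + (i * (2 * n + 2 * k) : ℕ) ∧
        R' 33 = D - (i * (2 * n) : ℕ) ∧ R' 34 = (64 + queryLength k n + i * (2 * k) : ℕ) ∧
        R' 35 = n - i ∧ (∀ x < i * (2 * n + 2 * k), H' (69 + (x : ℕ)) = qf x) ∧
        ∀ z : ℤ, z < 69 ∨ ((64 + queryLength k n : ℕ) : ℤ) ≤ z → H' z = H₀ z)
      ⟨?_, by simp, by simp, by simp, by simp, ?_, fun _ _ => rfl⟩ ?_ ?_ (by simp [rowBody])) ?_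
    · intro i hi
      simp only [Function.update_apply]
      iterate 9 rw [if_neg (by omega)]
    · intro x hx; omega
    · rintro i hi R' H' - ⟨hF, h31, h33, h34, h35, hx, hz⟩
      refine ⟨by rw [h35]; omega, ?_⟩
      have hi1 : i * (2 * n + 2 * k) + (2 * n + 2 * k) ≤ n * (2 * n + 2 * k) := by
        rw [← Nat.succ_mul]; exact Nat.mul_le_mul_right _ hi
      have hi2 : i * (2 * n) + 2 * n ≤ 2 * n ^ 2 := by
        rw [← Nat.succ_mul, show 2 * n ^ 2 = n * (2 * n) by ring]; exact Nat.mul_le_mul_right _ hi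
      have hi3 : i * (2 * k) + 2 * k ≤ 2 * n * k := by
        rw [← Nat.succ_mul, show 2 * n * k = n * (2 * k) by ring]; exact Nat.mul_le_mul_right _ hi
      refine Runs.mono (runs_rowBody (c := n - i) hG hF a4 a23 a28 a29 h31 h33 h34
        (by rw [h35]; omega) ?_ ?_ hx hz ?_ ?_ ?_ (by omega) ?_ ?_ (by omega)) le_rfl ?_
      · intro t ht
        rw [hH₀H _ (by left; omega)]
        exact hq₁ i hi t ht
      · intro t ht
        rw [hH₀H _ (by right; omega)]
        exact hq₂ i hi t ht
      · omega
      · omega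
      · omega
      · omega
      · omega
      · rintro R'' H'' - ⟨hF, h31, h33, h34, h35, hx, hz⟩
        have e1 : (i + 1) * (2 * n + 2 * k) = i * (2 * n + 2 * k) + 2 * n + 2 * k := by ring
        rw [e1]
        refine ⟨hF, h31, ?_, ?_, ?_, hx, hz⟩
        · rw [h33]; push_cast; ring
        · rw [h34]; push_cast; ring
        · rw [h35]; push_cast; omega
    · rintro R' H' ⟨-, -, -, -, h35, -⟩
      rw [h35]; simp
    · rintro R' H' - ⟨hF, h31, h33, h34, h35, hx, hz⟩
      have b17 : R' 17 = answerBits k n p b := (hF 17 (by decide)).trans (hA 17 (by decide))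
      have b24 : R' 24 = queryLength k n := (hF 24 (by decide)).trans (hA 24 (by decide))
      refine Runs.const (abs_cast_lt (v := 64) hG (by omega)) ?_
      refine Runs.ask 64 (queryLength k n) (answerBits k n p b) (nodeQuery k n p a b j Z
        (sampleMatrix n k (fineBits p b) (coarseBits k n) g)) (by simp) (by simp [b24])
        (by simp [b17]) (by norm_num) ?_ hκ ?_ ?_
      · rw [hlen, List.range_add, List.map_append, nodeQuery, sigmaQuery, entries_eq_map, ← hqf,
          List.map_map]
        congr 1
        · have hh : ∀ z : ℤ, z < 69 → H' z = H₀ z := fun z h => hz z (Or.inl h)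
          simp [List.range_succ, hh, hH₀]
        · rw [show n * ((n + k) * 2) = n * (2 * n + 2 * k) by ring]
          refine List.map_congr_left fun x hx' => ?_
          rw [← hx x (List.mem_range.1 hx')]
          simp only [Function.comp]
          congr 1; push_cast; ring
      · exact (abs_saturate_le _ _).trans_lt (pow_lt_pow_right₀ (by norm_num) hlim)
      · refine Runs.nil (N := 0) ⟨hF.update.update, fun z hz' => ?_, by simp⟩
        rw [hz z (by omega), hH₀H z (by omega)]
  · rw [show 6 * (2 * n) + 7 * (2 * k) + 5 + 1 = 12 * n + 14 * k + 6 by ring]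
    omega

/-! ### Combining the answers -/

/-- Numerator and denominator of `∑ i < j, (M + i) ^ (2 k) z i / weightDen k M i`. -/
def combination (k M : ℕ) (z : ℕ → ℤ) : ℕ → ℤ × ℤ
  | 0 => (0, 1)
  | j + 1 => ((combination k M z j).1 * weightDen k M j +
      z j * (M + j) ^ (2 * k) * (combination k M z j).2,
      (combination k M z j).2 * weightDen k M j)

theorem combination_snd_ne_zero (k : ℕ) {M : ℕ} (hM : 0 < M) (z : ℕ → ℤ) (j : ℕ) :
    (combination k M z j).2 ≠ 0 := by
  induction j with
  | zero => simp [combination]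
  | succ j ih => exact mul_ne_zero ih (weightDen_ne_zero k M (by exact_mod_cast hM) j)

/-- Fractions are added over the product of the denominators without reduction. This is affordable
because the number k + 1 of terms is fixed. -/
theorem combination_div (k : ℕ) {M : ℕ} (hM : 0 < M) (z : ℕ → ℤ) (j : ℕ) :
    ((combination k M z j).1 : ℝ) / (combination k M z j).2
      = ∑ i ∈ Finset.range j, ((M : ℝ) + i) ^ (2 * k) / (weightDen k M i : ℝ) * z i := by
  induction j with
  | zero => simp [combination]
  | succ j ih =>
    have h1 : ((combination k M z j).2 : ℝ) ≠ 0 := by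
      exact_mod_cast combination_snd_ne_zero k hM z j
    have h2 : (weightDen k M j : ℝ) ≠ 0 := by exact_mod_cast weightDen_ne_zero k M (by exact_mod_cast hM) j
    rw [Finset.sum_range_succ, ← ih, combination]
    push_cast
    field_simp

theorem abs_prod_le_pow {s : Finset ℕ} {f : ℕ → ℤ} {Y : ℤ} {m : ℕ} (hY : 1 ≤ Y)
    (h : ∀ i ∈ s, |f i| ≤ Y) (hs : s.card ≤ m) : |∏ i ∈ s, f i| ≤ Y ^ m := by
  rw [Finset.abs_prod]
  refine (Finset.prod_le_prod (fun i _ => abs_nonneg _) h).trans ?_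
  rw [Finset.prod_const]
  exact pow_le_pow_right₀ hY hs

theorem abs_sq_sub_sq_le {k M i j : ℕ} (hi : i ≤ k) (hj : j ≤ k) :
    |((M : ℤ) + j) ^ 2 - ((M : ℤ) + i) ^ 2| ≤ ((M : ℤ) + k) ^ 2 := by
  have h1 : ((M : ℤ) + j) ^ 2 ≤ ((M : ℤ) + k) ^ 2 :=
    pow_le_pow_left₀ (by positivity) (by omega) 2
  have h2 : ((M : ℤ) + i) ^ 2 ≤ ((M : ℤ) + k) ^ 2 :=
    pow_le_pow_left₀ (by positivity) (by omega) 2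
  have h3 := sq_nonneg ((M : ℤ) + j)
  have h4 := sq_nonneg ((M : ℤ) + i)
  rw [abs_le]; constructor <;> linarith

theorem card_range_erase_le (s j : ℕ) : ((Finset.range s).erase j).card ≤ s :=
  (Finset.card_erase_le).trans (Finset.card_range s).le

theorem abs_weightDen_le {k M j : ℕ} (hM : 0 < M) (hj : j ≤ k) :
    |weightDen k M j| ≤ (((M : ℤ) + k) ^ 2) ^ (k + 1) := by
  refine abs_prod_le_pow (by nlinarith) (fun i hi => abs_sq_sub_sq_le ?_ hj)
    (card_range_erase_le _ _)
  have := Finset.mem_range.1 (Finset.mem_of_mem_erase hi)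
  omega

theorem pow_two_mul_le {k M j : ℕ} (hM : 0 < M) (hj : j ≤ k) :
    ((M : ℤ) + j) ^ (2 * k) ≤ (((M : ℤ) + k) ^ 2) ^ (k + 1) := by
  rw [← pow_mul]
  calc ((M : ℤ) + j) ^ (2 * k) ≤ ((M : ℤ) + k) ^ (2 * k) :=
        pow_le_pow_left₀ (by positivity) (by omega) _
    _ ≤ _ := pow_le_pow_right₀ (by omega) (by omega)

/-- The number X = ((M+k)²)^(k+1) bounds both the weight denominators and (M+j)^(2k). So each node
multiplies the old fraction by at most X and adds at most 2^l X^(j+1) to the numerator. -/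
theorem abs_combination_le {k M l : ℕ} (hM : 0 < M) {z : ℕ → ℤ} (hz : ∀ j, |z j| ≤ 2 ^ l) {j : ℕ}
    (hj : j ≤ k + 1) :
    |(combination k M z j).1| ≤ j * 2 ^ l * ((((M : ℤ) + k) ^ 2) ^ (k + 1)) ^ j ∧
      |(combination k M z j).2| ≤ ((((M : ℤ) + k) ^ 2) ^ (k + 1)) ^ j := by
  induction j with
  | zero => simp [combination]
  | succ j ih =>
    obtain ⟨h1, h2⟩ := ih (by omega)
    have h3 := abs_weightDen_le hM (show j ≤ k by omega)
    have h4 := pow_two_mul_le hM (show j ≤ k by omega)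
    have h5 : (0 : ℤ) ≤ ((M : ℤ) + j) ^ (2 * k) := by positivity
    obtain ⟨X, hX⟩ : ∃ X, X = (((M : ℤ) + k) ^ 2) ^ (k + 1) := ⟨_, rfl⟩
    rw [← hX] at h1 h2 h3 h4 ⊢
    have hX0 : 0 ≤ X := by rw [hX]; positivity
    constructor
    · rw [combination]
      refine (abs_add_le _ _).trans ?_
      rw [abs_mul, abs_mul, abs_mul, abs_of_nonneg h5]
      calc _ ≤ j * 2 ^ l * X ^ j * X + 2 ^ l * X * X ^ j := by
            gcongr
            exact hz j
        _ = _ := by push_cast; ring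
    · rw [combination, abs_mul, pow_succ]
      gcongr

/-- One factor of the weight of the current node. -/
def weightBody : List Cmd :=
  [.add 36 14 30, .mul 36 36 36, .sub 36 46 36, .mul 33 36 36,
    .ite 33 (block [.mul 38 38 46, .mul 39 39 36]) (block [.const 33 0]), .add 30 30 4,
    .sub 35 35 4]

/-- Add the contribution of one node. -/
def combineBody : List Cmd :=
  [.mul 46 43 43, .const 38 1, .const 39 1, .const 30 0, .add 35 6 4, .loop 35 (block weightBody),
    .mul 40 40 39, .mul 37 37 38, .mul 37 37 41, .add 40 40 37, .mul 41 41 39, .add 42 42 4,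
    .sub 45 45 4]

/-- A bound for the numbers that occur when the answers are combined. -/
def valueBound (k n p b : ℕ) : ℕ :=
  (k + 2) * 2 ^ answerBits k n p b * (((nodeBase k n b + k) ^ 2) ^ (k + 1)) ^ (k + 2) *
    (n + k) ^ k * k.factorial * 2 ^ p

theorem prod_range_erase_succ {f : ℕ → ℤ} (s j : ℕ) :
    ∏ i ∈ (Finset.range (s + 1)).erase j, f i
      = (∏ i ∈ (Finset.range s).erase j, f i) * if s = j then 1 else f s := by
  split_ifs with h
  · subst h
    rw [mul_one, Finset.range_add_one, Finset.erase_insert (by simp), Finset.erase_eq_of_notMem (by simp)]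
  · rw [Finset.range_add_one, Finset.erase_insert_of_ne h, Finset.prod_insert (by simp), mul_comm]

section

variable {O : Oracle} {Λ κ k n p a b j : ℕ} {R : ℕ → ℤ} {H : ℤ → ℤ}

/-- The factor i = j has to be omitted. The test register holds the square of (M+j)² - (M+i)², which
is positive exactly when i ≠ j. The other branch is a dummy write. -/
theorem runs_weightLoop {G : ℕ} (hG : G < 2 ^ Λ)
    (hGY : ((nodeBase k n b + k) ^ 2) ^ (k + 2) ≤ G)
    (hj : j ≤ k) (hA : Agree (params k n p a b) R) (h30 : R 30 = 0) (h35 : R 35 = (k + 1 : ℕ))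
    (h38 : R 38 = 1) (h39 : R 39 = 1) (h46 : R 46 = ((nodeBase k n b : ℤ) + j) ^ 2) :
    Runs O Λ κ 64 [.loop 35 (block weightBody)] R H ((k + 1) * 10 + 1) fun R' H' =>
      Agree (params k n p a b) R' ∧ (∀ i, i = 37 ∨ 40 ≤ i → R' i = R i) ∧ H' = H ∧
      R' 38 = ((nodeBase k n b : ℤ) + j) ^ (2 * k) ∧ R' 39 = weightDen k (nodeBase k n b) j := by
  obtain ⟨M, hM⟩ : ∃ M, M = nodeBase k n b := ⟨_, rfl⟩
  have hM0 : 0 < M := by have := lt_nodeBase k n b; omega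
  rw [← hM] at hGY h46 ⊢
  have hY1 : (1 : ℤ) ≤ ((M : ℤ) + k) ^ 2 := one_le_pow₀ (by omega)
  have hGY' : (((M : ℤ) + k) ^ 2) ^ (k + 2) ≤ G := by exact_mod_cast hGY
  have hGs : ∀ s ≤ k + 2, (((M : ℤ) + k) ^ 2) ^ s ≤ G := fun s hs =>
    (pow_le_pow_right₀ hY1 hs).trans hGY'
  have hG1 := hGs 1 (by omega)
  rw [pow_one] at hG1
  have hG2 : ((M : ℤ) + k) ^ 2 * ((M : ℤ) + k) ^ 2 ≤ G := by
    have := hGs 2 (by omega)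
    rwa [pow_two] at this
  have hMk : (M : ℤ) + k ≤ ((M : ℤ) + k) ^ 2 := by
    have : (1 : ℤ) ≤ (M : ℤ) + k := by omega
    nlinarith
  have habs : ∀ {v : ℤ}, |v| ≤ G → |v| < 2 ^ Λ := fun h => h.trans_lt (by exact_mod_cast hG)
  refine Runs.mono (Runs.loop (k + 1) 9
    (fun s R' H' => Agree (params k n p a b) R' ∧ (∀ i, i = 37 ∨ 40 ≤ i → R' i = R i) ∧ H' = H ∧
      R' 30 = s ∧ R' 35 = (k + 1 : ℕ) - s ∧
      R' 38 = ∏ i ∈ (Finset.range s).erase j, ((M : ℤ) + j) ^ 2 ∧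
      R' 39 = ∏ i ∈ (Finset.range s).erase j, (((M : ℤ) + j) ^ 2 - ((M : ℤ) + i) ^ 2))
    ⟨hA, fun _ _ => rfl, rfl, by simp [h30], by simp [h35], by simp [h38], by simp [h39]⟩ ?_ ?_
    (by simp [weightBody])) le_rfl ?_
  · rintro s hs R' H' - ⟨hA, hf, rfl, h30, h35, h38, h39⟩
    have a4 : R' 4 = 1 := hA 4 (by decide)
    have a14 : R' 14 = M := (hA 14 (by decide)).trans (by rw [hM]; rfl)
    have a46 : R' 46 = ((M : ℤ) + j) ^ 2 := (hf 46 (by decide)).trans h46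
    have hdiff := abs_sq_sub_sq_le (M := M) (show s ≤ k by omega) hj
    have hsq : ((M : ℤ) + s) ^ 2 ≤ ((M : ℤ) + k) ^ 2 :=
      pow_le_pow_left₀ (by positivity) (by omega) 2
    have hsq0 := sq_nonneg ((M : ℤ) + s)
    have hms : (M : ℤ) + s ≤ M + k := by omega
    refine ⟨by rw [h35]; omega, ?_⟩
    refine Runs.mono (N := 2 + (2 + 1) + 4) ?_ le_rfl fun _ _ _ hQ => hQ
    unfold weightBody
    refine Runs.add ((M : ℤ) + s) (by simp [a14, h30]) (habs ?_) ?_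
    · rw [abs_of_nonneg (by positivity)]; omega
    refine Runs.mul (((M : ℤ) + s) ^ 2) (by simp; ring) (habs ?_) ?_
    · rw [abs_of_nonneg hsq0]; omega
    refine Runs.sub (((M : ℤ) + j) ^ 2 - ((M : ℤ) + s) ^ 2) (by simp [a46])
      (habs (hdiff.trans hG1)) ?_
    refine Runs.mul ((((M : ℤ) + j) ^ 2 - ((M : ℤ) + s) ^ 2) ^ 2) (by simp; ring) (habs ?_) ?_
    · rw [abs_pow, pow_two]
      exact (mul_le_mul hdiff hdiff (abs_nonneg _) (by positivity)).trans hG2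
    have hQ38 : |∏ i ∈ (Finset.range (s + 1)).erase j, ((M : ℤ) + j) ^ 2| ≤ G := by
      refine (abs_prod_le_pow hY1 (fun i _ => ?_) (card_range_erase_le (s + 1) j)).trans
        (hGs (s + 1) (by omega))
      rw [abs_of_nonneg (by positivity)]
      exact pow_le_pow_left₀ (by positivity) (by omega) 2
    have hQ39 : |∏ i ∈ (Finset.range (s + 1)).erase j, (((M : ℤ) + j) ^ 2 - ((M : ℤ) + i) ^ 2)|
        ≤ G := by
      refine (abs_prod_le_pow hY1 (fun i hi => abs_sq_sub_sq_le ?_ hj)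
        (card_range_erase_le (s + 1) j)).trans (hGs (s + 1) (by omega))
      have := Finset.mem_range.1 (Finset.mem_of_mem_erase hi)
      omega
    refine Runs.seq (Runs.ite (Q := fun R'' H'' => Agree (params k n p a b) R'' ∧
      (∀ i, i = 37 ∨ 40 ≤ i → R'' i = R i) ∧ H'' = H' ∧
      R'' 30 = s ∧ R'' 35 = (k + 1 : ℕ) - s ∧
      R'' 38 = ∏ i ∈ (Finset.range (s + 1)).erase j, ((M : ℤ) + j) ^ 2 ∧
      R'' 39 = ∏ i ∈ (Finset.range (s + 1)).erase j, (((M : ℤ) + j) ^ 2 - ((M : ℤ) + i) ^ 2))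
      (by simp) (by simp) (fun hpos => ?_) (fun hneg => ?_)) ?_
    · simp only [Function.update_self] at hpos
      have hne : s ≠ j := by rintro rfl; simp at hpos
      refine Runs.mul (∏ i ∈ (Finset.range (s + 1)).erase j, ((M : ℤ) + j) ^ 2) ?_ (habs hQ38) ?_
      · rw [prod_range_erase_succ, if_neg hne]
        simp [h38, a46]
      refine Runs.mul (∏ i ∈ (Finset.range (s + 1)).erase j,
        (((M : ℤ) + j) ^ 2 - ((M : ℤ) + i) ^ 2)) ?_ (habs hQ39) ?_
      · simp [h39]
        rw [prod_range_erase_succ, if_neg hne]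
      refine Runs.nil (N := 0) ⟨hA.update.update.update.update.update.update, ?_, rfl,
        by simp [h30], by simp [h35], by simp, by simp⟩
      intro i hi
      iterate 6 rw [Function.update_of_ne (by omega)]
      exact hf i hi
    · simp only [Function.update_self] at hneg
      have heq : s = j := by
        have h0 : ((M : ℤ) + j) ^ 2 - ((M : ℤ) + s) ^ 2 = 0 :=
          pow_eq_zero_iff (two_ne_zero) |>.1 (le_antisymm hneg (sq_nonneg _))
        have h1 : ((j : ℤ) - s) * (2 * M + j + s) = 0 := by linear_combination h0
        rcases mul_eq_zero.1 h1 with h | h <;> omega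
      refine Runs.const (habs (by simp)) ?_
      refine Runs.nil ⟨hA.update.update.update.update.update, ?_, rfl,
        by simp [h30], by simp [h35], ?_, ?_⟩
      · intro i hi
        iterate 5 rw [Function.update_of_ne (by omega)]
        exact hf i hi
      · rw [prod_range_erase_succ, if_pos heq]
        simp [h38]
      · rw [prod_range_erase_succ, if_pos heq]
        simp [h39]
    · rintro R'' H'' - ⟨hA, hf, rfl, h30, h35, h38, h39⟩
      have a4 : R'' 4 = 1 := hA 4 (by decide)
      have hkY : (k : ℤ) + 1 ≤ G := by omega
      refine Runs.add ((s + 1 : ℕ) : ℤ) (by simp [h30, a4]) (abs_cast_lt hG (by omega)) ?_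
      refine Runs.sub ((k + 1 : ℕ) - (s + 1 : ℕ)) (by simp [h35, a4]; ring)
        (abs_lt_of_le hG (by omega) (by omega)) ?_
      refine Runs.nil (N := 0) ⟨hA.update.update, ?_, rfl, by simp, by simp, by simp [h38],
        by simp [h39]⟩
      intro i hi
      iterate 2 rw [Function.update_of_ne (by omega)]
      exact hf i hi
  · rintro R' H' ⟨-, -, -, -, h35, -⟩
    rw [h35]; simp
  · rintro R' H' - ⟨hA, hf, hH, -, -, h38, h39⟩
    refine ⟨hA, hf, hH, ?_, h39⟩
    rw [h38, Finset.prod_const, Finset.card_erase_of_mem (Finset.mem_range.2 (by omega)),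
      Finset.card_range, ← pow_mul, Nat.add_sub_cancel]

/-- One query and its contribution to the estimate. -/
def nodeBody : List Cmd := 
  .add 43 14 42 :: .mul 44 9 43 :: (queryCode ++ combineBody)

/-- The queries and the computation of the estimate. -/
def estimateCode (k : ℕ) : List Cmd :=
  [.const 40 0, .const 41 1, .const 42 0, .add 45 6 4, .loop 45 (block nodeBody), .add 30 5 29,
    .add 35 6 29, .loop 35 (block [.add 30 30 4, .mul 40 40 30, .sub 35 35 4]), .mul 41 41 18,
    .const 30 k.factorial, .mul 41 41 30, .add 0 40 29, .add 1 41 29]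

theorem runs_combineBody {z : ℕ → ℤ} {l : ℕ} {B : ℤ} (hz : ∀ j, |z j| ≤ 2 ^ l)
    (hG : paramBound k n p a b < 2 ^ Λ)
    (hV : (k + 2) * 2 ^ l * (((nodeBase k n b + k) ^ 2) ^ (k + 1)) ^ (k + 2) < 2 ^ Λ) (hj : j ≤ k)
    (hA : Agree (params k n p a b) R)
    (h37 : R 37 = z j) (h40 : R 40 = (combination k (nodeBase k n b) z j).1)
    (h41 : R 41 = (combination k (nodeBase k n b) z j).2) (h42 : R 42 = j)
    (h43 : R 43 = (nodeBase k n b + j : ℕ)) (h45 : R 45 = B) (hB : 0 < B) (hB' : B ≤ k + 1) :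
    Runs O Λ κ 64 combineBody R H (10 * k + 23) fun R' H' =>
      Agree (params k n p a b) R' ∧ H' = H ∧
      R' 40 = (combination k (nodeBase k n b) z (j + 1)).1 ∧
      R' 41 = (combination k (nodeBase k n b) z (j + 1)).2 ∧ R' 42 = (j + 1 : ℕ) ∧
      R' 45 = B - 1 := by
  have a4 : R 4 = 1 := hA 4 (by decide)
  have a6 : R 6 = k := hA 6 (by decide)
  have hf := Nat.zero_le (2 ^ fineBits p b)
  have hkG : k + 1 + 50 ≤ paramBound k n p a b := by rw [paramBound]; omega
  obtain ⟨M, hM⟩ : ∃ M, M = nodeBase k n b := ⟨_, rfl⟩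
  have hM0 : 0 < M := by have := lt_nodeBase k n b; omega
  rw [← hM] at hV h40 h41 h43 ⊢
  obtain ⟨X, hX⟩ : ∃ X, X = ((M + k) ^ 2) ^ (k + 1) := ⟨_, rfl⟩
  have hX' : (((M : ℤ) + k) ^ 2) ^ (k + 1) = X := by rw [hX]; push_cast; ring
  have hX1 : 1 ≤ X := by rw [hX]; exact Nat.one_le_pow _ _ (by positivity)
  have hY1 : 1 ≤ (M + k) ^ 2 := Nat.one_le_pow _ _ (by omega)
  rw [← hX] at hV
  obtain ⟨G, hGd⟩ : ∃ G, G = (k + 2) * 2 ^ l * X ^ (k + 2) := ⟨_, rfl⟩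
  rw [← hGd] at hV
  have hl1 : 1 ≤ 2 ^ l := Nat.one_le_two_pow
  have hpow : ∀ s ≤ k + 2, ∀ c ≤ k + 2, (c : ℤ) * 2 ^ l * X ^ s ≤ G := by
    intro s hs c hc
    have : c * 2 ^ l * X ^ s ≤ G := by
      rw [hGd]
      gcongr
    exact_mod_cast this
  have habs : ∀ {v : ℤ}, |v| ≤ G → |v| < 2 ^ Λ := fun h => h.trans_lt (by exact_mod_cast hV)
  have hXs : ∀ s ≤ k + 2, (X : ℤ) ^ s ≤ G := fun s hs => by
    refine le_trans ?_ (hpow s hs 1 (by omega))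
    have : (1 : ℤ) ≤ 2 ^ l := by exact_mod_cast hl1
    have h2 : (0 : ℤ) ≤ X ^ s := by positivity
    push_cast
    nlinarith
  have hc := abs_combination_le hM0 hz (show j ≤ k + 1 by omega)
  have hc' := abs_combination_le hM0 hz (show j + 1 ≤ k + 1 by omega)
  have hw := abs_weightDen_le hM0 hj
  have hp := pow_two_mul_le hM0 hj
  have hp0 : (0 : ℤ) ≤ ((M : ℤ) + j) ^ (2 * k) := by positivity
  have hzj := hz j
  rw [hX'] at hc hc' hw hp
  refine Runs.mono (N := 7 + ((k + 1) * 10 + 1) + 5) ?_ (by omega) fun _ _ _ hQ => hQ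
  unfold combineBody
  refine Runs.mul (((M : ℤ) + j) ^ 2) (by simp [h43]; ring) (habs ?_) ?_
  · rw [abs_of_nonneg (by positivity)]
    refine le_trans ?_ (hXs 1 (by omega))
    rw [pow_one, ← hX']
    calc ((M : ℤ) + j) ^ 2 ≤ ((M : ℤ) + k) ^ 2 := pow_le_pow_left₀ (by positivity) (by omega) 2
      _ ≤ _ := le_self_pow₀ (by exact_mod_cast hY1) (by omega)
  refine Runs.const (abs_cast_lt (v := 1) hG (by omega)) ?_
  refine Runs.const (abs_cast_lt (v := 1) hG (by omega)) ?_
  refine Runs.const (abs_cast_lt (v := 0) hG (by omega)) ?_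
  refine Runs.add ((k + 1 : ℕ) : ℤ) (by simp [a6, a4]) (abs_cast_lt hG (by omega)) ?_
  refine Runs.seq (runs_weightLoop (j := j) hV ?_ hj hA.update.update.update.update.update
    (by simp) (by simp) (by simp) (by simp) (by simp [hM])) ?_
  · have h1 : ((nodeBase k n b + k) ^ 2) ^ (k + 2) ≤ X ^ (k + 2) := by
      rw [← hM, hX]
      exact Nat.pow_le_pow_left (Nat.le_self_pow (by omega) _) _
    have h2 := hXs (k + 2) le_rfl
    zify at h1 ⊢
    exact h1.trans h2
  rw [← hM]
  rintro R' H' - ⟨hA', hf', rfl, h38, h39⟩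
  have a4 : R' 4 = 1 := hA' 4 (by decide)
  have h37 : R' 37 = z j := by rw [hf' 37 (by decide)]; simp [h37]
  have h40 : R' 40 = (combination k M z j).1 := by rw [hf' 40 (by decide)]; simp [h40]
  have h41 : R' 41 = (combination k M z j).2 := by rw [hf' 41 (by decide)]; simp [h41]
  have h42 : R' 42 = j := by rw [hf' 42 (by decide)]; simp [h42]
  have h45 : R' 45 = B := by rw [hf' 45 (by decide)]; simp [h45]
  refine Runs.mul ((combination k M z j).1 * weightDen k M j) (by simp [h40, h39]) (habs ?_) ?_
  · rw [abs_mul]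
    calc _ ≤ j * 2 ^ l * (X : ℤ) ^ j * X := by gcongr; exact hc.1
      _ = j * 2 ^ l * (X : ℤ) ^ (j + 1) := by ring
      _ ≤ G := hpow (j + 1) (by omega) j (by omega)
  refine Runs.mul (z j * ((M : ℤ) + j) ^ (2 * k)) (by simp [h37, h38]) (habs ?_) ?_
  · rw [abs_mul, abs_of_nonneg hp0]
    calc _ ≤ 2 ^ l * (X : ℤ) := by gcongr
      _ = (1 : ℕ) * 2 ^ l * (X : ℤ) ^ 1 := by push_cast; ring
      _ ≤ G := hpow 1 (by omega) 1 (by omega)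
  refine Runs.mul (z j * ((M : ℤ) + j) ^ (2 * k) * (combination k M z j).2) (by simp [h41])
    (habs ?_) ?_
  · rw [abs_mul, abs_mul, abs_of_nonneg hp0]
    calc _ ≤ 2 ^ l * (X : ℤ) * X ^ j := by gcongr; exact hc.2
      _ = (1 : ℕ) * 2 ^ l * (X : ℤ) ^ (j + 1) := by push_cast; ring
      _ ≤ G := hpow (j + 1) (by omega) 1 (by omega)
  refine Runs.add (combination k M z (j + 1)).1 (by simp [combination])
    (habs (hc'.1.trans (hpow _ (by omega) _ (by omega)))) ?_
  refine Runs.mul (combination k M z (j + 1)).2 (by simp [h41, h39, combination])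
    (habs (hc'.2.trans (hXs _ (by omega)))) ?_
  refine Runs.add ((j + 1 : ℕ) : ℤ) (by simp [h42, a4]) (abs_cast_lt hG (by omega)) ?_
  refine Runs.sub (B - 1) (by simp [h45, a4]) (abs_lt_of_le hG (by omega) (by omega)) ?_
  exact Runs.nil (N := 0) ⟨hA'.update.update.update.update.update.update.update, rfl, by simp,
    by simp, by simp, by simp⟩

end

section

variable {O : Oracle} {Λ κ k n p a b : ℕ} {R : ℕ → ℤ} {H : ℤ → ℤ}

theorem gridRoot_le_nodeBase (k n b : ℕ) : gridRoot k n ≤ nodeBase k n b :=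
  Nat.le_mul_of_pos_right _ (by positivity)

theorem combination_bound_le_valueBound (k n p b : ℕ) (hn : 0 < n) :
    (k + 2) * 2 ^ answerBits k n p b * (((nodeBase k n b + k) ^ 2) ^ (k + 1)) ^ (k + 2)
      ≤ valueBound k n p b := by
  rw [valueBound, mul_assoc _ _ (2 ^ p), mul_assoc _ _ (k.factorial * 2 ^ p)]
  refine Nat.le_mul_of_pos_right _ ?_
  have := Nat.factorial_pos k
  positivity

/-- What is known about the memory after the coins have been decoded. -/
structure Decoded (k n p a b : ℕ) (Z : Fin n → Fin n → ℤ × ℤ) (g : ℕ → ℤ) (H : ℤ → ℤ) : Prop where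
  input : ∀ x < 2 * n ^ 2, H (-((p + a : ℕ) : ℤ) - (x : ℕ)) = entryFn Z x
  samples : ∀ x < 2 * n * k, H ((64 + queryLength k n : ℕ) + (x : ℕ))
    = sample (fineBits p b) (coarseBits k n) g x

theorem Decoded.congr {Z : Fin n → Fin n → ℤ × ℤ} {g : ℕ → ℤ} {H' : ℤ → ℤ}
    (h : Decoded k n p a b Z g H) (ha : 0 < a)
    (hH : ∀ z : ℤ, z < 64 ∨ ((64 + queryLength k n : ℕ) : ℤ) ≤ z → H' z = H z) :
    Decoded k n p a b Z g H' := by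
  refine ⟨fun x hx => ?_, fun x hx => ?_⟩
  · rw [hH _ (by left; omega)]
    exact h.input x hx
  · rw [hH _ (by right; omega)]
    exact h.samples x hx

theorem runs_nodeBody {g : ℕ → ℤ} {Z : Fin n → Fin n → ℤ × ℤ} {z : ℕ → ℤ} {j : ℕ}
    (hz : z = fun j => saturate (answerBits k n p b) (O (nodeQuery k n p a b j Z
        (sampleMatrix n k (fineBits p b) (coarseBits k n) g))))
    (hn : 0 < n) (ha : 0 < a)
    (hG : paramBound k n p a b < 2 ^ Λ) (hV : valueBound k n p b < 2 ^ Λ)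
    (hlim : answerBits k n p b < Λ)
    (hκ : 1 + 3 * Λ + queryLength k n + queryLength k n * Λ + answerBits k n p b ≤ κ)
    (hj : j ≤ k) (hA : Agree (params k n p a b) R) (hH : Decoded k n p a b Z g H)
    (h40 : R 40 = (combination k (nodeBase k n b) z j).1)
    (h41 : R 41 = (combination k (nodeBase k n b) z j).2) (h42 : R 42 = j)
    (h45 : R 45 = (k + 1 : ℕ) - j) :
    Runs O Λ κ 64 nodeBody R H (10 * k + n * (12 * n + 14 * k + 6) + 42) fun R' H' =>
      Agree (params k n p a b) R' ∧ Decoded k n p a b Z g H' ∧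
      R' 40 = (combination k (nodeBase k n b) z (j + 1)).1 ∧
      R' 41 = (combination k (nodeBase k n b) z (j + 1)).2 ∧ R' 42 = (j + 1 : ℕ) ∧
      R' 45 = (k + 1 : ℕ) - (j + 1 : ℕ) := by
  have hV' := (combination_bound_le_valueBound k n p b hn).trans_lt hV
  have a9 : R 9 = gridRoot k n := hA 9 (by decide)
  have a14 : R 14 = nodeBase k n b := hA 14 (by decide)
  have hf := Nat.zero_le (2 ^ fineBits p b)
  have hMG : nodeBase k n b + k ≤ paramBound k n p a b := by rw [paramBound]; omega
  have hM0 := lt_nodeBase k n b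
  have hLM : gridRoot k n * (nodeBase k n b + j)
      ≤ (k + 2) * 2 ^ answerBits k n p b * (((nodeBase k n b + k) ^ 2) ^ (k + 1)) ^ (k + 2) := by
    have h1 := gridRoot_le_nodeBase k n b
    have h0 : 0 < nodeBase k n b + k := by omega
    calc gridRoot k n * (nodeBase k n b + j) ≤ (nodeBase k n b + k) * (nodeBase k n b + k) :=
          Nat.mul_le_mul (by omega) (by omega)
      _ = (nodeBase k n b + k) ^ 2 := (pow_two _).symm
      _ ≤ (((nodeBase k n b + k) ^ 2) ^ (k + 1)) := Nat.le_self_pow (by omega) _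
      _ ≤ (((nodeBase k n b + k) ^ 2) ^ (k + 1)) ^ (k + 2) := Nat.le_self_pow (by omega) _
      _ ≤ _ := Nat.le_mul_of_pos_left _ (by positivity)
  refine Runs.mono (N := (10 * k + 23) + (n * (12 * n + 14 * k + 6) + 17) + 2) ?_ (by omega)
    fun _ _ _ hQ => hQ
  unfold nodeBody
  refine Runs.add ((nodeBase k n b + j : ℕ) : ℤ) (by simp [a14, h42]) (abs_cast_lt hG (by omega)) ?_
  refine Runs.mul ((gridRoot k n * (nodeBase k n b + j) : ℕ) : ℤ) (by simp [a9])
    (abs_cast_lt hV' hLM) ?_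
  refine Runs.append (runs_queryCode (j := j) ha hG hlim hκ hA.update.update (by simp) hH.input
    hH.samples) ?_
  rintro R' H' - ⟨hF, hf', h37⟩
  have hA' : Agree (params k n p a b) R' := fun i hi => by
    rw [hF i (Or.inl hi)]
    iterate 2 rw [Function.update_of_ne (by omega)]
    exact hA i hi
  refine Runs.mono (runs_combineBody (z := z) (B := (k + 1 : ℕ) - j) (fun j => by
    rw [hz]; exact abs_saturate_le _ _) hG hV' hj hA' (by rw [h37, hz])
    (by rw [hF 40 (by decide)]; simp [h40]) (by rw [hF 41 (by decide)]; simp [h41])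
    (by rw [hF 42 (by decide)]; simp [h42]) (by rw [hF 43 (by decide)]; simp)
    (by rw [hF 45 (by decide)]; simp [h45]) (by omega) (by push_cast; omega)) le_rfl ?_
  rintro R'' H'' - ⟨hA, rfl, h40, h41, h42, h45⟩
  exact ⟨hA, hH.congr ha hf', h40, h41, h42, by rw [h45]; push_cast; ring⟩

/-- Uses binom(n+k, n) · k! = (n+1)⋯(n+k): the program multiplies the numerator by the rising
product and the denominator by k! and by the scale 2^p of the answers. -/
theorem estimate_eq_div (z : ℕ → ℤ) :
    (((combination k (nodeBase k n b) z (k + 1)).1 * ((n + 1).ascFactorial k : ℕ) : ℤ) : ℝ) /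
      (((combination k (nodeBase k n b) z (k + 1)).2 * (2 ^ p : ℕ) * (k.factorial : ℕ) : ℤ) : ℝ)
      = estimate k n p b z := by
  have hM : 0 < nodeBase k n b := by have := lt_nodeBase k n b; omega
  have h := combination_div k hM z (k + 1)
  rw [estimate, Nat.ascFactorial_eq_factorial_mul_choose, Nat.choose_symm_add]
  have h2 : ∑ j ∈ Finset.range (k + 1), (((nodeBase k n b : ℝ) + j) ^ (2 * k) /
      (weightDen k (nodeBase k n b) j : ℝ)) * ((z j : ℝ) / 2 ^ p)
      = (∑ j ∈ Finset.range (k + 1), ((nodeBase k n b : ℝ) + j) ^ (2 * k) /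
      (weightDen k (nodeBase k n b) j : ℝ) * z j) / 2 ^ p := by
    rw [Finset.sum_div]
    exact Finset.sum_congr rfl fun j _ => by ring
  rw [h2, ← h]
  have h3 : ((combination k (nodeBase k n b) z (k + 1)).2 : ℝ) ≠ 0 := by
    exact_mod_cast combination_snd_ne_zero k hM z (k + 1)
  have h4 : (k.factorial : ℝ) ≠ 0 := by exact_mod_cast k.factorial_ne_zero
  push_cast
  field_simp

theorem runs_estimateCode {g : ℕ → ℤ} {Z : Fin n → Fin n → ℤ × ℤ} {z : ℕ → ℤ}
    (hz : z = fun j => saturate (answerBits k n p b) (O (nodeQuery k n p a b j Z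
        (sampleMatrix n k (fineBits p b) (coarseBits k n) g))))
    (hn : 0 < n) (ha : 0 < a)
    (hG : paramBound k n p a b < 2 ^ Λ) (hV : valueBound k n p b < 2 ^ Λ)
    (hlim : answerBits k n p b < Λ)
    (hκ : 1 + 3 * Λ + queryLength k n + queryLength k n * Λ + answerBits k n p b ≤ κ)
    (hA : Agree (params k n p a b) R) (hH : Decoded k n p a b Z g H) :
    Runs O Λ κ 64 (estimateCode k) R H
      ((k + 1) * (10 * k + n * (12 * n + 14 * k + 6) + 43) + 4 * k + 13) fun R' _ =>
      (R' 0 : ℝ) / (R' 1 : ℝ) = estimate k n p b z := by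
  have a4 : R 4 = 1 := hA 4 (by decide)
  have a6 : R 6 = k := hA 6 (by decide)
  have hf := Nat.zero_le (2 ^ fineBits p b)
  have hkG : k + 50 + n + k ≤ paramBound k n p a b := by rw [paramBound]; omega
  refine Runs.mono (N := 5 + (k * (3 + 1) + 1) + 2 +
    ((k + 1) * (10 * k + n * (12 * n + 14 * k + 6) + 42 + 1) + 1) + 4) ?_ ?_ fun _ _ _ hQ => hQ
  swap
  · rw [show 10 * k + n * (12 * n + 14 * k + 6) + 42 + 1
      = 10 * k + n * (12 * n + 14 * k + 6) + 43 by ring]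
    omega
  unfold estimateCode
  refine Runs.const (abs_cast_lt (v := 0) hG (by omega)) ?_
  refine Runs.const (abs_cast_lt (v := 1) hG (by omega)) ?_
  refine Runs.const (abs_cast_lt (v := 0) hG (by omega)) ?_
  refine Runs.add ((k + 1 : ℕ) : ℤ) (by simp [a4, a6]) (abs_cast_lt hG (by omega)) ?_
  refine Runs.seq (Runs.loop (k + 1) (10 * k + n * (12 * n + 14 * k + 6) + 42)
    (fun j R' H' => Agree (params k n p a b) R' ∧ Decoded k n p a b Z g H' ∧
      R' 40 = (combination k (nodeBase k n b) z j).1 ∧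
      R' 41 = (combination k (nodeBase k n b) z j).2 ∧ R' 42 = (j : ℕ) ∧
      R' 45 = (k + 1 : ℕ) - (j : ℕ))
    ⟨hA.update.update.update.update, hH, by simp [combination], by simp [combination], by simp,
      by simp⟩ ?_ ?_ (by simp [nodeBody])) ?_
  · rintro j hj R' H' - ⟨hA, hH, h40, h41, h42, h45⟩
    exact ⟨by rw [h45]; omega, runs_nodeBody hz hn ha hG hV hlim hκ (by omega) hA hH h40 h41 h42 h45⟩
  · rintro R' H' ⟨-, -, -, -, -, h45⟩
    rw [h45]; simp
  rintro R' H' - ⟨hA, -, h40, h41, -, -⟩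
  have a5 : R' 5 = n := hA 5 (by decide)
  have a6 : R' 6 = k := hA 6 (by decide)
  have a29 : R' 29 = 0 := hA 29 (by decide)
  have hM0 : 0 < nodeBase k n b := by have := lt_nodeBase k n b; omega
  have hc := abs_combination_le hM0 (l := answerBits k n p b) (z := z)
    (fun j => by rw [hz]; exact abs_saturate_le _ _) (show k + 1 ≤ k + 1 from le_rfl)
  obtain ⟨X, hX⟩ : ∃ X, X = ((nodeBase k n b + k) ^ 2) ^ (k + 1) := ⟨_, rfl⟩
  have hX' : (((nodeBase k n b : ℤ) + k) ^ 2) ^ (k + 1) = X := by rw [hX]; push_cast; ring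
  have hX1 : 1 ≤ X := by rw [hX]; exact Nat.one_le_pow _ _ (by positivity)
  rw [hX'] at hc
  have hXk : X ^ (k + 1) ≤ X ^ (k + 2) := Nat.pow_le_pow_right hX1 (by omega)
  have hnum : ∀ c : ℕ, c ≤ (n + k) ^ k →
      |(combination k (nodeBase k n b) z (k + 1)).1 * (c : ℤ)| < 2 ^ Λ := by
    intro c hc'
    rw [abs_mul, abs_of_nonneg (Int.natCast_nonneg c)]
    have h1 : (k + 1) * 2 ^ answerBits k n p b * X ^ (k + 1) * c ≤ valueBound k n p b := by
      rw [valueBound, ← hX, mul_assoc _ _ (2 ^ p)]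
      refine le_trans ?_ (Nat.le_mul_of_pos_right _ (by positivity))
      gcongr
      omega
    calc _ ≤ (((k + 1 : ℕ) : ℤ) * 2 ^ answerBits k n p b * X ^ (k + 1)) * c := by
            gcongr; exact hc.1
      _ ≤ (valueBound k n p b : ℤ) := by exact_mod_cast h1
      _ < 2 ^ Λ := by exact_mod_cast hV
  have hden : ∀ c : ℕ, c ≤ k.factorial * 2 ^ p →
      |(combination k (nodeBase k n b) z (k + 1)).2 * (c : ℤ)| < 2 ^ Λ := by
    intro c hc'
    rw [abs_mul, abs_of_nonneg (Int.natCast_nonneg c)]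
    have h1 : X ^ (k + 1) * c ≤ valueBound k n p b := by
      rw [valueBound, ← hX, mul_assoc _ _ (2 ^ p)]
      refine Nat.mul_le_mul ?_ hc'
      refine hXk.trans ?_
      rw [mul_comm _ (X ^ (k + 2)), mul_assoc]
      exact Nat.le_mul_of_pos_right _ (by positivity)
    calc _ ≤ (X : ℤ) ^ (k + 1) * c := by gcongr; exact hc.2
      _ ≤ (valueBound k n p b : ℤ) := by exact_mod_cast h1
      _ < 2 ^ Λ := by exact_mod_cast hV
  have hnk : 1 ≤ n + k := by omega
  refine Runs.add (n : ℤ) (by simp [a5, a29]) (abs_cast_lt hG (by omega)) ?_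
  refine Runs.add (k : ℤ) (by simp [a6, a29]) (abs_cast_lt hG (by omega)) ?_
  refine Runs.seq (Runs.loop k 3
    (fun s R' _ => Agree (params k n p a b) R' ∧ R' 30 = (n + s : ℕ) ∧ R' 35 = k - s ∧
      R' 40 = (combination k (nodeBase k n b) z (k + 1)).1 * ((n + 1).ascFactorial s : ℕ) ∧
      R' 41 = (combination k (nodeBase k n b) z (k + 1)).2)
    ⟨hA.update.update, by simp, by simp, by simp [h40], by simp [h41]⟩ ?_ ?_) ?_
  · rintro s hs R' H' - ⟨hA, h30, h35, h40, h41⟩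
    have a4 : R' 4 = 1 := hA 4 (by decide)
    refine ⟨by rw [h35]; omega, ?_⟩
    refine Runs.add ((n + (s + 1) : ℕ) : ℤ) (by simp [h30, a4]; ring)
      (abs_cast_lt hG (by omega)) ?_
    refine Runs.mul ((combination k (nodeBase k n b) z (k + 1)).1 *
      ((n + 1).ascFactorial (s + 1) : ℕ)) ?_ (hnum _ ?_) ?_
    · rw [Nat.ascFactorial_succ]
      simp [h40]
      ring
    · refine (Nat.ascFactorial_le_pow_add n (s + 1)).trans ?_
      calc (n + (s + 1)) ^ (s + 1) ≤ (n + k) ^ (s + 1) := Nat.pow_le_pow_left (by omega) _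
        _ ≤ (n + k) ^ k := Nat.pow_le_pow_right hnk hs
    refine Runs.sub (k - (s + 1 : ℕ)) (by simp [h35, a4]; ring)
      (abs_lt_of_le hG (by omega) (by omega)) ?_
    exact Runs.nil ⟨hA.update.update.update, by simp, by simp, by simp, by simp [h41]⟩
  · rintro R' H' ⟨-, -, h35, -⟩
    rw [h35]; simp
  rintro R' H' - ⟨hA, h30, h35, h40, h41⟩
  have a18 : R' 18 = (2 ^ p : ℕ) := hA 18 (by decide)
  have a29 : R' 29 = 0 := hA 29 (by decide)
  have hfac := Nat.factorial_pos k
  have hasc : (n + 1).ascFactorial k ≤ (n + k) ^ k := Nat.ascFactorial_le_pow_add n k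
  have hden1 := hden (2 ^ p) (Nat.le_mul_of_pos_left _ hfac)
  have hden2 := hden (k.factorial * 2 ^ p) le_rfl
  have hden3 : (combination k (nodeBase k n b) z (k + 1)).2 * (2 ^ p : ℕ) * (k.factorial : ℕ)
      = (combination k (nodeBase k n b) z (k + 1)).2 * ((k.factorial * 2 ^ p : ℕ) : ℤ) := by
    push_cast; ring
  refine Runs.mul ((combination k (nodeBase k n b) z (k + 1)).2 * (2 ^ p : ℕ)) (by simp [h41, a18])
    hden1 ?_
  refine Runs.const (abs_cast_lt hV ?_) ?_
  · rw [valueBound, mul_assoc _ _ (2 ^ p)]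
    refine le_trans ?_ (Nat.le_mul_of_pos_left _ (by rw [← hX]; positivity))
    exact Nat.le_mul_of_pos_right _ (by positivity)
  refine Runs.mul ((combination k (nodeBase k n b) z (k + 1)).2 * (2 ^ p : ℕ) * (k.factorial : ℕ))
    (by simp) (by rw [hden3]; exact hden2) ?_
  refine Runs.add ((combination k (nodeBase k n b) z (k + 1)).1 * ((n + 1).ascFactorial k : ℕ))
    (by simp [h40, a29]) (hnum _ hasc) ?_
  refine Runs.add ((combination k (nodeBase k n b) z (k + 1)).2 * (2 ^ p : ℕ) * (k.factorial : ℕ))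
    (by simp [a29]) (by rw [hden3]; exact hden2) ?_
  refine Runs.nil (N := 0) ?_
  rw [← estimate_eq_div]
  simp

end

/-! ### The program -/

/-- Move the input, compute the parameters, and prepare the coin flips. -/
def setupCode (k : ℕ) : List Cmd :=
  gridCode k ++ (scaleCode ++ (errorCode k ++ (addressCode ++ [.add 31 27 29, .add 30 22 29])))

/-- The reduction. -/
def program (k : ℕ) : Cmd :=
  block (inputCode ++ (setupCode k ++ ([.loop 30 (block coinBody)] ++
    (sampleCode ++ estimateCode k))))

/-- A bound for the number of steps of the program apart from the coin flips. -/
def stepBound (k n p b : ℕ) : ℕ :=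
  (12 * n ^ 2 + 40) + (5 * n + 4 * b + 3 * k + 3 * p + 92) +
    ((2 * n * k * (10 * (fineBits p b + 2 * coarseBits k n) + 11) + 4) +
    ((k + 1) * (10 * k + n * (12 * n + 14 * k + 6) + 43) + 4 * k + 13)) +
    (5 * coinCount k n p b + 1) + 3

section

variable {O : Oracle} {Λ κ k n p a b : ℕ}

theorem runs_setupCode {R : ℕ → ℤ} {H : ℤ → ℤ} (hn : 0 < n) (hb : 0 < b)
    (hG : paramBound k n p a b < 2 ^ Λ) (h : AgreeTo 6 (params k n p a b) R) :
    Runs O Λ κ 64 (setupCode k) R H (5 * n + 4 * b + 3 * k + 3 * p + 92) fun R' H' =>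
      Agree (params k n p a b) R' ∧ R' 30 = coinCount k n p b ∧
      R' 31 = (64 + queryLength k n + 2 * n * k : ℕ) ∧ H' = H := by
  have hf := Nat.zero_le (2 ^ fineBits p b)
  have hGT : 100 + coinCount k n p b + queryLength k n + 2 * n * k ≤ paramBound k n p a b := by
    rw [paramBound]; omega
  refine Runs.mono (N := 2 + (3 * p + 30) + (3 * k + 20) + (4 * b + 20) + (5 * n + 20)) ?_
    (by omega) fun _ _ _ hQ => hQ
  unfold setupCode
  refine Runs.append (runs_gridCode hG h) ?_
  rintro R₁ H₁ - ⟨h, rfl⟩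
  refine Runs.append (runs_scaleCode hG h) ?_
  rintro R₂ H₂ - ⟨h, rfl⟩
  refine Runs.append (runs_errorCode hn hb hG h) ?_
  rintro R₃ H₃ - ⟨h, rfl⟩
  refine Runs.append (runs_addressCode hG h) ?_
  rintro R₄ H₄ - ⟨h, rfl⟩
  have hA : Agree (params k n p a b) R₄ := h
  have a22 : R₄ 22 = coinCount k n p b := h 22 (by decide)
  have a27 : R₄ 27 = (64 + queryLength k n + 2 * n * k : ℕ) := h 27 (by decide)
  have a29 : R₄ 29 = 0 := h 29 (by decide)
  refine Runs.add ((64 + queryLength k n + 2 * n * k : ℕ) : ℤ) (by simp [a27, a29])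
    (abs_cast_lt hG (by omega)) ?_
  refine Runs.add (coinCount k n p b : ℤ) (by simp [a22, a29]) (abs_cast_lt hG (by omega)) ?_
  exact Runs.nil (N := 0) ⟨hA.update.update, by simp, by simp, rfl⟩

theorem getD_gpeInput {Z : Fin n → Fin n → ℤ × ℤ} (x : ℕ) :
    (gpeInput p a b Z).getD (4 + x) 0 = entryFn Z x := by
  rw [entryFn, gpeInput, add_comm]
  simp [List.getD]

theorem initial_mem_natCast (L : List ℤ) (i : ℕ) : (initial L).mem i = L.getD i 0 := by
  simp [initial]

theorem exists_setup {Z : Fin n → Fin n → ℤ × ℤ} (hn : 0 < n) (ha : 0 < a) (hb : 0 < b)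
    (hκ : 1 + 3 * Λ ≤ κ) (hG : paramBound k n p a b < 2 ^ Λ)
    (hB : ∀ z, |(initial (gpeInput p a b Z)).mem z| < 2 ^ Λ) :
    ∃ R H, Bounded Λ R H ∧ Agree (params k n p a b) R ∧ R 30 = coinCount k n p b ∧
      R 31 = (64 + queryLength k n + 2 * n * k : ℕ) ∧
      (∀ x < 2 * n ^ 2, H (-((p + a : ℕ) : ℤ) - (x : ℕ)) = entryFn Z x) ∧
      ∀ fuel, ((12 * n ^ 2 + 40) + (5 * n + 4 * b + 3 * k + 3 * p + 92)) * κ < fuel →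
        ∃ t ≤ ((12 * n ^ 2 + 40) + (5 * n + 4 * b + 3 * k + 3 * p + 92)) * κ, ∀ l,
          evalList O fuel (inputCode ++ (setupCode k ++ l)) (initial (gpeInput p a b Z))
            = evalList O fuel l ⟨layout 64 R H, t⟩ := by
  obtain ⟨m, hm⟩ : ∃ m, m = (initial (gpeInput p a b Z)).mem := ⟨_, rfl⟩
  have hcell : ∀ i : ℕ, m i = (gpeInput p a b Z).getD i 0 := fun i => by
    rw [hm, initial_mem_natCast]
  have hentry : ∀ x : ℕ, m ((4 + x : ℕ) : ℤ) = entryFn Z x := fun x => by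
    rw [hcell, getD_gpeInput]
  have hrun := runs_inputCode (O := O) (κ := κ) (k := k) (R := fun i => m i) (H := m) (n := n)
    (p := p) (b := b) ha hG
    (by rw [hcell]; rfl) (by rw [hcell]; rfl) (by rw [hcell]; rfl) (by rw [hcell]; rfl)
    (entryFn Z) (fun x _ => hentry x) (fun x _ => by rw [← hentry x]; congr 1)
  obtain ⟨R₁, H₁, hB₁, ⟨hA₁, hin₁⟩, he₁⟩ := hrun hκ
    ⟨fun i => by rw [hm]; exact hB i, fun z => by rw [hm]; exact hB z⟩
  have hA₁' : AgreeTo 6 (params k n p a b) (fun i => layout 9 R₁ H₁ i) := fun i hi => by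
    exact (layout_reg (by omega) R₁ H₁).trans (hA₁ i hi)
  obtain ⟨R₂, H₂, hB₂, ⟨hA₂, h30, h31, rfl⟩, he₂⟩ := runs_setupCode (O := O) (κ := κ) hn hb hG hA₁'
    hκ (hB₁.layout 9)
  refine ⟨R₂, layout 9 R₁ H₁, hB₂, hA₂, h30, h31, fun x hx => ?_, fun fuel hfuel => ?_⟩
  · rw [layout_heap (by left; omega)]
    exact hin₁ x hx
  · rw [Nat.add_mul] at hfuel
    obtain ⟨t₁, ht₁, h1⟩ := he₁ fuel 0 (by omega)
    obtain ⟨t₂, ht₂, h2⟩ := he₂ fuel (0 + t₁) (by omega)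
    refine ⟨0 + t₁ + t₂, by rw [Nat.add_mul]; omega, fun l => ?_⟩
    rw [layout_self] at h1 h2
    have h0 : initial (gpeInput p a b Z) = ⟨m, 0⟩ := by rw [hm]; rfl
    rw [h0, evalList_append, h1, PMF.pure_bind]
    simp only []
    rw [evalList_append, h2, PMF.pure_bind]

/-- Before and after the coin loop the program is deterministic, so the final law is the image of
the uniform law on bit strings. Nothing is assumed about the oracle here; its answers enter only
after saturation. -/
theorem eval_program {Z : Fin n → Fin n → ℤ × ℤ} (hn : 0 < n) (ha : 0 < a) (hb : 0 < b)
    (hG : paramBound k n p a b < 2 ^ Λ) (hV : valueBound k n p b < 2 ^ Λ)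
    (hlim : answerBits k n p b < Λ)
    (hκ : 1 + 3 * Λ + queryLength k n + queryLength k n * Λ + answerBits k n p b ≤ κ)
    (hB : ∀ z, |(initial (gpeInput p a b Z)).mem z| < 2 ^ Λ) {fuel : ℕ}
    (hfuel : stepBound k n p b * κ < fuel) :
    ∃ cfg : (Fin (coinCount k n p b) → Bool) → Config,
      eval O fuel (program k) (initial (gpeInput p a b Z))
        = (PMF.uniformOfFintype (Fin (coinCount k n p b) → Bool)).map (fun ω => some (cfg ω)) ∧
      ∀ ω, (cfg ω).time ≤ stepBound k n p b * κ ∧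
        (cfg ω).output = estimate k n p b fun j =>
          saturate (answerBits k n p b) (nodeAnswer O k p a b Z ω j) := by
  have hκ' : 1 + 3 * Λ ≤ κ := by omega
  have hf := Nat.zero_le (2 ^ fineBits p b)
  have hGT : 100 + coinCount k n p b + queryLength k n + 2 * n * k ≤ paramBound k n p a b := by
    rw [paramBound]; omega
  obtain ⟨N₁, hN₁⟩ : ∃ N, N = (12 * n ^ 2 + 40) + (5 * n + 4 * b + 3 * k + 3 * p + 92) := ⟨_, rfl⟩
  obtain ⟨N₂, hN₂⟩ : ∃ N, N = (2 * n * k * (10 * (fineBits p b + 2 * coarseBits k n) + 11) + 4) +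
    ((k + 1) * (10 * k + n * (12 * n + 14 * k + 6) + 43) + 4 * k + 13) := ⟨_, rfl⟩
  have hstep : stepBound k n p b * κ = N₁ * κ + N₂ * κ + (5 * coinCount k n p b + 1) * κ + 3 * κ := by
    rw [stepBound, ← hN₁, ← hN₂]; ring
  have hTκ : coinCount k n p b ≤ (5 * coinCount k n p b + 1) * κ :=
    le_trans (by omega) (Nat.le_mul_of_pos_right _ (by omega))
  obtain ⟨R, H, hBd, hA, h30, h31, hin, hev⟩ := exists_setup (O := O) (k := k) hn ha hb hκ' hG hB
  rw [← hN₁] at hev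
  obtain ⟨t₁, ht₁, hev⟩ := hev fuel (by omega)
  obtain ⟨R', H', t₂, hcoin, hpost⟩ := iterate_coinBody (O := O) rfl hκ' (by omega)
    (coinCount k n p b) _ R H (by omega)
    (by
      have : 64 + queryLength k n + 2 * n * k + coinCount k n p b < 2 ^ Λ := by omega
      exact_mod_cast this) hBd hA h30 h31 fuel t₁ fuel (by omega) (by omega)
  have hrest : ∀ ω, ∃ s : Config, (s.time ≤ stepBound k n p b * κ ∧
      s.output = estimate k n p b fun j =>
        saturate (answerBits k n p b) (nodeAnswer O k p a b Z ω j)) ∧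
      evalList O fuel (sampleCode ++ estimateCode k) ⟨layout 64 (R' ω) (H' ω), t₁ + t₂ ω⟩
        = PMF.pure (some s) := by
    intro ω
    obtain ⟨ht₂, hB', hA', hbits, hold⟩ := hpost ω
    have hrun : Runs O Λ κ 64 (sampleCode ++ estimateCode k) (R' ω) (H' ω) N₂ fun R' _ =>
        (R' 0 : ℝ) / (R' 1 : ℝ) = estimate k n p b fun j =>
          saturate (answerBits k n p b) (nodeAnswer O k p a b Z ω j) := by
      rw [hN₂, add_comm]
      refine Runs.append (runs_sampleCode hG hA' (bitVal_nonneg ω) (bitVal_le_one ω) hbits) ?_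
      rintro R'' H'' - ⟨hA'', hs, hlow⟩
      refine runs_estimateCode rfl hn ha hG hV hlim hκ hA'' ⟨fun x hx => ?_, hs⟩
      rw [hlow _ (by omega), hold _ (by omega)]
      exact hin x hx
    obtain ⟨R₃, H₃, -, hout, he⟩ := hrun hκ' hB'
    obtain ⟨t₃, ht₃, h3⟩ := he fuel (t₁ + t₂ ω) (by omega)
    refine ⟨_, ⟨?_, ?_⟩, h3⟩
    · show t₁ + t₂ ω + t₃ ≤ _
      omega
    · rw [← hout, Config.output]
      congr 2
  choose cfg hcfg hlaw using hrest
  refine ⟨cfg, ?_, hcfg⟩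
  rw [program, eval_block _ _ _ (by simp [inputCode]), hev, evalList_append,
    ← eval_block _ _ _ (by simp), block, eval, hcoin, PMF.bind_map]
  rw [PMF.map]
  congr 1
  funext ω
  simp only [Function.comp]
  exact hlaw ω

end

/-! ### Polynomial bounds -/

section

variable {k n p a b U : ℕ}

theorem two_pow_size_le {b : ℕ} (hb : 0 < b) : 2 ^ Nat.size b ≤ 2 * b := by
  obtain ⟨s, hs⟩ : ∃ s, Nat.size b = s + 1 :=
    ⟨Nat.size b - 1, by have := Nat.size_pos.2 hb; omega⟩
  have : 2 ^ s ≤ b := Nat.lt_size.1 (by omega)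
  rw [hs, pow_succ]
  omega

theorem succ_le_slack (k : ℕ) : 20 * (k + 1) ≤ slack k := by
  rw [slack]
  exact Nat.mul_le_mul_left _ (Nat.le_self_pow (by norm_num) _)

/-- Numerical constants are absorbed by an additional power of U, which is possible because `slack`
makes U at least 20. -/
theorem mul_pow_le_pow {c U : ℕ} (hc : c ≤ U) (i : ℕ) : c * U ^ i ≤ U ^ (i + 1) := by
  rw [pow_succ, mul_comm]
  exact Nat.mul_le_mul_left _ hc

theorem gridRoot_le_pow (hU : n + p + a + b + slack k ≤ U) : gridRoot k n ≤ U ^ 2 := by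
  have h1 := Nat.sqrt_le_self n
  have h2 := slack_ge k
  rw [gridRoot, pow_two]
  exact Nat.mul_le_mul (by omega) (by omega)

theorem nodeBase_le_pow (hb : 0 < b) (hU : n + p + a + b + slack k ≤ U) :
    nodeBase k n b ≤ U ^ 4 := by
  have h1 := gridRoot_le_pow hU
  have h2 := two_pow_size_le hb
  have h3 := slack_ge k
  have h4 : 2 ^ Nat.size b ≤ U ^ 2 := by
    rw [pow_two]
    exact h2.trans (Nat.mul_le_mul (by omega) (by omega))
  calc nodeBase k n b ≤ U ^ 2 * U ^ 2 := Nat.mul_le_mul h1 h4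
    _ = U ^ 4 := by ring

theorem coarseBits_le_pow (hU : n + p + a + b + slack k ≤ U) : coarseBits k n ≤ U ^ 8 := by
  have h1 := gridRoot_le_pow hU
  have h2 := coarseBits_add k n
  calc coarseBits k n ≤ (gridRoot k n ^ 2) ^ 2 := by omega
    _ ≤ ((U ^ 2) ^ 2) ^ 2 := by gcongr
    _ = U ^ 8 := by ring

theorem fineBits_le (hU : n + p + a + b + slack k ≤ U) : fineBits p b ≤ U := by
  have : Nat.size b ≤ b := Nat.size_le.2 Nat.lt_two_pow_self
  rw [fineBits]
  omega

theorem coin_factor_le (hU : n + p + a + b + slack k ≤ U) :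
    fineBits p b + 2 * coarseBits k n ≤ U ^ 9 := by
  have h1 := fineBits_le hU
  have h2 := coarseBits_le_pow hU
  have h3 := slack_ge k
  have h4 : U ≤ U ^ 8 := Nat.le_self_pow (by norm_num) _
  have h5 : 3 * U ^ 8 ≤ U ^ 9 := mul_pow_le_pow (by omega) 8
  omega

theorem two_mul_mul_le (hU : n + p + a + b + slack k ≤ U) : 2 * n * k ≤ U ^ 3 := by
  have h3 := succ_le_slack k
  calc 2 * n * k ≤ U * U * U := by
        refine Nat.mul_le_mul (Nat.mul_le_mul ?_ ?_) ?_ <;> omega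
    _ = U ^ 3 := by ring

theorem coinCount_le_pow (hU : n + p + a + b + slack k ≤ U) : coinCount k n p b ≤ U ^ 12 := by
  calc coinCount k n p b = 2 * n * k * (fineBits p b + 2 * coarseBits k n) := by
        rw [coinCount]; ring
    _ ≤ U ^ 3 * U ^ 9 := Nat.mul_le_mul (two_mul_mul_le hU) (coin_factor_le hU)
    _ = U ^ 12 := by ring

theorem queryLength_le_pow (hU : n + p + a + b + slack k ≤ U) : queryLength k n ≤ U ^ 3 := by
  have h3 := succ_le_slack k
  have h4 : n * (n + k) ≤ U ^ 2 := by
    rw [pow_two]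
    exact Nat.mul_le_mul (by omega) (by omega)
  have h5 : 7 * U ^ 2 ≤ U ^ 3 := mul_pow_le_pow (by omega) 2
  have h6 : 1 ≤ U ^ 2 := Nat.one_le_pow _ _ (by omega)
  rw [queryLength, mul_assoc]
  omega

theorem answerBits_le_pow (hU : n + p + a + b + slack k ≤ U) : answerBits k n p b ≤ U ^ 5 := by
  have h3 := slack_ge k
  have h2 : slack k ^ 2 ≤ U ^ 2 := Nat.pow_le_pow_left (by omega) 2
  have h1 : U ≤ U ^ 2 := Nat.le_self_pow (by norm_num) _
  have h4 : n * (8 * slack k ^ 2 + 2 * n + b) ≤ U * (11 * U ^ 2) :=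
    Nat.mul_le_mul (by omega) (by omega)
  have h5 : U * (11 * U ^ 2) = 11 * U ^ 3 := by ring
  have h6 : U ^ 2 ≤ U ^ 3 := Nat.pow_le_pow_right (by omega) (by norm_num)
  have h7 : 20 * U ^ 3 ≤ U ^ 4 := mul_pow_le_pow (by omega) 3
  have h8 : 20 * U ^ 4 ≤ U ^ 5 := mul_pow_le_pow (by omega) 4
  rw [answerBits, mul_assoc]
  omega

theorem stepBound_le_pow (hU : n + p + a + b + slack k ≤ U) : stepBound k n p b ≤ U ^ 16 := by
  have h3 := succ_le_slack k
  have hT := coinCount_le_pow hU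
  have hc := coin_factor_le hU
  have hn2 : n ^ 2 ≤ U ^ 2 := Nat.pow_le_pow_left (by omega) 2
  have hp : ∀ i, 20 * U ^ i ≤ U ^ (i + 1) := mul_pow_le_pow (by omega)
  have h0 := hp 0
  have h1 := hp 1
  have h2 := hp 2
  have h4 := hp 3
  have h5 := hp 4
  have h9 := hp 9
  have h13 := hp 13
  have h14 := hp 14
  have h15 := hp 15
  have h512 : U ^ 5 ≤ U ^ 12 := Nat.pow_le_pow_right (by omega) (by norm_num)
  have h312 : U ^ 12 ≤ U ^ 13 := Nat.pow_le_pow_right (by omega) (by norm_num)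
  norm_num at h0 h1 h2 h4 h5 h9 h13 h14 h15
  have hs : 2 * n * k * (10 * (fineBits p b + 2 * coarseBits k n) + 11) ≤ U ^ 3 * U ^ 10 :=
    Nat.mul_le_mul (two_mul_mul_le hU) (by
      have : 1 ≤ U ^ 9 := Nat.one_le_pow _ _ (by omega)
      have : 2 ≤ U ^ 9 := by
        calc 2 ≤ U := by omega
          _ ≤ U ^ 9 := Nat.le_self_pow (by norm_num) _
      omega)
  have hs' : U ^ 3 * U ^ 10 = U ^ 13 := by ring
  have he1 : n * (12 * n + 14 * k + 6) ≤ U * U ^ 2 := Nat.mul_le_mul (by omega) (by omega)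
  have he1' : U * U ^ 2 = U ^ 3 := by ring
  have he2 : (k + 1) * (10 * k + n * (12 * n + 14 * k + 6) + 43) ≤ U * U ^ 4 :=
    Nat.mul_le_mul (by omega) (by omega)
  have he2' : U * U ^ 4 = U ^ 5 := by ring
  rw [stepBound]
  omega

theorem queryError_le_pow (hb : 0 < b) (hU : n + p + a + b + slack k ≤ U) :
    queryError k n a b ≤ U ^ (6 * k + 2) := by
  have h3 := succ_le_slack k
  have hM := nodeBase_le_pow hb hU
  have h4 : 2 * U ^ 4 ≤ U ^ 5 := mul_pow_le_pow (by omega) 4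
  have h5 : 2 * nodeBase k n b ≤ U ^ 5 := by omega
  calc queryError k n a b ≤ U * U * (U ^ 5) ^ k * U ^ k := by
        rw [queryError]
        refine Nat.mul_le_mul (Nat.mul_le_mul (Nat.mul_le_mul (by omega) (by omega))
          (Nat.pow_le_pow_left h5 k)) (Nat.pow_le_pow_left (by omega) k)
    _ = U ^ (6 * k + 2) := by rw [← pow_mul]; ring

theorem paramBound_le (hb : 0 < b) (hU : n + p + a + b + slack k ≤ U) :
    paramBound k n p a b ≤ U ^ (6 * k + 14) * 2 ^ U := by
  have h3 := succ_le_slack k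
  have h2U : 1 ≤ 2 ^ U := Nat.one_le_two_pow
  -- W dominates each summand of `paramBound` up to a numerical coefficient; the factor U² ≥ 400 in
  -- the final bound absorbs the sum of these coefficients.
  obtain ⟨W, hW⟩ : ∃ W, W = U ^ (6 * k + 12) * 2 ^ U := ⟨_, rfl⟩
  have hi : ∀ i ≤ 6 * k + 12, U ^ i ≤ W := fun i hi => by
    rw [hW]
    exact (Nat.pow_le_pow_right (by omega) hi).trans (Nat.le_mul_of_pos_right _ h2U)
  have hi0 := hi 0 (by omega)
  have hi1 := hi 1 (by omega)
  have hi2 := hi 2 (by omega)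
  have hi3 := hi 3 (by omega)
  have hi5 := hi 5 (by omega)
  have hi6 := hi 6 (by omega)
  have hi8 := hi 8 (by omega)
  have hi10 := hi 10 (by omega)
  have hi12 := hi 12 (by omega)
  have hm := (queryError_le_pow hb hU).trans (hi _ (by omega))
  have hT := (coinCount_le_pow hU).trans hi12
  have hq := (queryLength_le_pow hU).trans hi3
  have hl := (answerBits_le_pow hU).trans hi5
  have hM := nodeBase_le_pow hb hU
  have hM' := hM.trans (hi 4 (by omega))
  have hL : gridRoot k n ^ 2 ^ 2 ≤ W := by
    refine le_trans ?_ hi8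
    calc gridRoot k n ^ 2 ^ 2 ≤ (U ^ 2) ^ 2 ^ 2 := Nat.pow_le_pow_left (gridRoot_le_pow hU) _
      _ = U ^ 8 := by ring
  have hn2 : n ^ 2 ≤ W := (Nat.pow_le_pow_left (by omega) 2).trans hi2
  have hs2 : slack k ^ 2 ≤ W := (Nat.pow_le_pow_left (by omega) 2).trans hi2
  have hkn : k * n ≤ W := by
    refine le_trans ?_ hi2
    rw [pow_two]
    exact Nat.mul_le_mul (by omega) (by omega)
  have hak : a * (k + 1) ≤ W := by
    refine le_trans ?_ hi2
    rw [pow_two]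
    exact Nat.mul_le_mul (by omega) (by omega)
  have hd : queryFailure k b ≤ 72 * W := by
    have : (k + 1) * b ≤ U ^ 2 := by
      rw [pow_two]
      exact Nat.mul_le_mul (by omega) (by omega)
    rw [queryFailure, mul_assoc]
    omega
  have hfp : 2 ^ fineBits p b ≤ 2 ^ U := Nat.pow_le_pow_right (by norm_num) (fineBits_le hU)
  have hfW : 2 ^ U ≤ W := by
    rw [hW]
    exact Nat.le_mul_of_pos_left _ (by have : 0 < U := by omega
                                       positivity)
  have hMn : 2 * nodeBase k n b * (n + k) ≤ W := by
    refine le_trans ?_ hi6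
    calc 2 * nodeBase k n b * (n + k) ≤ U * U ^ 4 * U :=
          Nat.mul_le_mul (Nat.mul_le_mul (by omega) hM) (by omega)
      _ = U ^ 6 := by ring
  have hc := (coin_factor_le hU).trans (hi 9 (by omega))
  have hN : 2 * (coarseBits k n + 1) * 2 ^ fineBits p b ≤ W := by
    rw [hW]
    refine Nat.mul_le_mul ?_ hfp
    have h1 := coarseBits_le_pow hU
    have h2 : 4 * U ^ 8 ≤ U ^ 9 := mul_pow_le_pow (by omega) 8
    have h4 : 1 ≤ U ^ 8 := Nat.one_le_pow _ _ (by omega)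
    exact (show 2 * (coarseBits k n + 1) ≤ U ^ 9 by omega).trans
      (Nat.pow_le_pow_right (by omega) (by omega))
  have hnk := (two_mul_mul_le hU).trans hi3
  have hlast : 400 * W ≤ U ^ (6 * k + 14) * 2 ^ U := by
    calc 400 * W ≤ U ^ 2 * W := Nat.mul_le_mul_right _ (by nlinarith)
      _ = _ := by rw [hW]; ring
  rw [pow_zero] at hi0
  rw [pow_one] at hi1
  have h2q := Nat.zero_le (2 ^ fineBits p b)
  refine le_trans ?_ hlast
  rw [paramBound]
  omega

/-- The factor 2^(U^5) comes from the oracle's answers. For fixed k the logarithm of the bound is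
polynomial in U, and this is what makes the number of digits polynomial. -/
theorem valueBound_le (hn : 0 < n) (hb : 0 < b) (hU : n + p + a + b + slack k ≤ U) :
    valueBound k n p b ≤ U ^ (1 + 10 * (k + 1) * (k + 2) + 2 * k) * 2 ^ (U ^ 5 + U) := by
  have h3 := succ_le_slack k
  have hM := nodeBase_le_pow hb hU
  have hMk : nodeBase k n b + k ≤ U ^ 5 := by
    have h1 : U ≤ U ^ 4 := Nat.le_self_pow (by norm_num) _
    have h2 : 2 * U ^ 4 ≤ U ^ 5 := mul_pow_le_pow (by omega) 4
    omega
  have hfac : k.factorial ≤ U ^ k :=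
    (Nat.factorial_le_pow k).trans (Nat.pow_le_pow_left (by omega) k)
  calc valueBound k n p b ≤ U * 2 ^ U ^ 5 * (((U ^ 5) ^ 2) ^ (k + 1)) ^ (k + 2) * U ^ k * U ^ k *
        2 ^ U := by
        rw [valueBound]
        gcongr
        · omega
        · norm_num
        · exact answerBits_le_pow hU
        · omega
        · norm_num
        · omega
    _ = _ := by
        rw [← pow_mul, ← pow_mul, ← pow_mul, pow_add 2]
        ring

/-- A polynomial bound for the number of digits of all numbers that occur. -/
def digitBound (k U : ℕ) : ℕ := U ^ 5 * (20 * (k + 2) ^ 2 + 60)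

/-- A polynomial bound for the time of a single step. -/
def stepCost (k U : ℕ) : ℕ := 1 + 3 * digitBound k U + U ^ 3 + U ^ 3 * digitBound k U + U ^ 5

/-- The crude estimate U ≤ 2^U charges a power U^e as U · e binary digits. -/
theorem pow_mul_two_pow_lt {U e f Λ : ℕ} (h : U * e + f < Λ) : U ^ e * 2 ^ f < 2 ^ Λ := by
  calc U ^ e * 2 ^ f ≤ (2 ^ U) ^ e * 2 ^ f :=
        Nat.mul_le_mul_right _ (Nat.pow_le_pow_left Nat.lt_two_pow_self.le e)
    _ = 2 ^ (U * e + f) := by rw [← pow_mul, ← pow_add]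
    _ < 2 ^ Λ := Nat.pow_lt_pow_right (by norm_num) h

theorem paramBound_lt (hb : 0 < b) (hU : n + p + a + b + slack k ≤ U) :
    paramBound k n p a b < 2 ^ digitBound k U := by
  refine (paramBound_le hb hU).trans_lt (pow_mul_two_pow_lt ?_)
  have h3 := slack_ge k
  calc U * (6 * k + 14) + U = U * (6 * k + 15) := by ring
    _ < U * (20 * (k + 2) ^ 2 + 60) := Nat.mul_lt_mul_of_pos_left (by nlinarith) (by omega)
    _ ≤ digitBound k U := Nat.mul_le_mul_right _ (Nat.le_self_pow (by norm_num) _)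

theorem valueBound_lt (hn : 0 < n) (hb : 0 < b) (hU : n + p + a + b + slack k ≤ U) :
    valueBound k n p b < 2 ^ digitBound k U := by
  refine (valueBound_le hn hb hU).trans_lt (pow_mul_two_pow_lt ?_)
  have h3 := slack_ge k
  have h1 : U ≤ U ^ 5 := Nat.le_self_pow (by norm_num) _
  calc U * (1 + 10 * (k + 1) * (k + 2) + 2 * k) + (U ^ 5 + U)
      ≤ U ^ 5 * (1 + 10 * (k + 1) * (k + 2) + 2 * k) + (U ^ 5 + U ^ 5) := by gcongr
    _ = U ^ 5 * (3 + 10 * (k + 1) * (k + 2) + 2 * k) := by ring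
    _ < digitBound k U := Nat.mul_lt_mul_of_pos_left (by nlinarith) (by omega)

theorem answerBits_lt (hU : n + p + a + b + slack k ≤ U) :
    answerBits k n p b < digitBound k U := by
  have h3 := slack_ge k
  have h1 : U ≤ U ^ 5 := Nat.le_self_pow (by norm_num) _
  refine (answerBits_le_pow hU).trans_lt ?_
  rw [digitBound]
  exact (Nat.lt_mul_iff_one_lt_right (by omega)).2 (by nlinarith)

theorem le_stepCost (hU : n + p + a + b + slack k ≤ U) :
    1 + 3 * digitBound k U + queryLength k n + queryLength k n * digitBound k U +
      answerBits k n p b ≤ stepCost k U := by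
  have h1 := queryLength_le_pow hU
  have h2 := answerBits_le_pow hU
  rw [stepCost]
  gcongr

theorem bitLen_natCast_le (n : ℕ) : bitLen (n : ℤ) ≤ n := by
  rw [bitLen, Int.natAbs_natCast]
  exact Nat.size_le.2 Nat.lt_two_pow_self

theorem bitLen_le_of_mem {L : List ℤ} {v : ℤ} (h : v ∈ L) : bitLen v ≤ bitLenList L :=
  List.le_sum_of_mem (List.mem_map_of_mem h)

theorem abs_lt_two_pow_bitLen (v : ℤ) : |v| < 2 ^ bitLen v := by
  have := Nat.lt_size_self v.natAbs
  zify at this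
  exact this

theorem abs_initial_lt {Z : Fin n → Fin n → ℤ × ℤ} {Λ : ℕ} (h : gpeSize p a b Z ≤ Λ) (z : ℤ) :
    |(initial (gpeInput p a b Z)).mem z| < 2 ^ Λ := by
  have key : ∀ v ∈ gpeInput p a b Z, |v| < 2 ^ Λ := by
    intro v hv
    refine (abs_lt_two_pow_bitLen v).trans_le (pow_le_pow_right₀ (by norm_num) ?_)
    rw [gpeSize] at h
    simp only [gpeInput, List.mem_append, List.mem_cons, List.not_mem_nil, or_false] at hv
    rcases hv with (rfl | rfl | rfl | rfl) | hv
    · have := bitLen_natCast_le n; omega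
    · have := bitLen_natCast_le p; omega
    · have := bitLen_natCast_le a; omega
    · have := bitLen_natCast_le b; omega
    · have := bitLen_le_of_mem hv; omega
  have h0 : |(0 : ℤ)| < 2 ^ Λ := by simp
  simp only [initial]
  split_ifs
  · rw [List.getD_eq_getElem?_getD]
    rcases h' : (gpeInput p a b Z)[z.toNat]? with _ | v
    · simp
    · exact key v (List.mem_of_getElem? h')
  · exact h0

end

/-! ### Correctness and running time of the reduction -/

/-- `eval_program` with polynomial bounds. -/
theorem eval_program_of_size_le (O : Oracle) {k n p a b U : ℕ} {Z : Fin n → Fin n → ℤ × ℤ}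
    (hn : 0 < n) (ha : 0 < a) (hb : 0 < b) (hU : gpeSize p a b Z + slack k = U) {fuel : ℕ}
    (hfuel : U ^ 16 * stepCost k U < fuel) :
    ∃ cfg : (Fin (coinCount k n p b) → Bool) → Config,
      eval O fuel (program k) (initial (gpeInput p a b Z))
        = (PMF.uniformOfFintype (Fin (coinCount k n p b) → Bool)).map (fun ω => some (cfg ω)) ∧
      ∀ ω, (cfg ω).time ≤ U ^ 16 * stepCost k U ∧
        (cfg ω).output = estimate k n p b fun j =>
          saturate (answerBits k n p b) (nodeAnswer O k p a b Z ω j) := by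
  have hU' : n + p + a + b + slack k ≤ U := by rw [gpeSize] at hU; omega
  have h1 : gpeSize p a b Z ≤ digitBound k U := by
    have h2 : U ≤ U ^ 5 := Nat.le_self_pow (by norm_num) _
    have h3 : U ^ 5 ≤ digitBound k U := Nat.le_mul_of_pos_right _ (by positivity)
    omega
  have hle := Nat.mul_le_mul_right (stepCost k U) (stepBound_le_pow hU')
  obtain ⟨cfg, h, hcfg⟩ := eval_program (O := O) hn ha hb (paramBound_lt hb hU')
    (valueBound_lt hn hb hU') (answerBits_lt hU') (le_stepCost hU') (abs_initial_lt h1)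
    (hle.trans_lt hfuel)
  exact ⟨cfg, h, fun ω => ⟨(hcfg ω).1.trans hle, (hcfg ω).2⟩⟩

/-- The time bound holds for every oracle, since saturation limits all answers to a polynomial
number of bits; the degree may depend on k. -/
theorem polyTime_program (k : ℕ) : PolyTime (program k) := by
  obtain ⟨V, hV⟩ : ∃ V : Polynomial ℕ, V = Polynomial.X + Polynomial.C (slack k) := ⟨_, rfl⟩
  obtain ⟨D, hD⟩ : ∃ D : Polynomial ℕ, D = V ^ 5 * Polynomial.C (20 * (k + 2) ^ 2 + 60) := ⟨_, rfl⟩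
  refine ⟨V ^ 16 * (1 + 3 * D + V ^ 3 + V ^ 3 * D + V ^ 5), fun O n p a b hn ha hb Z => ?_⟩
  have hVe : ∀ z, V.eval z = z + slack k := fun z => by rw [hV]; simp
  have hDe : ∀ z, D.eval z = digitBound k (z + slack k) := fun z => by
    rw [hD, Polynomial.eval_mul, Polynomial.eval_pow, hVe, Polynomial.eval_C, digitBound]
  have heval : ∀ z, (V ^ 16 * (1 + 3 * D + V ^ 3 + V ^ 3 * D + V ^ 5)).eval z
      = (z + slack k) ^ 16 * stepCost k (z + slack k) := fun z => by
    simp only [Polynomial.eval_mul, Polynomial.eval_add, Polynomial.eval_pow, Polynomial.eval_one,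
      Polynomial.eval_ofNat, hVe, hDe, stepCost]
  rw [heval]
  intro o ho
  obtain ⟨cfg, h, hcfg⟩ := eval_program_of_size_le O (k := k) (Z := Z) (p := p) hn ha hb rfl
    (Nat.lt_succ_self _)
  rw [h, PMF.mem_support_map_iff] at ho
  obtain ⟨ω, -, rfl⟩ := ho
  exact ⟨cfg ω, rfl, (hcfg ω).1⟩

theorem two_thirds_le_div {c T : ℕ} (h : 2 * 2 ^ T ≤ 3 * c) :
    (2 / 3 : ℝ≥0∞) ≤ (c : ℝ≥0∞) / 2 ^ T := by
  have h' : (2 : ℝ≥0∞) * 2 ^ T ≤ 3 * c := by exact_mod_cast h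
  rw [ENNReal.le_div_iff_mul_le (by simp) (by simp), mul_comm, ← mul_div_assoc,
    ENNReal.div_le_iff_le_mul (by simp) (by simp), mul_comm, mul_comm _ (3 : ℝ≥0∞)]
  exact h'

/-- On good coins no answer is saturated, so the output is the estimate itself. A single fuel value
above the time bound already accounts for the supremum from below. -/
theorem two_thirds_le_outputProb {O : Oracle} {k n p a b : ℕ} {X : Fin n → Fin n → ℂ}
    (hn : 0 < n) (ha : 0 < a) (hb : 0 < b)
    (h : 2 * 2 ^ coinCount k n p b
      ≤ 3 * Nat.card {ω : Fin (coinCount k n p b) → Bool // GoodCoins O k p a b X ω}) :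
    2 / 3 ≤ outputProb (program k) O (gpeInput p a b (roundMatrix p X))
      {y | |y - perSq X| ≤ 1 / (a : ℝ) * (n.factorial : ℝ)} := by
  classical
  obtain ⟨cfg, heval, hcfg⟩ := eval_program_of_size_le O (k := k) (Z := roundMatrix p X) (p := p)
    hn ha hb rfl (Nat.lt_succ_self _)
  refine le_trans ?_ (le_iSup _ ((gpeSize p a b (roundMatrix p X) + slack k) ^ 16 *
    stepCost k (gpeSize p a b (roundMatrix p X) + slack k) + 1))
  rw [heval, PMF.toOuterMeasure_map_apply]
  have hsub : {ω | GoodCoins O k p a b X ω} ⊆ (fun ω => some (cfg ω)) ⁻¹'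
      {o | ∃ s : Config, o = some s ∧
        s.output ∈ {y | |y - perSq X| ≤ 1 / (a : ℝ) * (n.factorial : ℝ)}} := by
    rintro ω ⟨hsmall, hgood⟩
    refine ⟨cfg ω, rfl, ?_⟩
    have hsat : estimate k n p b (fun j =>
        saturate (answerBits k n p b) (nodeAnswer O k p a b (roundMatrix p X) ω j))
        = estimate k n p b (nodeAnswer O k p a b (roundMatrix p X) ω) := by
      rw [estimate, estimate]
      congr 1
      refine Finset.sum_congr rfl fun j hj => ?_
      rw [saturate_of_abs_le (hsmall j (by have := Finset.mem_range.1 hj; omega))]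
    show |(cfg ω).output - perSq X| ≤ _
    rw [(hcfg ω).2, hsat]
    exact hgood
  refine le_trans ?_ (MeasureTheory.measure_mono hsub)
  rw [PMF.toOuterMeasure_uniformOfFintype_apply]
  refine (two_thirds_le_div h).trans_eq ?_
  rw [Nat.card_eq_fintype_card]
  congr 1
  simp

theorem solvesGPE_program {O : Oracle} {k n p a b : ℕ} (hn : 0 < n) (ha : 0 < a) (hb : 0 < b)
    (hO : SolvesSigmaGPE O k n p (queryError k n a b) (queryFailure k b)) :
    SolvesGPE (program k) O n p a b :=
  (many_goodCoins hn ha hb hO).trans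
    (measure_mono fun _ hX => two_thirds_le_outputProb hn ha hb hX)

/-! ### The error bound -/

/-- Both roundings cost a factor 2: √n + 1 ≤ 2√n, as n ≥ 1, and 2^(size b) ≤ 2b. -/
theorem two_mul_nodeBase_le {k n b : ℕ} (hn : 0 < n) (hb : 0 < b) :
    (2 * nodeBase k n b : ℝ) ≤ 8 * slack k * b * √n := by
  have h1 : (2 ^ Nat.size b : ℝ) ≤ 2 * b := by exact_mod_cast two_pow_size_le hb
  have h2 : (Nat.sqrt n : ℝ) ≤ √n := Real.nat_sqrt_le_real_sqrt
  have h3 : (1 : ℝ) ≤ √n := Real.one_le_sqrt.2 (by exact_mod_cast hn)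
  rw [nodeBase, gridRoot]
  push_cast
  calc 2 * (slack k * ((Nat.sqrt n : ℝ) + 1) * 2 ^ Nat.size b)
      ≤ 2 * (slack k * (√n + √n) * (2 * b)) := by gcongr
    _ = _ := by ring

/-- Since 1/b ≤ 1, the exponent k + 1/2 of δ may be lowered to k: the reduction is slightly better
than the rate asked for. -/
theorem errorRate_le {k n a b : ℕ} (hb : 0 < b) :
    errorRate k n (1 / (a : ℝ)) (1 / (b : ℝ)) ≤
      (k : ℝ) ^ ((k : ℝ) / 2) / (a * (b : ℝ) ^ k * √n ^ k * ((n : ℝ) + k) ^ k) := by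
  have hb' : (1 : ℝ) ≤ b := by exact_mod_cast hb
  have h1 : (1 / (b : ℝ)) ^ ((k : ℝ) + 1 / 2) ≤ (1 / (b : ℝ)) ^ k := by
    rw [← Real.rpow_natCast (1 / (b : ℝ)) k]
    exact Real.rpow_le_rpow_of_exponent_ge (by positivity)
      ((div_le_one (by positivity)).2 hb') (by linarith)
  have h2 : (n : ℝ) ^ ((k : ℝ) / 2) = √n ^ k := by
    rw [Real.sqrt_eq_rpow, ← Real.rpow_natCast ((n : ℝ) ^ (1 / 2 : ℝ)) k,
      ← Real.rpow_mul (by positivity)]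
    congr 1; ring
  rw [errorRate, h2]
  calc 1 / (a : ℝ) * (1 / (b : ℝ)) ^ ((k : ℝ) + 1 / 2) * (k : ℝ) ^ ((k : ℝ) / 2) /
        (√n ^ k * ((n : ℝ) + k) ^ k)
      ≤ 1 / (a : ℝ) * (1 / (b : ℝ)) ^ k * (k : ℝ) ^ ((k : ℝ) / 2) /
        (√n ^ k * ((n : ℝ) + k) ^ k) := by gcongr
    _ = _ := by rw [div_pow, one_pow]; field_simp

/-- The constant in the lower bound for the error with which the oracle is called. -/
noncomputable def errorConstant (k : ℕ) : ℝ :=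
  1 / ((k + 1) * (8 * slack k) ^ k * (k : ℝ) ^ ((k : ℝ) / 2))

/-- At k = 0 this relies on 0^0 = 1. -/
theorem self_rpow_pos (k : ℕ) : 0 < (k : ℝ) ^ ((k : ℝ) / 2) := by
  rcases Nat.eq_zero_or_pos k with rfl | hk
  · simp
  · positivity

theorem errorConstant_pos (k : ℕ) : 0 < errorConstant k := by
  have h1 := self_rpow_pos k
  have h2 : (0 : ℝ) < slack k := by
    have := slack_ge k
    exact_mod_cast (by omega : 0 < slack k)
  rw [errorConstant]
  positivity

theorem queryError_pos {k n a b : ℕ} (hn : 0 < n) (ha : 0 < a) : 0 < queryError k n a b := by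
  have : 0 < nodeBase k n b := (Nat.zero_le _).trans_lt (lt_nodeBase k n b)
  rw [queryError]
  positivity

/-- `errorConstant` is chosen so that the factors k^(k/2) cancel and the numerical factors of the
upper bound for `queryError` remain. -/
theorem errorConstant_mul_le {k n a b : ℕ} (hn : 0 < n) (ha : 0 < a) (hb : 0 < b) :
    errorConstant k * errorRate k n (1 / (a : ℝ)) (1 / (b : ℝ)) ≤ 1 / (queryError k n a b : ℝ) := by
  have hk := self_rpow_pos k
  have hs : (0 : ℝ) < slack k := by
    have := slack_ge k
    exact_mod_cast (by omega : 0 < slack k)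
  have hn' : (0 : ℝ) < n := by exact_mod_cast hn
  have ha' : (0 : ℝ) < a := by exact_mod_cast ha
  have hb' : (0 : ℝ) < b := by exact_mod_cast hb
  have hn2 : 0 < √(n : ℝ) := Real.sqrt_pos.2 hn'
  have hq : (0 : ℝ) < queryError k n a b := by exact_mod_cast queryError_pos hn ha
  have hqe : (queryError k n a b : ℝ)
      ≤ a * (k + 1) * (8 * slack k * b * √n) ^ k * ((n : ℝ) + k) ^ k := by
    rw [queryError]
    push_cast
    exact mul_le_mul_of_nonneg_right (mul_le_mul_of_nonneg_left
      (pow_le_pow_left₀ (by positivity) (two_mul_nodeBase_le hn hb) k) (by positivity))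
      (by positivity)
  calc errorConstant k * errorRate k n (1 / (a : ℝ)) (1 / (b : ℝ))
      ≤ errorConstant k *
        ((k : ℝ) ^ ((k : ℝ) / 2) / (a * (b : ℝ) ^ k * √n ^ k * ((n : ℝ) + k) ^ k)) :=
        mul_le_mul_of_nonneg_left (errorRate_le hb) (errorConstant_pos k).le
    _ = 1 / (a * (k + 1) * (8 * slack k * b * √n) ^ k * ((n : ℝ) + k) ^ k) := by
        rw [errorConstant]
        simp only [mul_pow]
        field_simp
    _ ≤ _ := one_div_le_one_div_of_le hq hqe

theorem constant_mul_le_queryFailure (k b : ℕ) :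
    1 / (72 * ((k : ℝ) + 1)) * (1 / (b : ℝ)) ≤ 1 / (queryFailure k b : ℝ) := by
  rw [queryFailure, one_div_mul_one_div]
  push_cast
  exact le_rfl

end LossyBS

theorem theorem1 (k : ℕ) :
    ∃ C : ℝ, 0 < C ∧ ∃ c : ℝ, 0 < c ∧
    -- the error bounds `ε' = 1 / m` and `δ' = 1 / d` with which the oracle is called
    ∃ m d : ℕ → ℕ → ℕ → ℕ,
      (∀ n a b : ℕ, 0 < n → 0 < a → 0 < b →
        0 < m n a b ∧ 0 < d n a b ∧
        C * LossyBS.errorRate k n (1 / (a : ℝ)) (1 / (b : ℝ)) ≤ 1 / (m n a b : ℝ) ∧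
        c * (1 / (b : ℝ)) ≤ 1 / (d n a b : ℝ)) ∧
      ∃ M : LossyBS.Cmd, LossyBS.PolyTime M ∧
        ∀ (O : LossyBS.Oracle) (n p a b : ℕ), 0 < n → 0 < a → 0 < b →
          LossyBS.SolvesSigmaGPE O k n p (m n a b) (d n a b) →
          LossyBS.SolvesGPE M O n p a b := by
  refine ⟨LossyBS.errorConstant k, LossyBS.errorConstant_pos k, 1 / (72 * ((k : ℝ) + 1)),
    by positivity, fun n a b => LossyBS.queryError k n a b, fun _ _ b => LossyBS.queryFailure k b,
    fun n a b hn ha hb => ⟨LossyBS.queryError_pos hn ha, ?_,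
      LossyBS.errorConstant_mul_le hn ha hb, LossyBS.constant_mul_le_queryFailure k b⟩,
    LossyBS.program k, LossyBS.polyTime_program k,
    fun O n p a b hn ha hb hO => LossyBS.solvesGPE_program hn ha hb hO⟩
  show 0 < 72 * (k + 1) * b
  positivity
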